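/- **Setting.** Let $d,k\ge 0$ be integers, let $\mathrm{Vol}^j$ be $j$-dimensional Hausdorff measure (normalised to agree with Lebesgue measure on $j$-planes), and let $\mathfrak K\subset\mathbb R^d$. An oriented $k$-simplex $\sigma=[v_0,\dots,v_k]$ is given by affinely independent points $v_0,\dots,v_k\in\mathbb R^d$, up to even permutations; it is identified with the convex hull of its vertices when its orientation is irrelevant. For $k\ge1$, $-\sigma$ is the same simplex with the opposite orientation. $\mathfrak X^k(\mathfrak K)$ is the set of oriented $k$-simplices contained in $\mathfrak K$, and $\mathfrak X^k_{\le1}(\mathfrak K)$ the set of those of diameter at most $1$. A subdivision $\mathcal K|\sigma$ is a finite set of $k$-simplices with union $\sigma$, with the orientation of $\sigma$, whose pairwise intersections have $\mathrm{Vol}^k$ zero. For $k\ge 1$ and $\alpha\in(0,1]$ put $$h_\sigma=\min_F\ \sup_{x\in\sigma} d(x,\langle F\rangle),\qquad \mathbf m^k_\alpha(\sigma)=\max_F \mathrm{Vol}^{k-1}(F)\,h_\sigma^\alpha,$$ where $F$ runs over the $(k-1)$-dimensional faces of $\sigma$ and $\langle F\rangle$ is the affine span of $F$; for $k=0$ put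 $\mathbf m^0_\alpha=1$. For a function $A$ on $k$-simplices and a $(k+1)$-simplex $\sigma=[v_0,\dots,v_{k+1}]$ write $A(\partial\sigma)=\sum_{i}(-1)^iA([v_0,\dots,\hat v_i,\dots,v_{k+1}])$. Let $\Omega^k(\mathfrak K)$ be the set of functions $A:\mathfrak X^k(\mathfrak K)\to\mathbb R$ such that 1. $A(-\sigma)=-A(\sigma)$ for all $\sigma$ (if $k\ge 1$), 2. $A(\sigma)=\sum_{\tau\in\mathcal K}A(\tau)$ for every subdivision $\mathcal K|\sigma$, 3. $(v_0,\dots,v_k)\mapsto A([v_0,\dots,v_k])$ (set to $0$ if the $v_i$ are affinely dependent or their convex hull is not contained in $\mathfrak K$) is Borel measurable. Put $$\|A\|_{\alpha,\beta;\mathfrak K}=\sup_{\sigma\in\mathfrak X^k_{\le1}(\mathfrak K)}\frac{|A(\sigma)|}{\mathbf m^k_\alpha(\sigma)}+\sup_{\sigma\in\mathfrak X^{k+1}_{\le1}(\mathfrak K)}\frac{|A(\partial\sigma)|}{\mathbf m^{k+1}_\beta(\sigma)},\qquad \Omega^k_{(\alpha,\beta)}(\mathfrak K)=\{A\in\Omega^k(\mathfrak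 K):\|A\|_{\alpha,\beta;\mathfrak K}<\infty\}.$$ **Proposition.** Let $\mathfrak K\subset\mathbb R^d$ be compact and convex, $\tilde\alpha,\tilde\beta\in(0,1]$, $q\ge1$ an integer, and $$0<\alpha<\tilde\alpha\wedge\tilde\beta-\frac{d(k+1)}{q},\qquad 0<\beta<\tilde\beta-\frac{d(k+2)}{q}.$$ There is a constant $C<\infty$, depending only on $d,k,\mathfrak K,\tilde\alpha,\tilde\beta,q,\alpha,\beta$, such that the following holds. Let $A=(A(\sigma):\sigma\in\mathfrak X^k(\mathfrak K))$ be a family of real random variables on a probability space such that, for every finite $S\subset\mathfrak X^k(\mathfrak K)$, almost surely all those instances of relations 1 and 2 hold that involve only simplices in $S$. Assume that $$M_q:=\sup_{\sigma\in\mathfrak X^k_{\le1}(\mathfrak K)}\frac{\mathbb E|A(\sigma)|^q}{\mathbf m^k_{\tilde\alpha}(\sigma)^q}+\sup_{\sigma\in\mathfrak X^{k+1}_{\le1}(\mathfrak K)}\frac{\mathbb E|A(\partial\sigma)|^q}{\mathbf m^{k+1}_{\tilde\beta}(\sigma)^q}<\infty .$$ Then $A$ has a modification $\hat A$ (random variables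 $\hat A(\sigma)$ with $\hat A(\sigma)=A(\sigma)$ almost surely, for each $\sigma\in\mathfrak X^k(\mathfrak K)$) all of whose realisations lie in $\Omega^k_{(\alpha,\beta)}(\mathfrak K)$, such that $\|\hat A\|_{\alpha,\beta;\mathfrak K}$ is a random variable and $$\mathbb E\big[\|\hat A\|_{\alpha,\beta;\mathfrak K}^q\big]\le C\,M_q .$$ -/

import Mathlib

open MeasureTheory Set
open scoped ENNReal NNReal

/-- An ordering of the vertices of a nondegenerate `k`-simplex of `ℝ^d`: a `(k+1)`-tuple of
affinely independent points. -/
abbrev OrderedSimplex (d k : ℕ) : Type := Affine.Simplex ℝ (EuclideanSpace ℝ (Fin d)) k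

/-- Two orderings are equivalent if they differ by an even permutation of the vertices. -/
instance orientationSetoid (d k : ℕ) : Setoid (OrderedSimplex d k) where
  r s t := ∃ e : Equiv.Perm (Fin (k + 1)), Equiv.Perm.sign e = 1 ∧ s.reindex e = t
  iseqv :=
    { refl := fun s => ⟨1, by simp, by ext1 i; rfl⟩
      symm := by
        rintro s t ⟨e, he, rfl⟩
        refine ⟨e⁻¹, by simpa using he, ?_⟩
        ext1 i
        simp [Affine.Simplex.reindex, Equiv.Perm.inv_def]
      trans := by
        rintro s t u ⟨e, he, rfl⟩ ⟨f, hf, rfl⟩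
        exact ⟨f * e, by simp [he, hf], by ext1 i; rfl⟩ }

/-- Oriented `k`-simplices in `ℝ^d`. -/
def OrientedSimplex (d k : ℕ) : Type := Quotient (orientationSetoid d k)

/-- The oriented simplex `[v_0, …, v_k]`. -/
def OrderedSimplex.oriented {d k : ℕ} (s : OrderedSimplex d k) : OrientedSimplex d k :=
  Quotient.mk _ s

/-- The vertex set of an oriented simplex. -/
def OrientedSimplex.vertices {d k : ℕ} (σ : OrientedSimplex d k) :
    Set (EuclideanSpace ℝ (Fin d)) :=
  Quotient.lift (fun s : OrderedSimplex d k => range s.points)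
    (by
      rintro s t ⟨e, -, rfl⟩
      exact (e.symm.surjective.range_comp s.points).symm) σ

/-- The underlying unoriented simplex, as a subset of `ℝ^d`. -/
def OrientedSimplex.carrier {d k : ℕ} (σ : OrientedSimplex d k) :
    Set (EuclideanSpace ℝ (Fin d)) :=
  convexHull ℝ σ.vertices

/-- The oriented `k`-simplices contained in `K`. -/
def simplicesIn {d : ℕ} (k : ℕ) (K : Set (EuclideanSpace ℝ (Fin d))) :
    Set (OrientedSimplex d k) :=
  {σ | σ.carrier ⊆ K}

/-- The oriented `k`-simplices of diameter at most one contained in `K`. -/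
def smallSimplicesIn {d : ℕ} (k : ℕ) (K : Set (EuclideanSpace ℝ (Fin d))) :
    Set (OrientedSimplex d k) :=
  {σ | σ ∈ simplicesIn k K ∧ Metric.diam σ.carrier ≤ 1}

/-- `s` and `t` span the same direction, with the same orientation: the edge vectors of `t` are
obtained from those of `s` by a matrix of positive determinant. (Trivially true for `k = 0`.) -/
def SameOrientation {d k : ℕ} (s t : OrderedSimplex d k) : Prop :=
  ∃ c : Matrix (Fin k) (Fin k) ℝ,
    (∀ i, t.points i.succ - t.points 0 = ∑ j, c i j • (s.points j.succ - s.points 0)) ∧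
      0 < c.det

/-- `𝒦` is a subdivision of the oriented simplex `σ`: finitely many simplices oriented as `σ`,
pairwise non-overlapping, whose union is `σ`. Here `μHE[k]` is the `k`-dimensional Hausdorff
measure, normalised to agree with Lebesgue measure on `k`-planes. -/
structure IsSubdivision {d k : ℕ} (𝒦 : Finset (OrientedSimplex d k)) (σ : OrientedSimplex d k) :
    Prop where
  orientation : ∀ τ ∈ 𝒦, ∃ s t : OrderedSimplex d k,
    s.oriented = σ ∧ t.oriented = τ ∧ SameOrientation s t
  nonoverlapping : ∀ τ ∈ 𝒦, ∀ τ' ∈ 𝒦, τ ≠ τ' → μHE[k] (τ.carrier ∩ τ'.carrier) = 0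
  union : (⋃ τ ∈ 𝒦, τ.carrier) = σ.carrier

/-- The relations of a cochain, as far as they concern simplices in `S` only: antisymmetry under
reversal of the orientation (void for `k = 0`, where there is no odd permutation) and additivity
over subdivisions. -/
structure IsCochainOn {d k : ℕ} (S : Set (OrientedSimplex d k)) (f : OrientedSimplex d k → ℝ) :
    Prop where
  antisymm : ∀ (s : OrderedSimplex d k) (e : Equiv.Perm (Fin (k + 1))),
    Equiv.Perm.sign e = -1 → s.oriented ∈ S → OrderedSimplex.oriented (s.reindex e) ∈ S →
      f (OrderedSimplex.oriented (s.reindex e)) = - f s.oriented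
  additive : ∀ σ ∈ S, ∀ 𝒦 : Finset (OrientedSimplex d k), (𝒦 : Set (OrientedSimplex d k)) ⊆ S →
    IsSubdivision 𝒦 σ → f σ = ∑ τ ∈ 𝒦, f τ

open Classical in
/-- The value `f [v_0, …, v_k]` as a function of the tuple of vertices. It is `0` if the vertices
are affinely dependent, or if the simplex they span is not contained in `K`. -/
noncomputable def evalVertices {d k : ℕ} (K : Set (EuclideanSpace ℝ (Fin d)))
    (f : OrientedSimplex d k → ℝ) (v : Fin (k + 1) → EuclideanSpace ℝ (Fin d)) : ℝ :=
  if h : AffineIndependent ℝ v ∧ convexHull ℝ (range v) ⊆ K then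
    f (OrderedSimplex.oriented ⟨v, h.1⟩) else 0

/-- The space `Ω^k(K)` of measurable cochains on the simplices in `K`. Functions on simplices in `K`
are represented by functions on all simplices, whose values at simplices not contained in `K`
are never looked at. -/
def cochains {d : ℕ} (k : ℕ) (K : Set (EuclideanSpace ℝ (Fin d))) :
    Set (OrientedSimplex d k → ℝ) :=
  {f | IsCochainOn (simplicesIn k K) f ∧ Measurable (evalVertices K f)}

/-- The face of `[v_0, …, v_{k+1}]` obtained by leaving out `v_i` (without the sign). -/
def oppositeFace {d k : ℕ} (s : OrderedSimplex d (k + 1)) (i : Fin (k + 2)) :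
    OrderedSimplex d k :=
  ⟨s.points ∘ i.succAbove, s.independent.comp_embedding i.succAboveEmb⟩

/-- `f (∂ [v_0, …, v_{k+1}]) = ∑ i, (-1)^i f [v_0, …, v_{i-1}, v_{i+1}, …, v_{k+1}]`. -/
def boundaryValue {d k : ℕ} (f : OrientedSimplex d k → ℝ) (s : OrderedSimplex d (k + 1)) : ℝ :=
  ∑ i : Fin (k + 2), (-1) ^ (i : ℕ) * f (oppositeFace s i).oriented

/-- The smallest height `h` of the simplex with vertex set `V`: the minimum over its boundary faces
`F` of the largest distance of a point of the simplex to the affine span of `F`. -/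
noncomputable def minHeight {d : ℕ} (V : Set (EuclideanSpace ℝ (Fin d))) : ℝ≥0∞ :=
  ⨅ v ∈ V, ⨆ x ∈ convexHull ℝ V,
    Metric.infEDist x (affineSpan ℝ (V \ {v}) : Set (EuclideanSpace ℝ (Fin d)))

/-- The `α`-mass of the `k`-simplex with vertex set `V`: the largest `(k-1)`-volume of a boundary
face, times the `α`-th power of the smallest height. For `k = 0` the mass is `1`. -/
noncomputable def simplexMass {d : ℕ} (α : ℝ) : ℕ → Set (EuclideanSpace ℝ (Fin d)) → ℝ≥0∞
  | 0, _ => 1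
  | k + 1, V => (⨆ v ∈ V, μHE[k] (convexHull ℝ (V \ {v}))) * minHeight V ^ α

/-- The norm `‖f‖_{α; K}`. -/
noncomputable def massNorm {d k : ℕ} (α : ℝ) (K : Set (EuclideanSpace ℝ (Fin d)))
    (f : OrientedSimplex d k → ℝ) : ℝ≥0∞ :=
  ⨆ σ ∈ smallSimplicesIn k K, ‖f σ‖ₑ / simplexMass α k σ.vertices

/-- The norm `‖∂f‖_{β; K}`. The supremum is over orderings of the vertices; for a cochain `f` the
quotient depends on the oriented simplex only. -/
noncomputable def boundaryMassNorm {d k : ℕ} (β : ℝ) (K : Set (EuclideanSpace ℝ (Fin d)))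
    (f : OrientedSimplex d k → ℝ) : ℝ≥0∞ :=
  ⨆ (s : OrderedSimplex d (k + 1)) (_ : s.oriented ∈ smallSimplicesIn (k + 1) K),
    ‖boundaryValue f s‖ₑ / simplexMass β (k + 1) s.oriented.vertices

/-- The norm `‖f‖_{α,β; K}`. -/
noncomputable def flatNorm {d k : ℕ} (α β : ℝ) (K : Set (EuclideanSpace ℝ (Fin d)))
    (f : OrientedSimplex d k → ℝ) : ℝ≥0∞ :=
  massNorm α K f + boundaryMassNorm β K f

/-- The space `Ω^k_{(α,β)}(K)`. -/
def flatCochains {d : ℕ} (k : ℕ) (α β : ℝ) (K : Set (EuclideanSpace ℝ (Fin d))) :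
    Set (OrientedSimplex d k → ℝ) :=
  {f | f ∈ cochains k K ∧ flatNorm α β K f < ∞}

/-- The quantity `M_q` of a random field: the sum of the suprema, over simplices in `K` of diameter
at most one, of `E|A(σ)|^q / m_α(σ)^q` and of `E|A(∂σ)|^q / m_β(σ)^q`. -/
noncomputable def momentBound {d k : ℕ} {Ω : Type*} [MeasurableSpace Ω] (P : Measure Ω)
    (q : ℕ) (α β : ℝ) (K : Set (EuclideanSpace ℝ (Fin d)))
    (A : OrientedSimplex d k → Ω → ℝ) : ℝ≥0∞ :=
  (⨆ σ ∈ smallSimplicesIn k K,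
      (∫⁻ ω, ‖A σ ω‖ₑ ^ q ∂P) / simplexMass α k σ.vertices ^ q) +
    ⨆ (s : OrderedSimplex d (k + 1)) (_ : s.oriented ∈ smallSimplicesIn (k + 1) K),
      (∫⁻ ω, ‖boundaryValue (fun σ => A σ ω) s‖ₑ ^ q ∂P) /
        simplexMass β (k + 1) s.oriented.vertices ^ q

/-! The proof is a Kolmogorov continuity argument for cochains. A cochain is viewed as a function g
of vertex tuples, and the cochain relations are condensed into flatness (`IsFlatCochain`): g and its
alternating coboundary vanish on affinely dependent tuples.

Cochains are flat. For k+2 dependent points, a Radon point lies in the convex hull of every face;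
additivity over the star subdivision at that point writes g on each face as the coboundary of one
and the same cone function, so the coboundary of g is a double coboundary, hence zero
(`exists_finset_coboundary_eq_zero`). Only finitely many relations enter, so this holds almost
surely for each tuple. Conversely, an alternating flat function is additive over every subdivision
(`IsFlatCochain.eq_sum_of_isSubdivision`): a linear relation between oriented indicators of
simplicial cones is inherited by g, by coning and induction on the dimension
(`sum_eq_zero_of_sum_indicator_eq_zero`).

Flatness also yields regularity. Moving one vertex changes g by its coboundary on one (k+1)-simplex
plus its values on k further k-simplices, all of which contain both the old and the new position of
that vertex (`IsFlatCochain.sub_update`). If these are both δ-close to one point, such simplices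
have height at most 2δ, so their masses carry a factor of order δ^β or δ^α (`IsFlatCochain.sub_le`).

Now discretise at meshes 2^(-n). Level n has of the order of 2^(nd(k+1)) k-simplices, and weighting
the q-th moments by 2^(-n(α'-α)q) makes the sum over all levels finite in mean, by the condition on
α; the same works for the coboundary with k+2 and β. Where this sum is finite, the values of g on
discretised tuples converge geometrically to a flat, alternating, continuous function. To bound it
by the mass, start the comparison at the level whose mesh is comparable to the height of the simplex
(`IsDyadicCochain.abs_limit_le`).

The algebra and the increment estimate hold for values in any group with a subadditive function.
Applied to classes of random variables with the L^q norm, they show that the limit is a modification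
(`IsRandomFlatCochain.ae_eq_of_tendsto`), and that moment bounds for diameter at most one extend to
all of K by bisecting long edges (`IsFlatCochain.le_of_small`). -/

/-! ### Alternating coboundary on tuples -/

section Coboundary

variable {X B : Type*} [AddCommGroup B]

/-- The alternating sum of the values of `g` on the faces of a tuple. -/
def coboundary {n : ℕ} (g : (Fin n → X) → B) (u : Fin (n + 1) → X) : B :=
  ∑ i : Fin (n + 1), (-1 : ℤ) ^ (i : ℕ) • g (i.removeNth u)

theorem succ_removeNth_cons {n : ℕ} (e : X) (v : Fin (n + 1) → X) (i : Fin (n + 1)) :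
    i.succ.removeNth (Fin.cons e v : Fin (n + 2) → X) = Fin.cons e (i.removeNth v) := by
  funext j
  refine Fin.cases ?_ (fun j => ?_) j <;> simp [Fin.removeNth]

theorem zero_removeNth_cons {n : ℕ} (e : X) (v : Fin n → X) :
    (0 : Fin (n + 1)).removeNth (Fin.cons e v : Fin (n + 1) → X) = v := by
  funext j
  simp [Fin.removeNth]

/-- The homotopy formula of the cone with apex e: the face opposite the apex is g v, the others are
cones over the faces of v. All coning arguments below rest on it. -/
theorem coboundary_cons {n : ℕ} (g : (Fin (n + 1) → X) → B) (e : X) (v : Fin (n + 1) → X) :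
    coboundary g (Fin.cons e v : Fin (n + 2) → X) =
      g v - coboundary (fun w => g (Fin.cons e w : Fin (n + 1) → X)) v := by
  unfold coboundary
  rw [Fin.sum_univ_succ]
  simp only [succ_removeNth_cons, zero_removeNth_cons, Fin.val_zero, pow_zero, one_smul,
    Fin.val_succ, pow_succ, mul_neg, mul_one, neg_smul, Finset.sum_neg_distrib]
  rw [sub_eq_add_neg]

theorem coboundary_sub {n : ℕ} (g h : (Fin n → X) → B) (u : Fin (n + 1) → X) :
    coboundary (fun w => g w - h w) u = coboundary g u - coboundary h u := by
  simp [coboundary, smul_sub, Finset.sum_sub_distrib]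

/-- Splitting off the first point with `coboundary_cons` twice leaves the double coboundary of the
cone function, which has one argument fewer; induction then replaces the usual sign cancellation. -/
theorem coboundary_coboundary {n : ℕ} (g : (Fin n → X) → B) (u : Fin (n + 2) → X) :
    coboundary (coboundary g) u = 0 := by
  induction n with
  | zero =>
    simp only [coboundary, Fin.sum_univ_succ, Finset.univ_eq_empty, Finset.sum_empty]
    simp only [Fin.val_zero, pow_zero, one_smul, add_zero, Fin.val_succ, zero_add, pow_one]
    rw [Subsingleton.elim (Fin.removeNth 0 (Fin.removeNth (Fin.succ 0) u))
      (Fin.removeNth 0 (Fin.removeNth 0 u))]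
    simp
  | succ n ih =>
    rw [← Fin.cons_self_tail u, coboundary_cons]
    simp only [coboundary_cons]
    rw [coboundary_sub, ih]
    simp

end Coboundary

/-! ### Tuples with entries in a set -/

section TupleMem

variable {X : Type*}

theorem forall_cons_mem {n : ℕ} {S : Set X} {w : X} {v : Fin n → X} (hw : w ∈ S)
    (hv : ∀ i, v i ∈ S) : ∀ i, (Fin.cons w v : Fin (n + 1) → X) i ∈ S := by
  intro i
  refine Fin.cases ?_ (fun j => ?_) i
  · simpa using hw
  · simpa using hv j

theorem forall_update_mem {n : ℕ} {S : Set X} {w : X} {v : Fin n → X} (hw : w ∈ S)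
    (hv : ∀ i, v i ∈ S) (j : Fin n) : ∀ i, Function.update v j w i ∈ S := by
  intro i
  by_cases h : i = j
  · subst h; simpa using hw
  · simpa [h] using hv i

end TupleMem

/-! ### Flat cochains: exchange of a vertex and bisection of an edge -/

section FlatCochain

variable {E B : Type*} [AddCommGroup E] [Module ℝ E] [AddCommGroup B]

theorem not_affineIndependent_of_eq {ι : Type*} {v : ι → E} {i j : ι} (hij : i ≠ j)
    (h : v i = v j) : ¬ AffineIndependent ℝ v :=
  fun hv => hij (hv.injective h)

theorem not_affineIndependent_of_mem_affineSpan {n : ℕ} {v : Fin (n + 1) → E} (i : Fin (n + 1))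
    {s : Set E} (hs : s ⊆ range (i.removeNth v)) (h : v i ∈ affineSpan ℝ s) :
    ¬ AffineIndependent ℝ v := by
  intro hv
  have := hv.notMem_affineSpan_sdiff i univ
  refine this (affineSpan_mono ℝ ?_ h)
  refine hs.trans ?_
  rintro _ ⟨j, rfl⟩
  exact ⟨i.succAbove j, by simp, rfl⟩

/-- A function of `n`-tuples which vanishes on degenerate tuples, and whose coboundary vanishes on
degenerate tuples. -/
structure IsFlatCochain {n : ℕ} (S : Set E) (g : (Fin n → E) → B) : Prop where
  degenerate : ∀ v : Fin n → E, (∀ i, v i ∈ S) → ¬ AffineIndependent ℝ v → g v = 0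
  closed : ∀ u : Fin (n + 1) → E, (∀ i, u i ∈ S) → ¬ AffineIndependent ℝ u → coboundary g u = 0

theorem IsFlatCochain.coboundary_isFlat {n : ℕ} {S : Set E} {g : (Fin n → E) → B}
    (h : IsFlatCochain S g) : IsFlatCochain S (coboundary g) :=
  ⟨h.closed, fun u _ _ => coboundary_coboundary g u⟩

/-- In the tuple (w, v with v_i replaced by w) the point w occurs twice, so the coboundary vanishes
there; all faces that keep both copies vanish as well, and just two faces remain. This much
antisymmetry is thus a consequence of flatness. -/
theorem IsFlatCochain.update_eq {n : ℕ} {S : Set E} {g : (Fin (n + 1) → E) → B}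
    (h : IsFlatCochain S g) {v : Fin (n + 1) → E} (hv : ∀ i, v i ∈ S) {w : E} (hw : w ∈ S)
    (i : Fin (n + 1)) :
    g (Function.update v i w) =
      (-1 : ℤ) ^ (i : ℕ) • g (Fin.cons w (i.removeNth v) : Fin (n + 1) → E) := by
  have h1 := h.closed (Fin.cons w (Function.update v i w) : Fin (n + 2) → E)
    (forall_cons_mem hw (forall_update_mem hw hv i))
    (not_affineIndependent_of_eq (i := 0) (j := i.succ) (Fin.succ_ne_zero i).symm (by simp))
  rw [coboundary_cons, sub_eq_zero] at h1
  rw [h1]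
  unfold coboundary
  rw [Finset.sum_eq_single i]
  · simp
  · intro l _ hl
    beta_reduce
    rw [h.degenerate, smul_zero]
    · exact forall_cons_mem hw fun j => forall_update_mem hw hv i _
    · obtain ⟨j, rfl⟩ := Fin.exists_succAbove_eq hl.symm
      refine not_affineIndependent_of_eq (i := 0) (j := j.succ) (Fin.succ_ne_zero j).symm ?_
      simp
  · simp

/-- Every simplex on the right contains both w and v_i. When these two points are close the
simplices are thin, which is the source of all smallness in the increment estimates. -/
theorem IsFlatCochain.sub_update {n : ℕ} {S : Set E} {g : (Fin (n + 1) → E) → B}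
    (h : IsFlatCochain S g) {v : Fin (n + 1) → E} (hv : ∀ i, v i ∈ S) {w : E} (hw : w ∈ S)
    (i : Fin (n + 1)) :
    g v - g (Function.update v i w) = coboundary g (Fin.cons w v : Fin (n + 2) → E) +
      ∑ l ∈ Finset.univ.erase i,
        (-1 : ℤ) ^ (l : ℕ) • g (Fin.cons w (l.removeNth v) : Fin (n + 1) → E) := by
  rw [h.update_eq hv hw i, coboundary_cons, coboundary,
    ← Finset.add_sum_erase _ _ (Finset.mem_univ i)]
  abel

/-- Since e lies on the line through v_a and v_b, the tuple (e, v) is degenerate, and so is each of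
its faces that keeps e, v_a and v_b. The surviving faces are v and its two halves. -/
theorem IsFlatCochain.bisect {n : ℕ} {S : Set E} {g : (Fin (n + 1) → E) → B}
    (h : IsFlatCochain S g) {v : Fin (n + 1) → E} (hv : ∀ i, v i ∈ S) {a b : Fin (n + 1)}
    (hab : a ≠ b) {e : E} (he : e ∈ S) (hspan : e ∈ affineSpan ℝ {v a, v b}) :
    g v = g (Function.update v a e) + g (Function.update v b e) := by
  have key : ∀ {m : ℕ} (t : Fin m → E), v a ∈ range t → v b ∈ range t →
      ¬ AffineIndependent ℝ (Fin.cons e t : Fin (m + 1) → E) := by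
    intro m t ha hb
    refine not_affineIndependent_of_mem_affineSpan 0 (s := {v a, v b}) ?_ (by simpa using hspan)
    rw [zero_removeNth_cons]
    exact insert_subset ha (singleton_subset_iff.2 hb)
  have h1 := h.closed (Fin.cons e v : Fin (n + 2) → E) (forall_cons_mem he hv)
    (key v ⟨a, rfl⟩ ⟨b, rfl⟩)
  rw [coboundary_cons, sub_eq_zero] at h1
  rw [h1, h.update_eq hv he, h.update_eq hv he, coboundary,
    ← Finset.add_sum_erase _ _ (Finset.mem_univ a), ← Finset.add_sum_erase _ _
      (Finset.mem_erase.2 ⟨hab.symm, Finset.mem_univ b⟩), Finset.sum_eq_zero, add_zero]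
  intro l hl
  simp only [Finset.mem_erase, Finset.mem_univ, and_true] at hl
  rw [h.degenerate, smul_zero]
  · exact forall_cons_mem he fun j => hv _
  · obtain ⟨i, hi⟩ := Fin.exists_succAbove_eq hl.1.symm
    obtain ⟨j, hj⟩ := Fin.exists_succAbove_eq hl.2.symm
    exact key _ ⟨j, by simp [Fin.removeNth, hj]⟩ ⟨i, by simp [Fin.removeNth, hi]⟩

end FlatCochain

/-! ### Relations between oriented indicators of simplicial cones -/

section OpenCone

open Filter Topology

variable {W : Type*} [AddCommGroup W] [Module ℝ W]

/-- The positive linear combinations of a tuple of vectors. -/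
def openCone {n : ℕ} (τ : Fin n → W) : Set W :=
  {x | ∃ a : Fin n → ℝ, (∀ i, 0 < a i) ∧ x = ∑ i, a i • τ i}

theorem sum_smul_mem_openCone_iff {n : ℕ} {τ : Fin n → W} (hτ : LinearIndependent ℝ τ)
    (a : Fin n → ℝ) : ∑ i, a i • τ i ∈ openCone τ ↔ ∀ i, 0 < a i := by
  constructor
  · rintro ⟨b, hb, h⟩ i
    have := hτ.eq_coords_of_eq h i
    rw [this]; exact hb i
  · exact fun h => ⟨a, h, rfl⟩

theorem sum_smul_succAbove {n : ℕ} (τ : Fin (n + 1) → W) (a : Fin (n + 1) → ℝ) (i : Fin (n + 1)) :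
    ∑ l, a l • τ l = a i • τ i + ∑ l, a (i.succAbove l) • i.removeNth τ l := by
  rw [Fin.sum_univ_succAbove _ i]; rfl

/-- Cramer's rule: by alternation only the i-th term of the combination survives, and moving it to
the front costs the sign. -/
theorem map_cons_removeNth {n : ℕ} (D : W [⋀^Fin (n + 1)]→ₗ[ℝ] ℝ) (τ : Fin (n + 1) → W)
    (b : Fin (n + 1) → ℝ) (i : Fin (n + 1)) :
    D (Fin.cons (∑ l, b l • τ l) (i.removeNth τ) : Fin (n + 1) → W) =
      (-1) ^ (i : ℕ) * (b i * D τ) := by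
  have h1 : D (Function.update τ i (∑ l, b l • τ l)) = b i * D τ := by
    rw [D.map_update_sum]
    rw [Finset.sum_eq_single i]
    · rw [D.map_update_smul]; simp
    · intro l _ hl
      rw [D.map_update_smul, D.map_update_self _ hl.symm, smul_zero]
    · simp
  rw [← h1, ← Fin.insertNth_removeNth, D.map_insertNth]
  have hz : (-1 : ℝ) ^ (i : ℕ) = (((-1 : ℤ) ^ (i : ℕ) : ℤ) : ℝ) := by push_cast; rfl
  rw [hz]
  rcases neg_one_pow_eq_or ℤ (i : ℕ) with h | h <;> simp [h, Matrix.vecCons]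

/-- Jump of the oriented indicator when crossing y in direction ν. If no coordinate of y vanishes,
nothing changes for small t. If only the i-th vanishes, one of y ± tν lies in the cone exactly when
y lies in the open cone of the i-th facet, and the sign of b_i says which; the sign of D on (ν,
facet) records this. -/
theorem eventually_openCone_jump {n : ℕ} {τ : Fin (n + 1) → W} (hτ : LinearIndependent ℝ τ)
    (D : W [⋀^Fin (n + 1)]→ₗ[ℝ] ℝ) (a b : Fin (n + 1) → ℝ) (hab : ∀ i, a i = 0 → b i ≠ 0)
    (huniq : ∀ i i', a i = 0 → a i' = 0 → i = i') :
    ∀ᶠ t : ℝ in 𝓝[>] 0,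
      (SignType.sign (D τ) : ℝ) *
        ((openCone τ).indicator 1 (∑ l, a l • τ l + t • ∑ l, b l • τ l) -
          (openCone τ).indicator 1 (∑ l, a l • τ l - t • ∑ l, b l • τ l)) =
      ∑ i with a i = 0, (-1 : ℝ) ^ (i : ℕ) *
        (SignType.sign (D (Fin.cons (∑ l, b l • τ l) (i.removeNth τ) : Fin (n + 1) → W)) : ℝ) *
          (openCone (i.removeNth τ)).indicator 1 (∑ l, a l • τ l) := by
  classical
  have hadd : ∀ t : ℝ, (∑ l, a l • τ l + t • ∑ l, b l • τ l) = ∑ l, (a l + t * b l) • τ l := by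
    intro t; simp [Finset.smul_sum, add_smul, mul_smul, Finset.sum_add_distrib]
  have hsub : ∀ t : ℝ, (∑ l, a l • τ l - t • ∑ l, b l • τ l) = ∑ l, (a l - t * b l) • τ l := by
    intro t; simp [Finset.smul_sum, sub_smul, mul_smul, Finset.sum_sub_distrib]
  have hsgn : ∀ i, a i ≠ 0 → ∀ᶠ t : ℝ in 𝓝[>] 0,
      ((0 < a i + t * b i ↔ 0 < a i) ∧ (0 < a i - t * b i ↔ 0 < a i)) := by
    intro i hi
    have h1 : Tendsto (fun t : ℝ => a i + t * b i) (𝓝[>] 0) (𝓝 (a i)) := by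
      have : Tendsto (fun t : ℝ => a i + t * b i) (𝓝 0) (𝓝 (a i + 0 * b i)) := by
        apply Continuous.tendsto; fun_prop
      simpa using this.mono_left nhdsWithin_le_nhds
    have h2 : Tendsto (fun t : ℝ => a i - t * b i) (𝓝[>] 0) (𝓝 (a i)) := by
      have : Tendsto (fun t : ℝ => a i - t * b i) (𝓝 0) (𝓝 (a i - 0 * b i)) := by
        apply Continuous.tendsto; fun_prop
      simpa using this.mono_left nhdsWithin_le_nhds
    rcases lt_or_gt_of_ne hi with h | h
    · filter_upwards [h1.eventually_lt_const h, h2.eventually_lt_const h] with t h3 h4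
      exact ⟨⟨fun h' => absurd h' h3.not_gt, fun h' => absurd h' h.not_gt⟩,
        ⟨fun h' => absurd h' h4.not_gt, fun h' => absurd h' h.not_gt⟩⟩
    · filter_upwards [h1.eventually_const_lt h, h2.eventually_const_lt h] with t h3 h4
      exact ⟨⟨fun _ => h, fun _ => h3⟩, ⟨fun _ => h, fun _ => h4⟩⟩
  have hall : ∀ᶠ t : ℝ in 𝓝[>] 0, ∀ i, a i ≠ 0 →
      ((0 < a i + t * b i ↔ 0 < a i) ∧ (0 < a i - t * b i ↔ 0 < a i)) := by
    rw [eventually_all]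
    intro i
    by_cases hi : a i = 0
    · exact Eventually.of_forall fun t h => absurd hi h
    · filter_upwards [hsgn i hi] with t ht _ using ht
  filter_upwards [hall, self_mem_nhdsWithin] with t ht htpos
  rw [mem_Ioi] at htpos
  rw [hadd, hsub]
  simp only [indicator, sum_smul_mem_openCone_iff hτ, Pi.one_apply]
  by_cases hex : ∃ i, a i = 0
  · obtain ⟨i, hi⟩ := hex
    have hfilter : (Finset.univ.filter fun l => a l = 0) = {i} := by
      ext l
      simp only [Finset.mem_filter, Finset.mem_univ, true_and, Finset.mem_singleton]
      exact ⟨fun h => huniq _ _ h hi, fun h => h ▸ hi⟩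
    rw [hfilter, Finset.sum_singleton, map_cons_removeNth, sum_smul_succAbove τ a i, hi, zero_smul,
      zero_add]
    have hind : LinearIndependent ℝ (i.removeNth τ) := hτ.comp _ Fin.succAbove_right_injective
    rw [sum_smul_mem_openCone_iff hind]
    have hne : ∀ l, a (i.succAbove l) ≠ 0 := fun l h => Fin.succAbove_ne i l (huniq _ _ h hi)
    have e1 : (∀ l, 0 < a l + t * b l) ↔ (0 < b i ∧ ∀ l, 0 < a (i.succAbove l)) := by
      rw [Fin.forall_iff_succAbove i, hi, zero_add, mul_pos_iff_of_pos_left htpos]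
      exact and_congr_right fun _ => forall_congr' fun l => (ht _ (hne l)).1
    have e2 : (∀ l, 0 < a l - t * b l) ↔ (b i < 0 ∧ ∀ l, 0 < a (i.succAbove l)) := by
      have hneg : t * b i < 0 ↔ b i < 0 :=
        ⟨fun h => by nlinarith, fun h => mul_neg_of_pos_of_neg htpos h⟩
      rw [Fin.forall_iff_succAbove i, hi, zero_sub, neg_pos, hneg]
      exact and_congr_right fun _ => forall_congr' fun l => (ht _ (hne l)).2
    rw [if_congr e1 rfl rfl, if_congr e2 rfl rfl]
    by_cases hp : ∀ l, 0 < a (i.succAbove l)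
    · have hs : ((-1 : ℝ) ^ (i : ℕ)) * ((SignType.sign ((-1 : ℝ) ^ (i : ℕ) * (b i * D τ)) : SignType) : ℝ)
          = (SignType.sign (b i) : ℝ) * (SignType.sign (D τ) : ℝ) := by
        rcases neg_one_pow_eq_or ℝ (i : ℕ) with h | h <;> simp [h, sign_mul, Left.sign_neg]
      rw [hs]
      rcases lt_or_gt_of_ne (hab i hi) with h | h
      · simp [hp, h, h.not_gt, sign_neg]
      · simp [hp, h, h.not_gt, sign_pos]
    · simp [hp]
  · push Not at hex
    rw [Finset.filter_false_of_mem (fun i _ => hex i), Finset.sum_empty]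
    have e1 : (∀ l, 0 < a l + t * b l) ↔ ∀ l, 0 < a l - t * b l :=
      forall_congr' fun l => (ht l (hex l)).1.trans (ht l (hex l)).2.symm
    rw [if_congr e1 rfl rfl, sub_self, mul_zero]

/-- Apart from t = 0, a line through y in direction ±ν meets N at most once, unless it lies in N; so
small positive t avoid N. -/
theorem eventually_add_smul_notMem {N : Submodule ℝ W} {y ν : W} (h : y ∈ N → ν ∉ N) :
    ∀ᶠ t : ℝ in 𝓝[>] 0, y + t • ν ∉ N ∧ y - t • ν ∉ N := by
  have key : ∀ ν : W, (y ∈ N → ν ∉ N) → {t : ℝ | t ≠ 0 ∧ y + t • ν ∈ N}.Subsingleton := by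
    rintro ν h t ⟨ht0, ht⟩ s ⟨hs0, hs⟩
    by_contra hne
    have h1 : (t - s) • ν ∈ N := by
      have := N.sub_mem ht hs
      rwa [add_sub_add_left_eq_sub, ← sub_smul] at this
    have h2 : ν ∈ N := by
      have := N.smul_mem (t - s)⁻¹ h1
      rwa [smul_smul, inv_mul_cancel₀ (sub_ne_zero.2 hne), one_smul] at this
    refine h ?_ h2
    have := N.sub_mem ht (N.smul_mem t h2)
    rwa [add_sub_cancel_right] at this
  have hev : ∀ s : Set ℝ, s.Subsingleton → ∀ᶠ t : ℝ in 𝓝[>] 0, t ∉ s ∨ t = 0 := by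
    intro s hs
    have : (s \ {0})ᶜ ∈ 𝓝 (0 : ℝ) := (hs.finite.subset sdiff_subset).isClosed.isOpen_compl.mem_nhds
      (by simp)
    filter_upwards [nhdsWithin_le_nhds this] with t ht
    by_contra! hc
    exact ht ⟨hc.1, hc.2⟩
  filter_upwards [hev _ (key ν h), hev _ (key (-ν) fun h' => by simpa using h h'),
    self_mem_nhdsWithin] with t h1 h2 h3
  rw [mem_Ioi] at h3
  constructor
  · intro h4
    rcases h1 with h1 | h1
    · exact h1 ⟨h3.ne', h4⟩
    · exact h3.ne' h1
  · intro h4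
    rcases h2 with h2 | h2
    · exact h2 ⟨h3.ne', by simpa [sub_eq_add_neg] using h4⟩
    · exact h3.ne' h2

theorem exists_coords {n : ℕ} {τ : Fin n → W} {U : Submodule ℝ W}
    (hU : Module.finrank ℝ U = n) [FiniteDimensional ℝ W] (hτ : LinearIndependent ℝ τ)
    (hmem : ∀ i, τ i ∈ U) {x : W} (hx : x ∈ U) : ∃ a : Fin n → ℝ, x = ∑ i, a i • τ i := by
  have h1 : Submodule.span ℝ (range τ) = U := by
    refine Submodule.eq_of_le_of_finrank_eq (Submodule.span_le.2 ?_) ?_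
    · rintro _ ⟨i, rfl⟩; exact hmem i
    · rw [finrank_span_eq_card hτ, hU, Fintype.card_fin]
  rw [← h1, Submodule.mem_span_range_iff_exists_fun] at hx
  obtain ⟨a, ha⟩ := hx
  exact ⟨a, ha.symm⟩

/-- If the oriented indicator functions of a family of simplicial cones of top dimension in `U`
sum up to zero, then so do the values of any function which vanishes on dependent tuples and whose
coboundary vanishes in `U`. -/
theorem sum_eq_zero_of_sum_indicator_eq_zero [FiniteDimensional ℝ W] {n : ℕ} {ι : Type*}
    (U : Submodule ℝ W) (hU : Module.finrank ℝ U = n) (K : Set W) (f : (Fin n → W) → ℝ)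
    (D : W [⋀^Fin n]→ₗ[ℝ] ℝ)
    (hD : ∀ v : Fin n → W, (∀ i, v i ∈ U) → LinearIndependent ℝ v → D v ≠ 0)
    (hf0 : ∀ v : Fin n → W, (∀ i, v i ∈ U) → (∀ i, v i ∈ K) → ¬ LinearIndependent ℝ v → f v = 0)
    (hf1 : ∀ u : Fin (n + 1) → W, (∀ i, u i ∈ U) → (∀ i, u i ∈ K) → coboundary f u = 0)
    (J : Finset ι) (τ : ι → Fin n → W) (hτU : ∀ j ∈ J, ∀ i, τ j i ∈ U)
    (hτK : ∀ j ∈ J, ∀ i, τ j i ∈ K) (hτ : ∀ j ∈ J, LinearIndependent ℝ (τ j)) (c : ι → ℝ)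
    (𝒩 : Set (Submodule ℝ W)) (h𝒩 : 𝒩.Finite) (hne : ∀ N ∈ 𝒩, ¬ U ≤ N)
    (hsum : ∀ x ∈ U, (∀ N ∈ 𝒩, x ∉ N) →
      ∑ j ∈ J, c j * (SignType.sign (D (τ j)) : ℝ) * (openCone (τ j)).indicator 1 x = 0) :
    ∑ j ∈ J, c j * f (τ j) = 0 := by
  classical
  induction n generalizing ι U 𝒩 with
  | zero =>
    -- In dimension zero U is trivial, so `hne` forces 𝒩 to be empty and the origin is an admissible
    -- test point. It lies in every cone, and the relation reduces to the vanishing of the sum of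
    -- the c j.
    have hs := hsum 0 U.zero_mem (fun N hN _ => hne N hN (by
      rw [Submodule.finrank_eq_zero.1 hU]; exact bot_le))
    have hc : ∀ j, (0 : W) ∈ openCone (τ j) := fun j => ⟨0, fun i => i.elim0, by simp⟩
    have hDj : ∀ j, D (τ j) = D default := fun j => congrArg D (Subsingleton.elim _ _)
    have hfj : ∀ j, f (τ j) = f default := fun j => congrArg f (Subsingleton.elim _ _)
    simp only [indicator_of_mem (hc _), Pi.one_apply, mul_one, hDj, ← Finset.sum_mul] at hs
    simp only [hfj, ← Finset.sum_mul]
    have h0 : D default ≠ 0 := hD default (fun i => i.elim0) linearIndependent_empty_type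
    rcases mul_eq_zero.1 hs with h | h
    · rw [h, zero_mul]
    · rcases lt_or_gt_of_ne h0 with h' | h' <;> simp [h'] at h
  | succ n ih =>
    rcases J.eq_empty_or_nonempty with rfl | ⟨j₀, hj₀⟩
    · simp
    -- Any vertex serves as apex: as the coboundary of f vanishes in U, f is the coboundary of its
    -- cone function F with apex o, and the claim becomes one about facets.
    set o := τ j₀ 0
    have hoU : o ∈ U := hτU j₀ hj₀ 0
    have hoK : o ∈ K := hτK j₀ hj₀ 0
    set F : (Fin n → W) → ℝ := fun w => f (Fin.cons o w : Fin (n + 1) → W) with hF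
    have hcone : ∀ v : Fin (n + 1) → W, (∀ i, v i ∈ U) → (∀ i, v i ∈ K) →
        f v = coboundary F v := by
      intro v hvU hvK
      have := hf1 (Fin.cons o v : Fin (n + 2) → W) (forall_cons_mem hoU hvU)
        (forall_cons_mem hoK hvK)
      rwa [coboundary_cons, sub_eq_zero] at this
    set H : ι × Fin (n + 1) → Submodule ℝ W :=
      fun p => Submodule.span ℝ (range (p.2.removeNth (τ p.1))) with hH
    have hface : ∀ j ∈ J, ∀ i : Fin (n + 1), LinearIndependent ℝ (i.removeNth (τ j)) :=
      fun j hj i => (hτ j hj).comp _ Fin.succAbove_right_injective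
    have hHU : ∀ p ∈ J ×ˢ Finset.univ, H p ≤ U := by
      rintro ⟨j, i⟩ hp
      refine Submodule.span_le.2 ?_
      rintro _ ⟨l, rfl⟩
      exact hτU j (Finset.mem_product.1 hp).1 _
    have hHrank : ∀ p ∈ J ×ˢ Finset.univ, Module.finrank ℝ (H p) = n := by
      rintro ⟨j, i⟩ hp
      rw [hH]
      simp only
      rw [finrank_span_eq_card (hface j (Finset.mem_product.1 hp).1 i), Fintype.card_fin]
    have hnotin : ∀ j ∈ J, ∀ i : Fin (n + 1), τ j i ∉ H (j, i) := by
      intro j hj i hmem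
      refine (hτ j hj).notMem_span_image (s := {i}ᶜ) (x := i) (by simp) ?_
      refine Submodule.span_mono ?_ hmem
      rintro _ ⟨l, rfl⟩
      exact ⟨i.succAbove l, by simp, rfl⟩
    have hexp : ∑ j ∈ J, c j * f (τ j) =
        ∑ p ∈ J ×ˢ (Finset.univ : Finset (Fin (n + 1))), (c p.1 * (-1) ^ (p.2 : ℕ)) * F (p.2.removeNth (τ p.1)) := by
      rw [Finset.sum_product]
      refine Finset.sum_congr rfl fun j hj => ?_
      rw [hcone _ (hτU j hj) (hτK j hj), coboundary, Finset.mul_sum]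
      refine Finset.sum_congr rfl fun i _ => ?_
      simp [mul_assoc]
    -- Facets are grouped by the hyperplane they span. Each group sums to zero separately, by the
    -- induction hypothesis in that hyperplane.
    rw [hexp, ← Finset.sum_fiberwise_of_maps_to (g := H)
      (t := (J ×ˢ Finset.univ).image H) (fun p hp => Finset.mem_image_of_mem _ hp)]
    refine Finset.sum_eq_zero fun H₀ hH₀ => ?_
    obtain ⟨⟨j₁, i₁⟩, hp₁, rfl⟩ := Finset.mem_image.1 hH₀
    have hj₁ : j₁ ∈ J := (Finset.mem_product.1 hp₁).1
    set ν := τ j₁ i₁ with hν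
    have hνU : ν ∈ U := hτU j₁ hj₁ i₁
    have hνH : ν ∉ H (j₁, i₁) := hnotin j₁ hj₁ i₁
    have hHne : ¬ U ≤ H (j₁, i₁) := fun h => hνH (h hνU)
    have hdep : ∀ u : Fin (n + 1) → W, (∀ i, u i ∈ H (j₁, i₁)) → ¬ LinearIndependent ℝ u := by
      intro u hu hind
      have h1 : Submodule.span ℝ (range u) ≤ H (j₁, i₁) := by
        refine Submodule.span_le.2 ?_
        rintro _ ⟨l, rfl⟩; exact hu l
      have h2 := Submodule.finrank_mono h1
      rw [finrank_span_eq_card hind, hHrank _ hp₁, Fintype.card_fin] at h2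
      omega
    -- The hyperplane is oriented by contracting D with the transversal vector ν. The exceptional
    -- subspaces are the old ones and all facet spans, as far as they do not contain the hyperplane.
    refine ih (H (j₁, i₁)) (hHrank _ hp₁) F (D.curryLeft ν) ?_ ?_ ?_ _
      (fun p : ι × Fin (n + 1) => p.2.removeNth (τ p.1)) ?_ ?_ ?_
      (fun p : ι × Fin (n + 1) => c p.1 * (-1) ^ (p.2 : ℕ))
      ({N | N ∈ 𝒩 ∨ N ∈ (J ×ˢ Finset.univ).image H} ∩ {N | ¬ H (j₁, i₁) ≤ N}) ?_ ?_ ?_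
    · intro v hv hind
      rw [AlternatingMap.curryLeft_apply_apply]
      refine hD _ (forall_cons_mem hνU fun i => hHU _ hp₁ (hv i)) ?_
      refine LinearIndependent.finCons hind fun hmem => hνH ?_
      refine (Submodule.span_le.2 ?_ : Submodule.span ℝ (range v) ≤ H (j₁, i₁)) hmem
      rintro _ ⟨l, rfl⟩; exact hv l
    · intro v hv hvK hind
      refine hf0 _ (forall_cons_mem hoU fun i => hHU _ hp₁ (hv i)) (forall_cons_mem hoK hvK) ?_
      intro h
      refine hind ?_
      have := h.comp Fin.succ (Fin.succ_injective _)
      convert this using 1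
      ext l; simp
    -- On the hyperplane the coboundary of F is f, evaluated at one vector more than the dimension;
    -- such tuples are dependent.
    · intro u hu huK
      rw [← hcone u (fun i => hHU _ hp₁ (hu i)) huK]
      exact hf0 u (fun i => hHU _ hp₁ (hu i)) huK (hdep u hu)
    · rintro ⟨j, i⟩ hp l
      obtain ⟨-, h2⟩ := Finset.mem_filter.1 hp
      rw [← h2]
      exact Submodule.subset_span ⟨l, rfl⟩
    · rintro ⟨j, i⟩ hp l
      exact hτK j (Finset.mem_product.1 (Finset.mem_filter.1 hp).1).1 _
    · rintro ⟨j, i⟩ hp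
      exact hface j (Finset.mem_product.1 (Finset.mem_filter.1 hp).1).1 i
    · exact (h𝒩.union (Finset.finite_toSet _)).inter_of_left _
    · exact fun N hN => hN.2
    · intro y hy hgen
      have hyU : y ∈ U := hHU _ hp₁ hy
      -- An exceptional N that contains y contains the whole hyperplane by genericity of y; if it
      -- also contained ν, it would contain U.
      have hNev : ∀ᶠ t : ℝ in 𝓝[>] 0, ∀ N ∈ 𝒩, y + t • ν ∉ N ∧ y - t • ν ∉ N := by
        rw [eventually_all_finite h𝒩]
        intro N hN
        refine eventually_add_smul_notMem fun hyN hνN => ?_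
        refine hgen N ⟨Or.inl hN, fun hle => hne N hN ?_⟩ hyN
        have hsup : H (j₁, i₁) ⊔ Submodule.span ℝ {ν} ≤ N :=
          sup_le hle (by simpa using hνN)
        refine le_trans (le_of_eq ?_) hsup
        refine (Submodule.eq_of_le_of_finrank_le (sup_le (hHU _ hp₁) (by simpa using hνU)) ?_).symm
        have hlt : H (j₁, i₁) < H (j₁, i₁) ⊔ Submodule.span ℝ {ν} := by
          refine lt_of_le_of_ne le_sup_left fun h => hνH ?_
          rw [h]
          exact (le_sup_right : _ ≤ H (j₁, i₁) ⊔ Submodule.span ℝ {ν})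
            (Submodule.mem_span_singleton_self ν)
        have := Submodule.finrank_lt_finrank_of_lt hlt
        rw [hHrank _ hp₁] at this
        omega
      have hcoord : ∀ j, ∃ a b : Fin (n + 1) → ℝ, j ∈ J →
          (y = ∑ i, a i • τ j i ∧ ν = ∑ i, b i • τ j i) := by
        intro j
        by_cases hj : j ∈ J
        · obtain ⟨a, ha⟩ := exists_coords hU (hτ j hj) (hτU j hj) hyU
          obtain ⟨b, hb⟩ := exists_coords hU (hτ j hj) (hτU j hj) hνU
          exact ⟨a, b, fun _ => ⟨ha, hb⟩⟩
        · exact ⟨0, 0, fun h => absurd h hj⟩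
      choose a b hab using hcoord
      have hmemspan : ∀ j ∈ J, ∀ (i : Fin (n + 1)) (d : Fin (n + 1) → ℝ), d i = 0 →
          ∑ l, d l • τ j l ∈ H (j, i) := by
        intro j hj i d hd
        rw [sum_smul_succAbove _ _ i, hd, zero_smul, zero_add]
        exact Submodule.sum_mem _ fun l _ => Submodule.smul_mem _ _ (Submodule.subset_span ⟨l, rfl⟩)
      -- As y avoids all other facet spans, its vanishing coordinates mark exactly the facets that
      -- lie in the chosen hyperplane.
      have hzero : ∀ j ∈ J, ∀ i, a j i = 0 ↔ H (j, i) = H (j₁, i₁) := by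
        intro j hj i
        have hp : (j, i) ∈ J ×ˢ (Finset.univ : Finset (Fin (n + 1))) := by simp [hj]
        constructor
        · intro h
          have hyH : y ∈ H (j, i) := by
            rw [(hab j hj).1]; exact hmemspan j hj i _ h
          by_contra hne'
          refine hgen (H (j, i)) ⟨Or.inr (Finset.mem_image_of_mem _ hp), fun hle => hne' ?_⟩ hyH
          exact (Submodule.eq_of_le_of_finrank_eq hle
            (by rw [hHrank _ hp, hHrank _ hp₁])).symm
        · intro h
          rw [← h, (hab j hj).1, sum_smul_succAbove _ _ i] at hy
          by_contra hne'
          refine hnotin j hj i ?_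
          have h1 : ∑ l, a j (i.succAbove l) • i.removeNth (τ j) l ∈ H (j, i) :=
            Submodule.sum_mem _ fun l _ => Submodule.smul_mem _ _ (Submodule.subset_span ⟨l, rfl⟩)
          have h2 := (Submodule.add_mem_iff_left _ h1).1 hy
          exact (Submodule.smul_mem_iff _ hne').1 h2
      have hjump : ∀ᶠ t : ℝ in 𝓝[>] 0, ∀ j ∈ J, _ := (Finset.eventually_all J).2 fun j hj =>
        eventually_openCone_jump (hτ j hj) D (a j) (b j)
          (fun i hi hb => hνH (by
            rw [← (hzero j hj i).1 hi, (hab j hj).2]; exact hmemspan j hj i _ hb))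
          (fun i i' hi hi' => by
            by_contra hne'
            refine hnotin j hj i ?_
            rw [(hzero j hj i).1 hi, ← (hzero j hj i').1 hi']
            obtain ⟨l, hl⟩ := Fin.exists_succAbove_eq hne'
            exact Submodule.subset_span ⟨l, by simp [Fin.removeNth, hl]⟩)
      -- Subtracting the relations at y + tν and y - tν leaves the jumps, which form the required
      -- relation at y inside the hyperplane.
      obtain ⟨t, ht1, ht2⟩ := (hNev.and hjump).exists
      have hs1 := hsum (y + t • ν) (U.add_mem hyU (U.smul_mem t hνU)) fun N hN => (ht1 N hN).1
      have hs2 := hsum (y - t • ν) (U.sub_mem hyU (U.smul_mem t hνU)) fun N hN => (ht1 N hN).2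
      have hs := congrArg₂ (· - ·) hs1 hs2
      simp only [← Finset.sum_sub_distrib, ← mul_sub, sub_zero] at hs
      rw [← hs, Finset.sum_filter, Finset.sum_product]
      refine Finset.sum_congr rfl fun j hj => ?_
      have h3 := ht2 j hj
      rw [← (hab j hj).1, ← (hab j hj).2] at h3
      rw [mul_assoc, h3, Finset.mul_sum, ← Finset.sum_filter]
      refine Finset.sum_congr ?_ fun i _ => ?_
      · ext i
        simp only [Finset.mem_filter, Finset.mem_univ, true_and]
        exact (hzero j hj i).symm
      · rw [AlternatingMap.curryLeft_apply_apply]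
        simp only [Matrix.vecCons]
        ring

end OpenCone

/-! ### Volumes of simplices via Gram determinants -/

section GramVolume

variable {E : Type*} [NormedAddCommGroup E] [InnerProductSpace ℝ E]

/-- Base times height: row i is a combination of the other rows, coming from the orthogonal
projection of e i to their span, plus the squared distance on the diagonal. The combination does not
affect the determinant. -/
theorem det_gram_removeNth [FiniteDimensional ℝ E] {n : ℕ} (e : Fin (n + 1) → E)
    (i : Fin (n + 1)) :
    (Matrix.gram ℝ e).det =
      Metric.infDist (e i) (Submodule.span ℝ (range (i.removeNth e)) : Set E) ^ 2 *
        (Matrix.gram ℝ (i.removeNth e)).det := by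
  set S := Submodule.span ℝ (range (i.removeNth e)) with hS
  set p := S.starProjection (e i) with hp
  have hpS : p ∈ S := S.starProjection_apply_mem _
  have horth : ∀ w ∈ S, inner ℝ (e i - p) w = 0 := fun w hw =>
    S.starProjection_inner_eq_zero _ w hw
  have hdist : Metric.infDist (e i) (S : Set E) = ‖e i - p‖ := by
    rw [Metric.infDist_eq_iInf, hp, Submodule.starProjection_minimal]
    simp only [dist_eq_norm]
    rfl
  obtain ⟨a, ha⟩ := (Submodule.mem_span_range_iff_exists_fun ℝ).1 hpS
  have hmem : ∀ l, e (i.succAbove l) ∈ S := fun l => Submodule.subset_span ⟨l, rfl⟩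
  have hrow : Matrix.gram ℝ e i =
      ∑ l, a l • Matrix.gram ℝ e (i.succAbove l) + Pi.single i (‖e i - p‖ ^ 2) := by
    funext j
    have h1 : inner ℝ (e i) (e j) = inner ℝ p (e j) + inner ℝ (e i - p) (e j) := by
      rw [← inner_add_left]; simp
    have h2 : inner ℝ (e i - p) (e j) = (Pi.single i (‖e i - p‖ ^ 2) : Fin (n + 1) → ℝ) j := by
      by_cases hj : j = i
      · subst hj
        rw [Pi.single_eq_same, ← real_inner_self_eq_norm_sq]
        conv_rhs => rw [inner_sub_right, horth p hpS, sub_zero]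
      · obtain ⟨l, rfl⟩ := Fin.exists_succAbove_eq hj
        rw [horth _ (hmem l), Pi.single_eq_of_ne (Fin.succAbove_ne i l)]
    have h3 : inner ℝ p (e j) = ∑ l, a l * inner ℝ (e (i.succAbove l)) (e j) := by
      rw [← ha, sum_inner]
      simp [real_inner_smul_left, Fin.removeNth]
    simp only [Matrix.gram_apply, h1, h2, h3, Pi.add_apply, Finset.sum_apply, Pi.smul_apply,
      smul_eq_mul]
  rw [hdist]
  have hdet : (Matrix.gram ℝ e).det =
      ((Matrix.gram ℝ e).updateRow i (Pi.single i (‖e i - p‖ ^ 2))).det := by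
    conv_lhs => rw [← Matrix.updateRow_eq_self (Matrix.gram ℝ e) i, hrow]
    rw [Matrix.det_updateRow_add, add_eq_right]
    have hsum : ∑ l, a l • Matrix.gram ℝ e (i.succAbove l) =
        ∑ k, (i.insertNth 0 a : Fin (n + 1) → ℝ) k • Matrix.gram ℝ e k := by
      rw [Fin.sum_univ_succAbove _ i]
      simp
    rw [hsum, Matrix.det_updateRow_sum]
    simp
  rw [hdet, Matrix.det_succ_row _ i, Finset.sum_eq_single i]
  · rw [← two_mul, pow_mul]
    simp only [even_two, Even.neg_pow, one_pow, one_mul, Matrix.updateRow_self, Pi.single_eq_same]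
    congr 2
    ext l m
    simp [Fin.removeNth]
  · intro j _ hj
    simp [Pi.single_eq_of_ne hj]
  · simp

/-- The edge vectors of a simplex, issuing from its first vertex. -/
def edgeVectors {n : ℕ} (v : Fin (n + 1) → E) : Fin n → E := fun i => v i.succ - v 0

/-- The volume of the parallelepiped spanned by the edge vectors of a simplex. -/
noncomputable def gramVolume {n : ℕ} (v : Fin (n + 1) → E) : ℝ :=
  √ (Matrix.gram ℝ (edgeVectors v)).det

theorem gramVolume_nonneg {n : ℕ} (v : Fin (n + 1) → E) : 0 ≤ gramVolume v := Real.sqrt_nonneg _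

@[simp]
theorem gramVolume_point (v : Fin 1 → E) : gramVolume v = 1 := by
  simp [gramVolume]

theorem affineIndependent_iff_edgeVectors {n : ℕ} (v : Fin (n + 1) → E) :
    AffineIndependent ℝ v ↔ LinearIndependent ℝ (edgeVectors v) := by
  rw [affineIndependent_iff_linearIndependent_vsub ℝ v 0,
    ← linearIndependent_equiv (finSuccAboveEquiv (0 : Fin (n + 1)))]
  rfl

theorem gramVolume_ne_zero_iff {n : ℕ} (v : Fin (n + 1) → E) :
    gramVolume v ≠ 0 ↔ AffineIndependent ℝ v := by
  rw [affineIndependent_iff_edgeVectors, ← Matrix.det_gram_ne_zero_iff_linearIndependent (𝕜 := ℝ),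
    gramVolume, Ne, Real.sqrt_eq_zero (Matrix.posSemidef_gram ℝ _).det_nonneg]

theorem gramVolume_pos {n : ℕ} {v : Fin (n + 1) → E} (hv : AffineIndependent ℝ v) :
    0 < gramVolume v :=
  (gramVolume_nonneg v).lt_of_ne' ((gramVolume_ne_zero_iff v).2 hv)

theorem gramVolume_eq_zero {n : ℕ} {v : Fin (n + 1) → E} (hv : ¬ AffineIndependent ℝ v) :
    gramVolume v = 0 := by
  by_contra h
  exact hv ((gramVolume_ne_zero_iff v).1 h)

theorem continuous_gramVolume {n : ℕ} : Continuous (gramVolume : (Fin (n + 1) → E) → ℝ) := by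
  unfold gramVolume
  refine Real.continuous_sqrt.comp (Continuous.matrix_det ?_)
  refine continuous_matrix fun i j => ?_
  simp only [Matrix.gram_apply, edgeVectors]
  fun_prop

theorem mem_affineSpan_range_iff {n : ℕ} (v : Fin (n + 1) → E) (x : E) :
    x ∈ affineSpan ℝ (range v) ↔ x - v 0 ∈ Submodule.span ℝ (range (edgeVectors v)) := by
  have h0 : v 0 ∈ affineSpan ℝ (range v) := subset_affineSpan ℝ _ ⟨0, rfl⟩
  rw [← AffineSubspace.vsub_right_mem_direction_iff_mem h0, direction_affineSpan,
    vectorSpan_range_eq_span_range_vsub_right ℝ v 0, vsub_eq_sub]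
  have : Submodule.span ℝ (range fun i => v i -ᵥ v 0) = Submodule.span ℝ (range (edgeVectors v)) := by
    refine le_antisymm (Submodule.span_le.2 ?_) (Submodule.span_mono ?_)
    · rintro _ ⟨i, rfl⟩
      refine Fin.cases ?_ (fun j => ?_) i
      · simp
      · exact Submodule.subset_span ⟨j, rfl⟩
    · rintro _ ⟨i, rfl⟩
      exact ⟨i.succ, rfl⟩
  rw [this]

/-- Edge vectors issue from vertex 0, so removing another vertex just removes one edge vector.
Vertex 0 itself is treated in `gramVolume_eq_infDist_mul`. -/
theorem gramVolume_removeNth_succ [FiniteDimensional ℝ E] {n : ℕ} (v : Fin (n + 2) → E)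
    (i : Fin (n + 1)) :
    gramVolume v = Metric.infDist (v i.succ) (affineSpan ℝ (range (i.succ.removeNth v)) : Set E) *
      gramVolume (i.succ.removeNth v) := by
  have h0 : i.succ.removeNth v 0 = v 0 := by simp [Fin.removeNth]
  have he : edgeVectors (i.succ.removeNth v) = i.removeNth (edgeVectors v) := by
    funext l
    simp [edgeVectors, Fin.removeNth]
  have hd : Metric.infDist (v i.succ) (affineSpan ℝ (range (i.succ.removeNth v)) : Set E) =
      Metric.infDist (edgeVectors v i)
        (Submodule.span ℝ (range (i.removeNth (edgeVectors v))) : Set E) := by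
    rw [← Metric.infDist_image (IsometryEquiv.subRight (v 0)).isometry]
    congr 1
    ext x
    simp only [IsometryEquiv.subRight_apply, mem_image, SetLike.mem_coe,
      mem_affineSpan_range_iff, he, h0]
    constructor
    · rintro ⟨y, hy, rfl⟩; exact hy
    · intro hx; exact ⟨x + v 0, by simpa using hx, by simp⟩
  rw [hd, gramVolume, gramVolume, he, det_gram_removeNth _ i, Real.sqrt_mul (sq_nonneg _),
    Real.sqrt_sq Metric.infDist_nonneg]

/-- The volume of the standard simplex spanned by the origin and the unit vectors. -/
noncomputable def cornerVolume (n : ℕ) : ℝ≥0∞ :=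
  volume (convexHull ℝ (range (Fin.cons 0 (EuclideanSpace.basisFun (Fin n) ℝ) :
    Fin (n + 1) → EuclideanSpace ℝ (Fin n))))

theorem affineIndependent_corner (n : ℕ) : AffineIndependent ℝ
    (Fin.cons 0 (EuclideanSpace.basisFun (Fin n) ℝ) : Fin (n + 1) → EuclideanSpace ℝ (Fin n)) := by
  rw [affineIndependent_iff_edgeVectors]
  have : edgeVectors (Fin.cons 0 (EuclideanSpace.basisFun (Fin n) ℝ) :
      Fin (n + 1) → EuclideanSpace ℝ (Fin n)) = EuclideanSpace.basisFun (Fin n) ℝ := by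
    funext i; simp [edgeVectors]
  rw [this]
  exact (EuclideanSpace.basisFun (Fin n) ℝ).toBasis.linearIndependent

theorem cornerVolume_ne_zero (n : ℕ) : cornerVolume n ≠ 0 := by
  have h : (interior (convexHull ℝ (range (Fin.cons 0 (EuclideanSpace.basisFun (Fin n) ℝ) :
      Fin (n + 1) → EuclideanSpace ℝ (Fin n))))).Nonempty := by
    rw [interior_convexHull_nonempty_iff_affineSpan_eq_top]
    exact (affineIndependent_corner n).affineSpan_eq_top_iff_card_eq_finrank_add_one.2 (by simp)
  exact (Measure.measure_pos_of_nonempty_interior _ h).ne'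

theorem cornerVolume_ne_top (n : ℕ) : cornerVolume n ≠ ∞ :=
  ((isBounded_convexHull.2 (finite_range _).isBounded).measure_lt_top).ne

/-- The simplex is a translate of the linear image of the standard corner simplex, under the map
that sends basis vectors to edge vectors; the volume factor of this map is `gramVolume`. Degenerate
tuples are included. -/
theorem euclideanHausdorffMeasure_convexHull [MeasurableSpace E] [BorelSpace E] {n : ℕ} (v : Fin (n + 1) → E) :
    μHE[n] (convexHull ℝ (range v)) = cornerVolume n * ENNReal.ofReal (gramVolume v) := by
  set b := EuclideanSpace.basisFun (Fin n) ℝ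
  set T : EuclideanSpace ℝ (Fin n) →ₗ[ℝ] E := b.toBasis.constr ℝ (edgeVectors v) with hT
  have hTb : ∀ i, T (b i) = edgeVectors v i := by
    intro i
    rw [← b.coe_toBasis, hT, Module.Basis.constr_basis]
  have hrange : range v = (fun x => v 0 + x) ''
      (T '' range (Fin.cons 0 b : Fin (n + 1) → EuclideanSpace ℝ (Fin n))) := by
    rw [← range_comp, ← range_comp]
    congr 1
    funext i
    refine Fin.cases ?_ (fun j => ?_) i
    · simp
    · simp [hTb, edgeVectors]
  have hdet : T.normDet = gramVolume v := by
    have h1 := T.normDet_sq_eq_det_gram b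
    simp only [hTb] at h1
    rw [gramVolume, ← Real.sqrt_sq T.normDet_nonneg]
    exact congrArg _ h1
  have himg : convexHull ℝ (range v) = (fun x => v 0 + x) '' (T '' convexHull ℝ
      (range (Fin.cons 0 b : Fin (n + 1) → EuclideanSpace ℝ (Fin n)))) := by
    rw [hrange, T.image_convexHull]
    exact ((AffineEquiv.constVAdd ℝ E (v 0)).toAffineMap.image_convexHull _).symm
  rw [himg, Isometry.euclideanHausdorffMeasure_image (isometry_add_left (v 0))]
  have h2 := T.euclideanHausdorffMeasure_image_eq_normDet_mul_volume (convexHull ℝ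
      (range (Fin.cons 0 b : Fin (n + 1) → EuclideanSpace ℝ (Fin n))))
  rw [finrank_euclideanSpace_fin] at h2
  rw [h2, hdet, mul_comm]
  rfl

/-- Independence of the ordering is read off from the Hausdorff measure of the convex hull, which
knows only the set of vertices. -/
theorem gramVolume_congr [FiniteDimensional ℝ E] {n : ℕ} {v w : Fin (n + 1) → E}
    (h : range v = range w) : gramVolume v = gramVolume w := by
  let _ : MeasurableSpace E := borel E
  have : BorelSpace E := ⟨rfl⟩
  have h1 := euclideanHausdorffMeasure_convexHull v
  rw [h, euclideanHausdorffMeasure_convexHull w,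
    ENNReal.mul_right_inj (cornerVolume_ne_zero n) (cornerVolume_ne_top n),
    ENNReal.ofReal_eq_ofReal_iff (gramVolume_nonneg _) (gramVolume_nonneg _)] at h1
  exact h1.symm

theorem gramVolume_eq_infDist_mul [FiniteDimensional ℝ E] {n : ℕ} (v : Fin (n + 2) → E)
    (i : Fin (n + 2)) :
    gramVolume v = Metric.infDist (v i) (affineSpan ℝ (range (i.removeNth v)) : Set E) *
      gramVolume (i.removeNth v) := by
  cases i using Fin.cases with
  | succ i => exact gramVolume_removeNth_succ v i
  | zero =>
    -- Swapping vertices 0 and 1 moves the base point of the edge vectors away from the removed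
    -- vertex.
    set w : Fin (n + 2) → E := v ∘ Equiv.swap 0 1 with hw
    have h1 : range w = range v := (Equiv.swap (0 : Fin (n + 2)) 1).surjective.range_comp v
    have hr : ∀ (u : Fin (n + 2) → E) (i : Fin (n + 2)), range (i.removeNth u) = u '' {i}ᶜ := by
      intro u i
      rw [← Fin.range_succAbove, ← range_comp]
      rfl
    have h2 : range ((1 : Fin (n + 2)).removeNth w) = range ((0 : Fin (n + 2)).removeNth v) := by
      rw [hr, hr, hw, image_comp]
      congr 1
      ext x
      simp only [mem_image, mem_compl_iff, mem_singleton_iff]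
      constructor
      · rintro ⟨y, hy, rfl⟩ h
        exact hy (by rw [← Equiv.swap_apply_left (0 : Fin (n + 2)) 1] ; exact (Equiv.swap_apply_eq_iff.1 h))
      · intro hx
        refine ⟨Equiv.swap 0 1 x, fun h => hx ?_, by simp⟩
        rw [Equiv.swap_apply_eq_iff] at h
        simpa using h
    have h3 := gramVolume_removeNth_succ w 0
    rw [Fin.succ_zero_eq_one, h2, gramVolume_congr h1, gramVolume_congr h2] at h3
    rw [h3, hw]
    simp

end GramVolume

/-! ### The mass of a vertex tuple -/

section TupleMass

variable {E : Type*} [NormedAddCommGroup E] [InnerProductSpace ℝ E]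

/-- The largest volume of a face of codimension one. -/
noncomputable def maxFaceVolume {n : ℕ} (v : Fin (n + 2) → E) : ℝ :=
  Finset.univ.sup' Finset.univ_nonempty fun i : Fin (n + 2) => gramVolume (i.removeNth v)

theorem gramVolume_removeNth_le {n : ℕ} (v : Fin (n + 2) → E) (i : Fin (n + 2)) :
    gramVolume (i.removeNth v) ≤ maxFaceVolume v :=
  Finset.le_sup' (fun i : Fin (n + 2) => gramVolume (i.removeNth v)) (Finset.mem_univ i)

theorem maxFaceVolume_le_iff {n : ℕ} {v : Fin (n + 2) → E} {c : ℝ} :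
    maxFaceVolume v ≤ c ↔ ∀ i : Fin (n + 2), gramVolume (i.removeNth v) ≤ c := by
  simp [maxFaceVolume]

theorem maxFaceVolume_nonneg {n : ℕ} (v : Fin (n + 2) → E) : 0 ≤ maxFaceVolume v :=
  (gramVolume_nonneg _).trans (gramVolume_removeNth_le v 0)

theorem affineIndependent_removeNth {n : ℕ} {v : Fin (n + 1) → E} (hv : AffineIndependent ℝ v)
    (i : Fin (n + 1)) : AffineIndependent ℝ (i.removeNth v) :=
  hv.comp_embedding i.succAboveEmb

theorem maxFaceVolume_pos {n : ℕ} {v : Fin (n + 2) → E} (hv : AffineIndependent ℝ v) :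
    0 < maxFaceVolume v :=
  (gramVolume_pos (affineIndependent_removeNth hv 0)).trans_le (gramVolume_removeNth_le v 0)

theorem continuous_maxFaceVolume {n : ℕ} :
    Continuous (maxFaceVolume : (Fin (n + 2) → E) → ℝ) := by
  unfold maxFaceVolume
  refine Continuous.finset_sup'_apply Finset.univ_nonempty fun i _ => ?_
  refine continuous_gramVolume.comp ?_
  exact continuous_pi fun j => continuous_apply _

theorem exists_maxFaceVolume_eq {n : ℕ} (v : Fin (n + 2) → E) :
    ∃ i : Fin (n + 2), maxFaceVolume v = gramVolume (i.removeNth v) := by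
  obtain ⟨i, -, hi⟩ := Finset.exists_mem_eq_sup' Finset.univ_nonempty
    fun i : Fin (n + 2) => gramVolume (i.removeNth v)
  exact ⟨i, hi⟩

/-- The `α`-mass of a tuple of points, up to normalisation: `maxFaceVolume * height ^ α`. -/
noncomputable def tupleMass (α : ℝ) : {n : ℕ} → (Fin (n + 1) → E) → ℝ
  | 0, _ => 1
  | _ + 1, v => maxFaceVolume v ^ (1 - α) * gramVolume v ^ α

@[simp]
theorem tupleMass_point (α : ℝ) (v : Fin (0 + 1) → E) : tupleMass α v = 1 := rfl

theorem tupleMass_succ (α : ℝ) {n : ℕ} (v : Fin (n + 1 + 1) → E) :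
    tupleMass α v = maxFaceVolume v ^ (1 - α) * gramVolume v ^ α := rfl

theorem tupleMass_nonneg (α : ℝ) {n : ℕ} (v : Fin (n + 1) → E) : 0 ≤ tupleMass α v := by
  cases n with
  | zero => simp
  | succ n =>
    exact mul_nonneg (Real.rpow_nonneg (maxFaceVolume_nonneg v) _)
      (Real.rpow_nonneg (gramVolume_nonneg v) _)

theorem tupleMass_pos (α : ℝ) {n : ℕ} {v : Fin (n + 1) → E} (hv : AffineIndependent ℝ v) :
    0 < tupleMass α v := by
  cases n with
  | zero => simp
  | succ n =>
    exact mul_pos (Real.rpow_pos_of_pos (maxFaceVolume_pos hv) _)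
      (Real.rpow_pos_of_pos (gramVolume_pos hv) _)

theorem continuous_tupleMass {α : ℝ} (h0 : 0 ≤ α) (h1 : α ≤ 1) {n : ℕ} :
    Continuous (tupleMass α : (Fin (n + 1) → E) → ℝ) := by
  cases n with
  | zero => exact continuous_const
  | succ n =>
    exact (continuous_maxFaceVolume.rpow_const fun _ => Or.inr (sub_nonneg.2 h1)).mul
      (continuous_gramVolume.rpow_const fun _ => Or.inr h0)

end TupleMass

/-! ### Comparison of `simplexMass` and `tupleMass` -/

section SimplexMass

variable {d : ℕ}

/-- The ratio between `simplexMass` and `tupleMass`. -/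
noncomputable def massConstant : ℕ → ℝ≥0∞
  | 0 => 1
  | n + 1 => cornerVolume n

theorem massConstant_ne_zero (n : ℕ) : massConstant n ≠ 0 := by
  cases n with
  | zero => exact one_ne_zero
  | succ n => exact cornerVolume_ne_zero n

theorem massConstant_ne_top (n : ℕ) : massConstant n ≠ ∞ := by
  cases n with
  | zero => exact ENNReal.one_ne_top
  | succ n => exact cornerVolume_ne_top n

theorem range_removeNth {X : Type*} {n : ℕ} {v : Fin (n + 1) → X} (hv : Function.Injective v)
    (i : Fin (n + 1)) : range (i.removeNth v) = range v \ {v i} := by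
  have : range (i.removeNth v) = v '' {i}ᶜ := by
    rw [← Fin.range_succAbove, ← range_comp]; rfl
  rw [this, image_compl_eq_range_sdiff_image hv, image_singleton]

/-- Closed neighbourhoods of an affine subspace are convex, so the farthest point of the simplex is
the vertex opposite the face. -/
theorem iSup_infEDist_convexHull {E : Type*} [NormedAddCommGroup E] [NormedSpace ℝ E] {n : ℕ}
    (v : Fin (n + 1) → E) (i : Fin (n + 1)) :
    ⨆ x ∈ convexHull ℝ (range v), Metric.infEDist x
      (affineSpan ℝ (range (i.removeNth v)) : Set E) =
      Metric.infEDist (v i) (affineSpan ℝ (range (i.removeNth v)) : Set E) := by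
  refine le_antisymm (iSup₂_le fun x hx => ?_)
    (le_iSup₂_of_le (v i) (subset_convexHull ℝ _ ⟨i, rfl⟩) le_rfl)
  set S : AffineSubspace ℝ E := affineSpan ℝ (range (i.removeNth v))
  by_cases htop : Metric.infEDist (v i) (S : Set E) = ∞
  · rw [htop]; exact le_top
  have hsub : range v ⊆ Metric.cthickening (Metric.infEDist (v i) (S : Set E)).toReal (S : Set E) := by
    rintro _ ⟨j, rfl⟩
    rw [Metric.mem_cthickening_iff, ENNReal.ofReal_toReal htop]
    rcases eq_or_ne j i with rfl | hj
    · exact le_rfl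
    · obtain ⟨l, rfl⟩ := Fin.exists_succAbove_eq hj
      have : v (i.succAbove l) ∈ (S : Set E) := subset_affineSpan ℝ _ ⟨l, rfl⟩
      rw [Metric.infEDist_zero_of_mem this]
      exact zero_le
  have := convexHull_min hsub (S.convex.cthickening _) hx
  rwa [Metric.mem_cthickening_iff, ENNReal.ofReal_toReal htop] at this

/-- The height over a facet is the volume divided by the volume of the facet, so the least height
stands over the largest facet. -/
theorem minHeight_range {n : ℕ} {v : Fin (n + 2) → EuclideanSpace ℝ (Fin d)}
    (hv : AffineIndependent ℝ v) :
    minHeight (range v) = ENNReal.ofReal (gramVolume v / maxFaceVolume v) := by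
  have h1 : ∀ i : Fin (n + 2), ⨆ x ∈ convexHull ℝ (range v), Metric.infEDist x
      (affineSpan ℝ (range v \ {v i}) : Set (EuclideanSpace ℝ (Fin d))) =
      ENNReal.ofReal (gramVolume v / gramVolume (i.removeNth v)) := by
    intro i
    rw [← range_removeNth hv.injective, iSup_infEDist_convexHull, gramVolume_eq_infDist_mul v i,
      mul_div_cancel_right₀ _ (gramVolume_pos (affineIndependent_removeNth hv i)).ne',
      Metric.infDist, ENNReal.ofReal_toReal]
    refine Metric.infEDist_ne_top ?_
    exact ⟨_, subset_affineSpan ℝ _ ⟨0, rfl⟩⟩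
  unfold minHeight
  rw [iInf_range]
  simp only [h1]
  refine le_antisymm ?_ (le_iInf fun i => ?_)
  · obtain ⟨i, hi⟩ := exists_maxFaceVolume_eq v
    rw [hi]
    exact iInf_le _ i
  · exact ENNReal.ofReal_le_ofReal (div_le_div_of_nonneg_left (gramVolume_nonneg v)
      (gramVolume_pos (affineIndependent_removeNth hv i)) (gramVolume_removeNth_le v i))

theorem simplexMass_range {α : ℝ} (h0 : 0 ≤ α) {n : ℕ}
    {v : Fin (n + 1) → EuclideanSpace ℝ (Fin d)} (hv : AffineIndependent ℝ v) :
    simplexMass α n (range v) = massConstant n * ENNReal.ofReal (tupleMass α v) := by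
  cases n with
  | zero => simp [simplexMass, massConstant]
  | succ n =>
    have h1 : ⨆ w ∈ range v, μHE[n] (convexHull ℝ (range v \ {w})) =
        cornerVolume n * ENNReal.ofReal (maxFaceVolume v) := by
      rw [iSup_range]
      simp only [← range_removeNth hv.injective, euclideanHausdorffMeasure_convexHull]
      refine le_antisymm (iSup_le fun i => ?_) ?_
      · gcongr
        exact gramVolume_removeNth_le v i
      · obtain ⟨i, hi⟩ := exists_maxFaceVolume_eq v
        rw [hi]
        exact le_iSup_of_le i le_rfl
    have hQ := maxFaceVolume_pos hv
    have hV := gramVolume_pos hv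
    rw [simplexMass, h1, minHeight_range hv, ENNReal.ofReal_rpow_of_nonneg (by positivity) h0,
      mul_assoc, ← ENNReal.ofReal_mul hQ.le, massConstant, tupleMass_succ]
    congr 2
    rw [Real.div_rpow hV.le hQ.le, Real.rpow_sub hQ, Real.rpow_one]
    ring

end SimplexMass

/-! ### Increments of flat cochains under small moves of the vertices -/

section Perturbation

variable {E : Type*} [NormedAddCommGroup E] [InnerProductSpace ℝ E] [FiniteDimensional ℝ E]

theorem gramVolume_le_update_add {n : ℕ} (v : Fin (n + 2) → E) (i : Fin (n + 2)) (x : E) :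
    gramVolume v ≤ gramVolume (Function.update v i x) +
      dist (v i) x * gramVolume (i.removeNth v) := by
  rw [gramVolume_eq_infDist_mul v i, gramVolume_eq_infDist_mul (Function.update v i x) i,
    Function.update_self, Fin.removeNth_update, ← add_mul]
  exact mul_le_mul_of_nonneg_right Metric.infDist_le_infDist_add_dist (gramVolume_nonneg _)

theorem gramVolume_le_dist_mul {n : ℕ} (v : Fin (n + 2) → E) {i j : Fin (n + 2)} (hij : i ≠ j) :
    gramVolume v ≤ dist (v i) (v j) * gramVolume (i.removeNth v) := by
  rw [gramVolume_eq_infDist_mul v i]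
  refine mul_le_mul_of_nonneg_right (Metric.infDist_le_dist_of_mem ?_) (gramVolume_nonneg _)
  obtain ⟨l, rfl⟩ := Fin.exists_succAbove_eq hij.symm
  exact subset_affineSpan ℝ _ ⟨l, rfl⟩

/-- `q j` bounds the volumes of the `j`-dimensional faces of `v` for `j ≤ J`, and does not decrease
by more than the factor `δ` when the dimension goes up. -/
structure VolumeBound {ι : Type*} (v : ι → E) (δ : ℝ) (q : ℕ → ℝ) (J : ℕ) : Prop where
  delta_nonneg : 0 ≤ δ
  nonneg : ∀ j, 0 ≤ q j
  volume_le : ∀ j ≤ J, ∀ f : Fin (j + 1) → ι, Function.Injective f → gramVolume (v ∘ f) ≤ q j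
  step : ∀ j < J, δ * q j ≤ q (j + 1)

variable {ι : Type*} {v : ι → E} {δ : ℝ} {q : ℕ → ℝ} {J : ℕ}

/-- Here t bounds the number of leading entries that may be displaced. Moving entry t back costs δ
times the volume of the face without it, and `step` absorbs δ into the bound one dimension higher;
each entry at most doubles the constant. -/
theorem VolumeBound.gramVolume_le_aux (h : VolumeBound v δ q J) (t : ℕ) :
    ∀ j ≤ J, ∀ (f : Fin (j + 1) → ι) (s : Fin (j + 1) → E), Function.Injective f →
      (∀ a, dist (s a) (v (f a)) ≤ δ) → (∀ a : Fin (j + 1), t ≤ (a : ℕ) → s a = v (f a)) →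
        gramVolume s ≤ 2 ^ t * q j := by
  induction t with
  | zero =>
    intro j hj f s hf _ hs
    have : s = v ∘ f := funext fun a => hs a (Nat.zero_le _)
    rw [this, pow_zero, one_mul]
    exact h.volume_le j hj f hf
  | succ t ih =>
    intro j hj f s hf hd hs
    have h2 : (0 : ℝ) ≤ 2 ^ t * q j := mul_nonneg (by positivity) (h.nonneg j)
    by_cases ht : t < j + 1
    · set a : Fin (j + 1) := ⟨t, ht⟩ with ha
      have h1 : gramVolume (Function.update s a (v (f a))) ≤ 2 ^ t * q j := by
        refine ih j hj f _ hf (fun b => ?_) (fun b hb => ?_)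
        · rcases eq_or_ne b a with rfl | hba
          · simp [h.delta_nonneg]
          · simpa [hba] using hd b
        · rcases eq_or_ne b a with rfl | hba
          · simp
          · have : t + 1 ≤ (b : ℕ) := by
              have : (b : ℕ) ≠ t := fun h' => hba (Fin.ext h')
              omega
            simpa [hba] using hs b this
      rcases j with _ | j
      · rw [gramVolume_point] at h1 ⊢
        rw [pow_succ]; linarith
      · have h3 : gramVolume (a.removeNth s) ≤ 2 ^ t * q j := by
          refine ih j (by omega) (f ∘ a.succAbove) _
            (hf.comp Fin.succAbove_right_injective) (fun b => hd _) (fun b hb => ?_)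
          refine hs _ ?_
          rw [Fin.succAbove_of_le_castSucc _ _ (by simpa [Fin.le_def, ha] using hb)]
          simpa using hb
        have h4 : dist (s a) (v (f a)) * gramVolume (a.removeNth s) ≤ 2 ^ t * q (j + 1) := by
          calc _ ≤ δ * (2 ^ t * q j) :=
                mul_le_mul (hd a) h3 (gramVolume_nonneg _) h.delta_nonneg
            _ = 2 ^ t * (δ * q j) := by ring
            _ ≤ 2 ^ t * q (j + 1) :=
                mul_le_mul_of_nonneg_left (h.step j (by omega)) (by positivity)
        have := gramVolume_le_update_add s a (v (f a))
        rw [pow_succ]; linarith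
    · have := ih j hj f s hf hd fun b hb => absurd b.2 (by omega)
      rw [pow_succ]; linarith

theorem VolumeBound.gramVolume_le (h : VolumeBound v δ q J) {j : ℕ} (hj : j ≤ J)
    {f : Fin (j + 1) → ι} (hf : Function.Injective f) {s : Fin (j + 1) → E}
    (hs : ∀ a, dist (s a) (v (f a)) ≤ δ) : gramVolume s ≤ 2 ^ (j + 1) * q j :=
  h.gramVolume_le_aux (j + 1) j hj f s hf hs fun a ha => absurd a.2 (by omega)

theorem VolumeBound.gramVolume_le_of_pair (h : VolumeBound v δ q J) {j : ℕ} (hj : j ≤ J)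
    {F : Fin (j + 2) → ι} {s : Fin (j + 2) → E} (hs : ∀ a, dist (s a) (v (F a)) ≤ δ)
    {x y : Fin (j + 2)} (hxy : x ≠ y) (hF : F x = F y)
    (hinj : Function.Injective (F ∘ x.succAbove)) :
    gramVolume s ≤ 2 * δ * (2 ^ (j + 1) * q j) := by
  refine (gramVolume_le_dist_mul s hxy).trans (mul_le_mul ?_ ?_ (gramVolume_nonneg _) ?_)
  · calc dist (s x) (s y) ≤ dist (s x) (v (F x)) + dist (s y) (v (F x)) := dist_triangle_right _ _ _
      _ ≤ δ + δ := add_le_add (hs x) (hF ▸ hs y)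
      _ = 2 * δ := by ring
  · exact h.gramVolume_le hj hinj fun a => hs _
  · linarith [h.delta_nonneg]

theorem injective_comp_succAbove_symm {n : ℕ} {F : Fin (n + 1) → ι} {x y : Fin (n + 1)}
    (hF : F x = F y) (hinj : Function.Injective (F ∘ x.succAbove)) :
    Function.Injective (F ∘ y.succAbove) := by
  have h1 : ∀ a b, a ≠ x → b ≠ x → F a = F b → a = b := by
    intro a b ha hb hab
    obtain ⟨a, rfl⟩ := Fin.exists_succAbove_eq ha
    obtain ⟨b, rfl⟩ := Fin.exists_succAbove_eq hb
    rw [hinj hab]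
  intro a b hab
  have ha := Fin.succAbove_ne y a
  have hb := Fin.succAbove_ne y b
  refine Fin.succAbove_right_injective (p := y) ?_
  simp only [Function.comp_apply] at hab
  rcases eq_or_ne y x with rfl | hyx
  · exact h1 _ _ ha hb hab
  · by_cases hax : y.succAbove a = x
    · by_cases hbx : y.succAbove b = x
      · rw [hax, hbx]
      · exact absurd (h1 _ _ hbx hyx (by rw [← hab, hax, hF])) hb
    · by_cases hbx : y.succAbove b = x
      · exact absurd (h1 _ _ hax hyx (by rw [hab, hbx, hF])) ha
      · exact h1 _ _ hax hbx hab

/-- Facets that lose a point of the pair are perturbed j-faces of v. The others still contain the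
pair, so their volume is at most of order δ times the bound in dimension j-1, which `step` turns
into the bound in dimension j. -/
theorem VolumeBound.maxFaceVolume_le_of_pair (h : VolumeBound v δ q J) {j : ℕ} (hj : j ≤ J)
    {F : Fin (j + 2) → ι} {s : Fin (j + 2) → E} (hs : ∀ a, dist (s a) (v (F a)) ≤ δ)
    {x y : Fin (j + 2)} (hxy : x ≠ y) (hF : F x = F y)
    (hinj : Function.Injective (F ∘ x.succAbove)) :
    maxFaceVolume s ≤ 2 ^ (j + 1) * q j := by
  rw [maxFaceVolume_le_iff]
  intro a
  rcases eq_or_ne a x with rfl | hax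
  · exact h.gramVolume_le hj hinj fun a => hs _
  rcases eq_or_ne a y with rfl | hay
  · exact h.gramVolume_le hj (injective_comp_succAbove_symm hF hinj) fun a => hs _
  obtain ⟨x', rfl⟩ := Fin.exists_succAbove_eq hax.symm
  obtain ⟨y', rfl⟩ := Fin.exists_succAbove_eq hay.symm
  have hxy' : x' ≠ y' := fun h => hxy (by rw [h])
  rcases j with _ | j
  · exact absurd (Fin.ext (by omega)) hxy'
  have h1 := h.gramVolume_le_of_pair (j := j) (by omega) (F := F ∘ a.succAbove)
    (s := a.removeNth s) (fun b => hs _) hxy' hF (by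
      intro b c hbc
      simp only [Function.comp_apply] at hbc
      have hb : a.succAbove (x'.succAbove b) ≠ a.succAbove x' :=
        fun h => Fin.succAbove_ne x' b (Fin.succAbove_right_injective h)
      have hc : a.succAbove (x'.succAbove c) ≠ a.succAbove x' :=
        fun h => Fin.succAbove_ne x' c (Fin.succAbove_right_injective h)
      obtain ⟨b', hb'⟩ := Fin.exists_succAbove_eq hb
      obtain ⟨c', hc'⟩ := Fin.exists_succAbove_eq hc
      rw [← hb', ← hc'] at hbc
      have := hinj hbc
      rw [this, hc'] at hb'
      exact (Fin.succAbove_right_injective (Fin.succAbove_right_injective hb')).symm)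
  calc _ ≤ 2 * δ * (2 ^ (j + 1) * q j) := h1
    _ = 2 ^ (j + 1 + 1) * (δ * q j) := by ring
    _ ≤ _ := mul_le_mul_of_nonneg_left (h.step j (by omega)) (by positivity)

/-- The pair has distance at most 2δ, hence so has the height; this is where the mass gains the
factor (2δ)^α. -/
theorem VolumeBound.tupleMass_le_of_pair (h : VolumeBound v δ q J) {α : ℝ} (h0 : 0 ≤ α)
    (h1 : α ≤ 1) {j : ℕ} (hj : j ≤ J)
    {F : Fin (j + 2) → ι} {s : Fin (j + 2) → E} (hs : ∀ a, dist (s a) (v (F a)) ≤ δ)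
    {x y : Fin (j + 2)} (hxy : x ≠ y) (hF : F x = F y)
    (hinj : Function.Injective (F ∘ x.succAbove)) :
    tupleMass α (n := j + 1) s ≤ 2 ^ (j + 1) * q j * (2 * δ) ^ α := by
  have hQ : 0 ≤ 2 ^ (j + 1) * q j := mul_nonneg (by positivity) (h.nonneg j)
  have hδ : 0 ≤ 2 * δ := by linarith [h.delta_nonneg]
  rw [tupleMass_succ]
  calc _ ≤ (2 ^ (j + 1) * q j) ^ (1 - α) * (2 * δ * (2 ^ (j + 1) * q j)) ^ α := by
        refine mul_le_mul ?_ ?_ (Real.rpow_nonneg (gramVolume_nonneg _) _) (Real.rpow_nonneg hQ _)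
        · exact Real.rpow_le_rpow (maxFaceVolume_nonneg _)
            (h.maxFaceVolume_le_of_pair hj hs hxy hF hinj) (by linarith)
        · exact Real.rpow_le_rpow (gramVolume_nonneg _)
            (h.gramVolume_le_of_pair hj hs hxy hF hinj) h0
    _ = ((2 ^ (j + 1) * q j) ^ (1 - α) * (2 ^ (j + 1) * q j) ^ α) * (2 * δ) ^ α := by
        rw [Real.mul_rpow hδ hQ]; ring
    _ = _ := by
        rw [← Real.rpow_add' hQ (by simp)]
        simp

theorem VolumeBound.tupleMass_le {k : ℕ} {v : Fin (k + 2) → E} (h : VolumeBound v δ q (k + 1))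
    {α : ℝ} (h0 : 0 ≤ α) (h1 : α ≤ 1) {s : Fin (k + 2) → E} (hs : ∀ a, dist (s a) (v a) ≤ δ) :
    tupleMass α (n := k + 1) s ≤
      (2 ^ (k + 1) * q k) ^ (1 - α) * (2 ^ (k + 2) * q (k + 1)) ^ α := by
  have hQ : ∀ k, 0 ≤ 2 ^ (k + 1) * q k := fun k => mul_nonneg (by positivity) (h.nonneg k)
  rw [tupleMass_succ]
  refine mul_le_mul ?_ ?_ (Real.rpow_nonneg (gramVolume_nonneg _) _) (Real.rpow_nonneg (hQ _) _)
  · refine Real.rpow_le_rpow (maxFaceVolume_nonneg _) (maxFaceVolume_le_iff.2 fun i => ?_)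
      (by linarith)
    exact h.gramVolume_le (f := i.succAbove) (by omega) Fin.succAbove_right_injective fun a => hs _
  · exact Real.rpow_le_rpow (gramVolume_nonneg _)
      (h.gramVolume_le (f := id) le_rfl Function.injective_id hs) h0

/-- A subadditive function, invariant under change of sign, with values in `[0, ∞]`. -/
structure IsSubadditive {B : Type*} [AddCommGroup B] (N : B → ℝ≥0∞) : Prop where
  zero : N 0 = 0
  add : ∀ x y, N (x + y) ≤ N x + N y
  neg : ∀ x, N (-x) = N x

section Increment

variable {B : Type*} [AddCommGroup B] {N : B → ℝ≥0∞}

theorem IsSubadditive.sum (hN : IsSubadditive N) {κ : Type*} (s : Finset κ) (f : κ → B) :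
    N (∑ i ∈ s, f i) ≤ ∑ i ∈ s, N (f i) := by
  classical
  induction s using Finset.induction_on with
  | empty => simp [hN.zero]
  | insert a s ha ih =>
    rw [Finset.sum_insert ha, Finset.sum_insert ha]
    exact (hN.add _ _).trans (by gcongr)

theorem IsSubadditive.neg_one_pow_smul (hN : IsSubadditive N) (n : ℕ) (x : B) :
    N ((-1 : ℤ) ^ n • x) = N x := by
  rcases neg_one_pow_eq_or ℤ n with h | h <;> simp [h, hN.neg]

/-- The bound for the change of a cochain when one vertex moves by `δ`. -/
noncomputable def incrementBound (k : ℕ) (X Y : ℝ≥0∞) (α β δ : ℝ) (q : ℕ → ℝ) : ℝ≥0∞ :=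
  Y * ENNReal.ofReal (2 ^ (k + 1) * q k * (2 * δ) ^ β) +
    k * (X * ENNReal.ofReal (2 ^ k * q (k - 1) * (2 * δ) ^ α))

variable {k : ℕ} {S : Set E} {g : (Fin (k + 1) → E) → B} {X Y : ℝ≥0∞} {α β : ℝ}
  {v : Fin (k + 1) → E}

/-- The simplices of `sub_update` contain w and s i, both δ-close to v i, so the bounds for pairs
apply. The factor k in `incrementBound` counts the facets; for k = 0 there are none, and the
truncated index k - 1 is harmless. -/
theorem IsFlatCochain.sub_update_le (hg : IsFlatCochain S g) (hN : IsSubadditive N)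
    (hα : α ∈ Icc (0 : ℝ) 1) (hβ : β ∈ Icc (0 : ℝ) 1)
    (hX : ∀ s : Fin (k + 1) → E, (∀ i, s i ∈ S) → N (g s) ≤ X * ENNReal.ofReal (tupleMass α s))
    (hY : ∀ s : Fin (k + 2) → E, (∀ i, s i ∈ S) →
      N (coboundary g s) ≤ Y * ENNReal.ofReal (tupleMass β (n := k + 1) s))
    (h : VolumeBound v δ q k) {s : Fin (k + 1) → E} (hs : ∀ i, s i ∈ S)
    (hsv : ∀ i, dist (s i) (v i) ≤ δ) {w : E} (hw : w ∈ S) {i : Fin (k + 1)}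
    (hwv : dist w (v i) ≤ δ) :
    N (g s - g (Function.update s i w)) ≤ incrementBound k X Y α β δ q := by
  rw [hg.sub_update hs hw i, incrementBound]
  refine (hN.add _ _).trans (add_le_add ?_ ?_)
  · refine (hY _ (forall_cons_mem hw hs)).trans ?_
    gcongr
    refine h.tupleMass_le_of_pair hβ.1 hβ.2 le_rfl (F := Fin.cons i id) (x := 0) (y := i.succ)
      ?_ (Fin.succ_ne_zero i).symm (by simp) ?_
    · intro a
      refine Fin.cases ?_ (fun b => ?_) a
      · simpa using hwv
      · simpa using hsv b
    · intro a b hab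
      simpa using hab
  · refine (hN.sum _ _).trans ?_
    rcases k with _ | k
    · have : (Finset.univ : Finset (Fin (0 + 1))).erase i = ∅ := by
        refine Finset.eq_empty_of_forall_notMem fun x hx => Finset.ne_of_mem_erase hx ?_
        exact Fin.ext (by omega)
      rw [this]; simp
    have hcard : (((Finset.univ : Finset (Fin (k + 1 + 1))).erase i).card : ℝ≥0∞) =
        ((k + 1 : ℕ) : ℝ≥0∞) := by
      rw [Finset.card_erase_of_mem (Finset.mem_univ i)]; simp
    rw [← hcard, ← nsmul_eq_mul]
    refine Finset.sum_le_card_nsmul _ _ _ fun l hl => ?_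
    have hil : i ≠ l := (Finset.ne_of_mem_erase hl).symm
    obtain ⟨p, hp⟩ := Fin.exists_succAbove_eq hil
    rw [hN.neg_one_pow_smul]
    refine (hX _ (forall_cons_mem hw fun _ => hs _)).trans ?_
    gcongr
    refine h.tupleMass_le_of_pair hα.1 hα.2 (Nat.le_succ k) (F := Fin.cons i l.succAbove) (x := 0)
      (y := p.succ) ?_ (Fin.succ_ne_zero p).symm (by simp [hp]) ?_
    · intro a
      refine Fin.cases ?_ (fun b => ?_) a
      · simpa using hwv
      · simpa [Fin.removeNth] using hsv _
    · intro a b hab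
      simpa using hab

theorem IsFlatCochain.sub_le (hg : IsFlatCochain S g) (hN : IsSubadditive N)
    (hα : α ∈ Icc (0 : ℝ) 1) (hβ : β ∈ Icc (0 : ℝ) 1)
    (hX : ∀ s : Fin (k + 1) → E, (∀ i, s i ∈ S) → N (g s) ≤ X * ENNReal.ofReal (tupleMass α s))
    (hY : ∀ s : Fin (k + 2) → E, (∀ i, s i ∈ S) →
      N (coboundary g s) ≤ Y * ENNReal.ofReal (tupleMass β (n := k + 1) s))
    (h : VolumeBound v δ q k) {s w : Fin (k + 1) → E} (hs : ∀ i, s i ∈ S)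
    (hsv : ∀ i, dist (s i) (v i) ≤ δ) (hw : ∀ i, w i ∈ S)
    (hwv : ∀ i, dist (w i) (v i) ≤ δ) :
    N (g s - g w) ≤ (k + 1 : ℕ) * incrementBound k X Y α β δ q := by
  -- Telescoping through tuples whose first t entries come from w. The reference tuple v is fixed,
  -- so its `VolumeBound` serves all intermediate steps.
  set mix : ℕ → Fin (k + 1) → E := fun t a => if (a : ℕ) < t then w a else s a with hmix
  have h0 : mix 0 = s := by funext a; simp [hmix]
  have h1 : mix (k + 1) = w := by
    funext a
    simp only [hmix, a.2, if_true]
  have key : ∀ t ≤ k + 1, N (g s - g (mix t)) ≤ t * incrementBound k X Y α β δ q := by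
    intro t
    induction t with
    | zero => intro _; simp [h0, hN.zero]
    | succ t ih =>
      intro ht
      have hstep : mix (t + 1) = Function.update (mix t) ⟨t, ht⟩ (w ⟨t, ht⟩) := by
        funext a
        rcases eq_or_ne a ⟨t, ht⟩ with rfl | ha
        · simp [hmix]
        · have hat : (a : ℕ) ≠ t := fun h => ha (Fin.ext h)
          rw [Function.update_of_ne ha]
          have : (a : ℕ) < t + 1 ↔ (a : ℕ) < t := by omega
          simp only [hmix, this]
      have e1 : g s - g (mix (t + 1)) = (g s - g (mix t)) + (g (mix t) - g (mix (t + 1))) := by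
        abel
      rw [e1, Nat.cast_succ, add_mul, one_mul]
      refine (hN.add _ _).trans (add_le_add (ih (by omega)) ?_)
      rw [hstep]
      refine hg.sub_update_le hN hα hβ hX hY h (fun i => ?_) (fun i => ?_) (hw _) (hwv _)
      · simp only [hmix]; split_ifs
        exacts [hw i, hs i]
      · simp only [hmix]; split_ifs
        exacts [hwv i, hsv i]
  simpa only [h1] using key (k + 1) le_rfl

end Increment

end Perturbation

/-! ### Crude and sharp volume bounds -/

section VolumeBounds

variable {E : Type*} [NormedAddCommGroup E] [InnerProductSpace ℝ E]

/-- The largest volume of a `j`-dimensional face. -/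
noncomputable def faceVolume {n : ℕ} (v : Fin (n + 1) → E) (j : ℕ) : ℝ :=
  ⨆ f : {f : Fin (j + 1) → Fin (n + 1) // Function.Injective f}, gramVolume (v ∘ f.1)

theorem gramVolume_le_faceVolume {n : ℕ} (v : Fin (n + 1) → E) {j : ℕ}
    {f : Fin (j + 1) → Fin (n + 1)} (hf : Function.Injective f) :
    gramVolume (v ∘ f) ≤ faceVolume v j :=
  le_ciSup (f := fun f : {f : Fin (j + 1) → Fin (n + 1) // Function.Injective f} =>
    gramVolume (v ∘ f.1)) (finite_range _).bddAbove ⟨f, hf⟩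

theorem faceVolume_nonneg {n : ℕ} (v : Fin (n + 1) → E) (j : ℕ) : 0 ≤ faceVolume v j :=
  Real.iSup_nonneg fun _ => gramVolume_nonneg _

variable [FiniteDimensional ℝ E]

theorem gramVolume_le_pow {R : ℝ} {n : ℕ} (v : Fin (n + 1) → E)
    (hv : ∀ i j, dist (v i) (v j) ≤ R) : gramVolume v ≤ R ^ n := by
  have hR : 0 ≤ R := dist_nonneg.trans (hv 0 0)
  induction n with
  | zero => simp
  | succ n ih =>
    refine (gramVolume_le_dist_mul v (Fin.zero_ne_one' (n := n + 1))).trans ?_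
    rw [pow_succ']
    exact mul_le_mul (hv _ _) (ih _ fun i j => hv _ _) (gramVolume_nonneg _) hR

/-- The crude bound is uniform and covers degenerate tuples; it gives convergence and continuity.
Estimates by the mass require the sharp `volumeBound_faceVolume` below. -/
theorem volumeBound_pow {R δ : ℝ} (hδ : 0 ≤ δ) (hδR : δ ≤ R) {ι : Type*} (v : ι → E)
    (hv : ∀ i j, dist (v i) (v j) ≤ R) (J : ℕ) : VolumeBound v δ (fun j => R ^ j) J where
  delta_nonneg := hδ
  nonneg j := pow_nonneg (hδ.trans hδR) j
  volume_le j _ f _ := gramVolume_le_pow _ fun _ _ => hv _ _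
  step j _ := by
    rw [pow_succ']
    exact mul_le_mul_of_nonneg_right hδR (pow_nonneg (hδ.trans hδR) j)

/-- Applied to degenerate v, where it says that approximations within δ have volume of order δ. -/
theorem gramVolume_le_add_of_dist_le {R δ : ℝ} {n : ℕ} {v w : Fin (n + 2) → E} (hδ : 0 ≤ δ)
    (hvw : ∀ i, dist (w i) (v i) ≤ δ) {S : Set E} (hv : ∀ i, v i ∈ S) (hw : ∀ i, w i ∈ S)
    (hS : ∀ x ∈ S, ∀ y ∈ S, dist x y ≤ R) :
    gramVolume w ≤ gramVolume v + (n + 2 : ℕ) * (δ * R ^ n) := by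
  have hR : 0 ≤ R := dist_nonneg.trans (hS _ (hv 0) _ (hv 0))
  set mix : ℕ → Fin (n + 2) → E := fun t a => if (a : ℕ) < t then v a else w a with hmix
  have h0 : mix 0 = w := by funext a; simp [hmix]
  have h1 : mix (n + 2) = v := by
    funext a
    simp only [hmix, a.2, if_true]
  have key : ∀ t ≤ n + 2, gramVolume w ≤ gramVolume (mix t) + t * (δ * R ^ n) := by
    intro t
    induction t with
    | zero => intro _; simp [h0]
    | succ t ih =>
      intro ht
      have hstep : mix (t + 1) = Function.update (mix t) ⟨t, ht⟩ (v ⟨t, ht⟩) := by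
        funext a
        rcases eq_or_ne a ⟨t, ht⟩ with rfl | ha
        · simp [hmix]
        · have hat : (a : ℕ) ≠ t := fun h => ha (Fin.ext h)
          rw [Function.update_of_ne ha]
          have : (a : ℕ) < t + 1 ↔ (a : ℕ) < t := by omega
          simp only [hmix, this]
      have hmem : ∀ a, mix t a ∈ S := by
        intro a
        simp only [hmix]; split_ifs
        exacts [hv a, hw a]
      have h3 := gramVolume_le_update_add (mix t) ⟨t, ht⟩ (v ⟨t, ht⟩)
      rw [← hstep] at h3
      have h4 : dist (mix t ⟨t, ht⟩) (v ⟨t, ht⟩) *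
          gramVolume ((⟨t, ht⟩ : Fin (n + 2)).removeNth (mix t)) ≤ δ * R ^ n := by
        refine mul_le_mul ?_ (gramVolume_le_pow _ fun i j => hS _ (hmem _) _ (hmem _))
          (gramVolume_nonneg _) hδ
        simpa [hmix] using hvw _
      have := ih (by omega)
      push_cast
      linarith
  simpa only [h1] using key (n + 2) le_rfl

theorem faceVolume_self_le {n : ℕ} (v : Fin (n + 1) → E) : faceVolume v n ≤ gramVolume v := by
  refine Real.iSup_le (fun f => ?_) (gramVolume_nonneg v)
  rw [gramVolume_congr ((Finite.injective_iff_surjective.1 f.2).range_comp v)]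

theorem faceVolume_pred_le {n : ℕ} (v : Fin (n + 2) → E) :
    faceVolume v n ≤ maxFaceVolume v := by
  refine Real.iSup_le (fun f => ?_) (maxFaceVolume_nonneg v)
  obtain ⟨f, hf⟩ := f
  have hns : ¬ Function.Surjective f := fun h => by
    have := Fintype.card_le_of_surjective f h
    simp at this
  obtain ⟨a, ha⟩ : ∃ a, ∀ b, f b ≠ a := by
    simpa [Function.Surjective] using hns
  have hcompl : range f = {a}ᶜ := by
    have h1 : range f ⊆ {a}ᶜ := by rintro _ ⟨b, rfl⟩; exact ha b
    refine Set.eq_of_subset_of_ncard_le h1 ?_ (toFinite _)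
    rw [Set.ncard_compl, Set.ncard_singleton, Nat.card_eq_fintype_card, Fintype.card_fin,
      ← image_univ, Set.ncard_image_of_injective _ hf, Set.ncard_univ, Nat.card_eq_fintype_card,
      Fintype.card_fin]
    omega
  have : range (v ∘ f) = range (a.removeNth v) := by
    rw [range_comp, hcompl, ← Fin.range_succAbove, ← range_comp]
    rfl
  rw [gramVolume_congr this]
  exact gramVolume_removeNth_le v a

/-- Enlarge a j-face by a vertex it misses. The distance from that vertex to the face is at least
its distance to the opposite facet of the whole simplex, hence at least the least height. -/
theorem faceVolume_step {n : ℕ} {v : Fin (n + 2) → E} (hv : AffineIndependent ℝ v) {j : ℕ}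
    (hj : j < n + 1) :
    gramVolume v / maxFaceVolume v * faceVolume v j ≤ faceVolume v (j + 1) := by
  have hQ := maxFaceVolume_pos hv
  have hh : 0 ≤ gramVolume v / maxFaceVolume v := div_nonneg (gramVolume_nonneg v) hQ.le
  unfold faceVolume
  rw [Real.mul_iSup_of_nonneg hh]
  refine Real.iSup_le (fun f => ?_) (faceVolume_nonneg v (j + 1))
  obtain ⟨f, hf⟩ := f
  have hns : ¬ Function.Surjective f := fun h => by
    have := Fintype.card_le_of_surjective f h
    simp at this; omega
  obtain ⟨a, ha⟩ : ∃ a, ∀ b, f b ≠ a := by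
    simpa [Function.Surjective] using hns
  have hinj : Function.Injective (Fin.cons a f : Fin (j + 2) → Fin (n + 2)) :=
    Fin.cons_injective_iff.2 ⟨fun ⟨b, hb⟩ => ha b hb, hf⟩
  refine le_trans ?_ (gramVolume_le_faceVolume v hinj)
  have h0 : (0 : Fin (j + 2)).removeNth (v ∘ (Fin.cons a f : Fin (j + 2) → Fin (n + 2))) = v ∘ f := by
    funext b; simp [Fin.removeNth]
  rw [gramVolume_eq_infDist_mul (v ∘ (Fin.cons a f : Fin (j + 2) → Fin (n + 2))) 0, h0]
  refine mul_le_mul_of_nonneg_right ?_ (gramVolume_nonneg _)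
  have hpos := gramVolume_pos (affineIndependent_removeNth hv a)
  calc gramVolume v / maxFaceVolume v ≤ gramVolume v / gramVolume (a.removeNth v) :=
        div_le_div_of_nonneg_left (gramVolume_nonneg v) hpos (gramVolume_removeNth_le v a)
    _ = Metric.infDist (v a) (affineSpan ℝ (range (a.removeNth v)) : Set E) := by
        rw [gramVolume_eq_infDist_mul v a, mul_div_cancel_right₀ _ hpos.ne']
    _ ≤ _ := by
        simp only [Function.comp_apply, Fin.cons_zero]
        refine Metric.infDist_le_infDist_of_subset (affineSpan_mono ℝ ?_)
          ⟨v (f 0), subset_affineSpan ℝ _ ⟨0, rfl⟩⟩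
        rintro _ ⟨b, rfl⟩
        obtain ⟨l, hl⟩ := Fin.exists_succAbove_eq (ha b)
        exact ⟨l, by simp [Fin.removeNth, hl]⟩

theorem volumeBound_faceVolume {n : ℕ} {v : Fin (n + 2) → E} (hv : AffineIndependent ℝ v) {δ : ℝ}
    (hδ : 0 ≤ δ) (hδv : δ ≤ gramVolume v / maxFaceVolume v) :
    VolumeBound v δ (faceVolume v) (n + 1) where
  delta_nonneg := hδ
  nonneg := faceVolume_nonneg v
  volume_le _ _ _ hf := gramVolume_le_faceVolume v hf
  step _ hj := (mul_le_mul_of_nonneg_right hδv (faceVolume_nonneg v _)).trans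
    (faceVolume_step hv hj)

theorem height_le_diam {R : ℝ} {n : ℕ} {v : Fin (n + 2) → E} (hv : AffineIndependent ℝ v)
    (hR : ∀ i j, dist (v i) (v j) ≤ R) : gramVolume v / maxFaceVolume v ≤ R := by
  rw [div_le_iff₀ (maxFaceVolume_pos hv)]
  refine (gramVolume_le_dist_mul v (Fin.zero_ne_one' (n := n + 1))).trans ?_
  exact mul_le_mul (hR _ _) (gramVolume_removeNth_le v _) (gramVolume_nonneg _)
    (dist_nonneg.trans (hR 0 0))

end VolumeBounds

/-! ### Bisecting an edge does not increase the mass -/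

section Bisection

variable {E : Type*} [NormedAddCommGroup E] [InnerProductSpace ℝ E]

theorem infDist_midpoint_le (S : AffineSubspace ℝ E) (hS : (S : Set E).Nonempty) (x y : E) :
    Metric.infDist (midpoint ℝ x y) (S : Set E) ≤
      max (Metric.infDist x (S : Set E)) (Metric.infDist y (S : Set E)) := by
  set r := max (Metric.infDist x (S : Set E)) (Metric.infDist y (S : Set E))
  have h : ∀ z, z ∈ Metric.cthickening r (S : Set E) ↔ Metric.infDist z (S : Set E) ≤ r := by
    intro z
    rw [Metric.mem_cthickening_iff, Metric.infDist,
      ENNReal.le_ofReal_iff_toReal_le (Metric.infEDist_ne_top hS)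
        (le_max_of_le_left Metric.infDist_nonneg)]
  rw [← h]
  exact (S.convex.cthickening r).midpoint_mem ((h x).2 (le_max_left _ _))
    ((h y).2 (le_max_right _ _))

variable [FiniteDimensional ℝ E]

theorem gramVolume_update_midpoint_le {n : ℕ} (v : Fin (n + 1) → E) (i : Fin (n + 1)) (x y : E) :
    gramVolume (Function.update v i (midpoint ℝ x y)) ≤
      max (gramVolume (Function.update v i x)) (gramVolume (Function.update v i y)) := by
  cases n with
  | zero => simp
  | succ n =>
    rw [gramVolume_eq_infDist_mul _ i, gramVolume_eq_infDist_mul (Function.update v i x) i,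
      gramVolume_eq_infDist_mul (Function.update v i y) i]
    simp only [Function.update_self, Fin.removeNth_update]
    rw [← max_mul_of_nonneg _ _ (gramVolume_nonneg _)]
    refine mul_le_mul_of_nonneg_right (infDist_midpoint_le _ ?_ _ _) (gramVolume_nonneg _)
    exact ⟨i.removeNth v 0, subset_affineSpan ℝ _ ⟨0, rfl⟩⟩

/-- With v_a replaced by v_b, the facet without a is unchanged, the facet without b has the vertices
of the old facet without a, and every other facet has a repeated vertex. -/
theorem gramVolume_removeNth_update_le {n : ℕ} (v : Fin (n + 2) → E) {a b : Fin (n + 2)}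
    (hab : a ≠ b) (l : Fin (n + 2)) :
    gramVolume (l.removeNth (Function.update v a (v b))) ≤ maxFaceVolume v := by
  rcases eq_or_ne l a with rfl | hla
  · rw [Fin.removeNth_update]; exact gramVolume_removeNth_le v l
  rcases eq_or_ne l b with rfl | hlb
  · have : range (l.removeNth (Function.update v a (v l))) = range (a.removeNth v) := by
      ext x
      constructor
      · rintro ⟨i, rfl⟩
        by_cases hi : l.succAbove i = a
        · obtain ⟨j, hj⟩ := Fin.exists_succAbove_eq hab.symm
          exact ⟨j, by simp [Fin.removeNth, hi, hj]⟩
        · obtain ⟨j, hj⟩ := Fin.exists_succAbove_eq hi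
          exact ⟨j, by simp [Fin.removeNth, hi, hj]⟩
      · rintro ⟨i, rfl⟩
        by_cases hi : a.succAbove i = l
        · obtain ⟨j, hj⟩ := Fin.exists_succAbove_eq hab
          exact ⟨j, by simp [Fin.removeNth, hi, hj]⟩
        · obtain ⟨j, hj⟩ := Fin.exists_succAbove_eq hi
          exact ⟨j, by simp [Fin.removeNth, hj]⟩
    rw [gramVolume_congr this]
    exact gramVolume_removeNth_le v a
  · rw [gramVolume_eq_zero]
    · exact maxFaceVolume_nonneg v
    · obtain ⟨i, hi⟩ := Fin.exists_succAbove_eq hla.symm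
      obtain ⟨j, hj⟩ := Fin.exists_succAbove_eq hlb.symm
      refine not_affineIndependent_of_eq (i := i) (j := j) ?_ ?_
      · rintro rfl; exact hab (hi.symm.trans hj)
      · simp [Fin.removeNth, hi, hj, hab.symm]

/-- At the midpoint, volumes are at most the larger of those at the two end positions of the moving
vertex: the original simplex, and the degenerate one with v_b repeated. -/
theorem tupleMass_update_midpoint_le {α : ℝ} (h0 : 0 ≤ α) (h1 : α ≤ 1) {n : ℕ}
    (v : Fin (n + 1) → E) {a b : Fin (n + 1)} (hab : a ≠ b) :
    tupleMass α (Function.update v a (midpoint ℝ (v a) (v b))) ≤ tupleMass α v := by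
  cases n with
  | zero => simp
  | succ n =>
    rw [tupleMass_succ, tupleMass_succ]
    refine mul_le_mul ?_ ?_ (Real.rpow_nonneg (gramVolume_nonneg _) _)
      (Real.rpow_nonneg (maxFaceVolume_nonneg _) _)
    · refine Real.rpow_le_rpow (maxFaceVolume_nonneg _) (maxFaceVolume_le_iff.2 fun l => ?_)
        (by linarith)
      rcases eq_or_ne l a with rfl | hla
      · rw [Fin.removeNth_update]; exact gramVolume_removeNth_le v l
      · obtain ⟨i, hi⟩ := Fin.exists_succAbove_eq hla.symm
        have : ∀ x, l.removeNth (Function.update v a x) = Function.update (l.removeNth v) i x := by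
          intro x
          funext j
          by_cases hj : j = i
          · subst hj; simp [Fin.removeNth, hi]
          · have : l.succAbove j ≠ a := fun h =>
              hj (Fin.succAbove_right_injective (h.trans hi.symm))
            simp [Fin.removeNth, hj, this]
        rw [this]
        refine (gramVolume_update_midpoint_le _ _ _ _).trans (max_le ?_ ?_)
        · rw [← this, Function.update_eq_self]; exact gramVolume_removeNth_le v l
        · rw [← this]; exact gramVolume_removeNth_update_le v hab l
    · refine Real.rpow_le_rpow (gramVolume_nonneg _) ?_ h0
      refine (gramVolume_update_midpoint_le _ _ _ _).trans (max_le ?_ ?_)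
      · rw [Function.update_eq_self]
      · rw [gramVolume_eq_zero]
        · exact gramVolume_nonneg v
        · exact not_affineIndependent_of_eq hab (by simp [hab.symm])

end Bisection

/-! ### From small simplices to simplices of bounded diameter -/

section Diameter

variable {E : Type*} [NormedAddCommGroup E] [InnerProductSpace ℝ E]

/-- By the parallelogram law the squared distance is at most R²(1 - 0.81/4), which is less than (0.9
R)². -/
theorem dist_midpoint_le_of_lt {R : ℝ} {a b c : E} (ha : dist a c ≤ R) (hb : dist b c ≤ R)
    (hab : R * (9 / 10) < dist a b) : dist (midpoint ℝ a b) c ≤ R * (9 / 10) := by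
  have hR : 0 ≤ R := dist_nonneg.trans ha
  have h1 := parallelogram_law_with_norm ℝ (a - c) (b - c)
  have h2 : (a - c) + (b - c) = (2 : ℝ) • (midpoint ℝ a b - c) := by
    rw [midpoint_eq_smul_add, smul_sub, smul_smul]
    norm_num
    rw [two_smul]; abel
  rw [h2, sub_sub_sub_cancel_right, norm_smul] at h1
  rw [dist_eq_norm] at ha hb hab ⊢
  norm_num at h1
  refine abs_le_of_sq_le_sq' ?_ (by positivity) |>.2
  have e1 := mul_self_le_mul_self (norm_nonneg _) ha
  have e2 := mul_self_le_mul_self (norm_nonneg _) hb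
  have e3 := mul_self_le_mul_self (by positivity) hab.le
  nlinarith

theorem dist_update_midpoint_le {R : ℝ} (hR : 0 ≤ R) {n : ℕ} {s : Fin n → E}
    (hs : ∀ i j, dist (s i) (s j) ≤ R) {a b : Fin n} (hab : R * (9 / 10) < dist (s a) (s b))
    (i j : Fin n) :
    dist (Function.update s a (midpoint ℝ (s a) (s b)) i)
        (Function.update s a (midpoint ℝ (s a) (s b)) j) ≤ R * (9 / 10) ∨
      (i ≠ a ∧ j ≠ a ∧ dist (Function.update s a (midpoint ℝ (s a) (s b)) i)
        (Function.update s a (midpoint ℝ (s a) (s b)) j) = dist (s i) (s j)) := by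
  have key : ∀ c, dist (midpoint ℝ (s a) (s b)) (s c) ≤ R * (9 / 10) := fun c =>
    dist_midpoint_le_of_lt (hs a c) (hs b c) hab
  rcases eq_or_ne i a with rfl | hi
  · left
    rcases eq_or_ne j i with rfl | hj
    · rw [dist_self]; positivity
    · simpa [hj] using key j
  · rcases eq_or_ne j a with rfl | hj
    · left; rw [dist_comm]; simpa [hi] using key i
    · right; simp [hi, hj]

/-- Termination measure for bisection: no new long pair appears, and (a, b) is no longer long. -/
theorem card_long_update_lt {R : ℝ} (hR : 0 ≤ R) {n : ℕ} {s : Fin n → E}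
    (hs : ∀ i j, dist (s i) (s j) ≤ R) {a b : Fin n} (hab : R * (9 / 10) < dist (s a) (s b)) :
    (Finset.univ.filter fun p : Fin n × Fin n => R * (9 / 10) <
      dist (Function.update s a (midpoint ℝ (s a) (s b)) p.1)
        (Function.update s a (midpoint ℝ (s a) (s b)) p.2)).card <
    (Finset.univ.filter fun p : Fin n × Fin n => R * (9 / 10) < dist (s p.1) (s p.2)).card := by
  refine Finset.card_lt_card (Finset.ssubset_iff_of_subset ?_ |>.2 ⟨(a, b), by simpa using hab, ?_⟩)
  · intro p hp
    simp only [Finset.mem_filter, Finset.mem_univ, true_and] at hp ⊢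
    rcases dist_update_midpoint_le hR hs hab p.1 p.2 with h | ⟨-, -, h⟩
    · exact absurd h hp.not_ge
    · rwa [← h]
  · simp only [Finset.mem_filter, Finset.mem_univ, true_and, not_lt]
    rcases dist_update_midpoint_le hR hs hab a b with h | ⟨h, -, -⟩
    · exact h
    · exact absurd rfl h

variable [FiniteDimensional ℝ E] {B : Type*} [AddCommGroup B] {N : B → ℝ≥0∞} {k : ℕ} {K : Set E}
  {g : (Fin (k + 1) → E) → B}

/-- An estimate for the simplices of diameter at most one extends to all simplices of bounded
diameter. -/
theorem IsFlatCochain.le_of_small (hK : Convex ℝ K) (hg : IsFlatCochain K g)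
    (hN : IsSubadditive N) {α : ℝ} (hα : α ∈ Icc (0 : ℝ) 1) {X : ℝ≥0∞}
    (hX : ∀ s : Fin (k + 1) → E, (∀ i, s i ∈ K) → (∀ i j, dist (s i) (s j) ≤ 1) →
      N (g s) ≤ X * ENNReal.ofReal (tupleMass α s))
    {R : ℝ} {p : ℕ} (hp : R * (9 / 10) ^ p ≤ 1) {s : Fin (k + 1) → E} (hs : ∀ i, s i ∈ K)
    (hsR : ∀ i j, dist (s i) (s j) ≤ R) :
    N (g s) ≤ 2 ^ (p * (k + 1) ^ 2) * (X * ENNReal.ofReal (tupleMass α s)) := by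
  induction p generalizing R s with
  | zero =>
    simp only [pow_zero, mul_one] at hp
    simpa using hX s hs fun i j => (hsR i j).trans hp
  | succ p ih =>
    have hR : 0 ≤ R := dist_nonneg.trans (hsR 0 0)
    -- Here t bounds the number of pairs longer than 9R/10. Each bisection lowers that number and
    -- doubles the constant, so (k+1)² bisections in depth shrink the diameter by the factor 9/10.
    have inner : ∀ (t : ℕ) (s : Fin (k + 1) → E), (∀ i, s i ∈ K) → (∀ i j, dist (s i) (s j) ≤ R) →
        (Finset.univ.filter fun q : Fin (k + 1) × Fin (k + 1) =>
          R * (9 / 10) < dist (s q.1) (s q.2)).card ≤ t →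
        N (g s) ≤ 2 ^ (t + p * (k + 1) ^ 2) * (X * ENNReal.ofReal (tupleMass α s)) := by
      intro t
      induction t with
      | zero =>
        intro s hs hsR hc
        rw [zero_add]
        refine ih (R := R * (9 / 10)) (by rw [mul_assoc, ← pow_succ']; exact hp) hs fun i j => ?_
        by_contra! h
        have : ((i, j) : Fin (k + 1) × Fin (k + 1)) ∈ Finset.univ.filter
            fun q : Fin (k + 1) × Fin (k + 1) => R * (9 / 10) < dist (s q.1) (s q.2) := by
          simpa using h
        rw [Finset.card_eq_zero.1 (Nat.le_zero.1 hc)] at this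
        exact absurd this (Finset.notMem_empty _)
      | succ t iht =>
        intro s hs hsR hc
        by_cases hex : ∃ a b, R * (9 / 10) < dist (s a) (s b)
        · obtain ⟨a, b, hab⟩ := hex
          have hne : a ≠ b := by
            rintro rfl
            rw [dist_self] at hab
            linarith
          have hstep : ∀ a b : Fin (k + 1), a ≠ b → R * (9 / 10) < dist (s a) (s b) →
              N (g (Function.update s a (midpoint ℝ (s a) (s b)))) ≤
                2 ^ (t + p * (k + 1) ^ 2) * (X * ENNReal.ofReal (tupleMass α s)) := by
            intro a b hne hab
            refine (iht _ (forall_update_mem (hK.midpoint_mem (hs a) (hs b)) hs a)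
              (fun i j => ?_) ?_).trans ?_
            · rcases dist_update_midpoint_le hR hsR hab i j with h | ⟨-, -, h⟩
              · exact h.trans (by linarith)
              · rw [h]; exact hsR i j
            · have := card_long_update_lt hR hsR hab
              omega
            · gcongr
              exact tupleMass_update_midpoint_le hα.1 hα.2 s hne
          rw [hg.bisect hs hne (hK.midpoint_mem (hs a) (hs b))
            (AffineMap.lineMap_mem_affineSpan_pair _ _ _)]
          refine (hN.add _ _).trans ?_
          have h1 := hstep a b hne hab
          have h2 := hstep b a hne.symm (by rwa [dist_comm])
          rw [midpoint_comm] at h2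
          refine (add_le_add h1 h2).trans (le_of_eq ?_)
          rw [← two_mul, ← mul_assoc, ← pow_succ']
          congr 2
          ring
        · push Not at hex
          refine (iht s hs hsR ?_).trans ?_
          · rw [Finset.filter_false_of_mem fun q _ => (hex q.1 q.2).not_gt]
            simp
          · gcongr
            · norm_num
            · omega
    refine (inner ((k + 1) ^ 2) s hs hsR ?_).trans (le_of_eq ?_)
    · refine (Finset.card_filter_le _ _).trans (le_of_eq ?_)
      rw [Finset.card_univ, Fintype.card_prod, Fintype.card_fin, sq]
    · congr 2
      ring

end Diameter

set_option linter.unusedSectionVars false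

/-! ### Limits along dyadic grids -/

section DyadicLimit

open Filter Topology

variable {E : Type*} [NormedAddCommGroup E] [InnerProductSpace ℝ E] [FiniteDimensional ℝ E]

theorem isSubadditive_enorm : IsSubadditive (fun x : ℝ => ‖x‖ₑ) where
  zero := enorm_zero
  add := enorm_add_le
  neg := enorm_neg

theorem enorm_le_mul_ofReal_iff {x a b : ℝ} (ha : 0 ≤ a) (hb : 0 ≤ b) :
    ‖x‖ₑ ≤ ENNReal.ofReal a * ENNReal.ofReal b ↔ |x| ≤ a * b := by
  rw [← ENNReal.ofReal_mul ha, Real.enorm_eq_ofReal_abs,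
    ENNReal.ofReal_le_ofReal_iff (mul_nonneg ha hb)]

theorem IsFlatCochain.abs_sub_le {k : ℕ} {S : Set E} {g : (Fin (k + 1) → E) → ℝ} {X Y : ℝ}
    {α β δ : ℝ} {q : ℕ → ℝ} {v : Fin (k + 1) → E} (hg : IsFlatCochain S g)
    (hα : α ∈ Icc (0 : ℝ) 1) (hβ : β ∈ Icc (0 : ℝ) 1) (hX0 : 0 ≤ X) (hY0 : 0 ≤ Y)
    (hX : ∀ s : Fin (k + 1) → E, (∀ i, s i ∈ S) → |g s| ≤ X * tupleMass α s)
    (hY : ∀ s : Fin (k + 2) → E, (∀ i, s i ∈ S) →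
      |coboundary g s| ≤ Y * tupleMass β (n := k + 1) s)
    (h : VolumeBound v δ q k) {s w : Fin (k + 1) → E} (hs : ∀ i, s i ∈ S)
    (hsv : ∀ i, dist (s i) (v i) ≤ δ) (hw : ∀ i, w i ∈ S)
    (hwv : ∀ i, dist (w i) (v i) ≤ δ) :
    |g s - g w| ≤ (k + 1) * (Y * (2 ^ (k + 1) * q k * (2 * δ) ^ β) +
      k * (X * (2 ^ k * q (k - 1) * (2 * δ) ^ α))) := by
  have h1 := hg.sub_le isSubadditive_enorm hα hβ (X := ENNReal.ofReal X) (Y := ENNReal.ofReal Y)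
    (fun s hs => (enorm_le_mul_ofReal_iff hX0 (tupleMass_nonneg _ _)).2 (hX s hs))
    (fun s hs => (enorm_le_mul_ofReal_iff hY0 (tupleMass_nonneg _ _)).2 (hY s hs)) h hs hsv hw hwv
  have hδ : 0 ≤ 2 * δ := by linarith [h.delta_nonneg]
  have e1 : 0 ≤ 2 ^ (k + 1) * q k * (2 * δ) ^ β :=
    mul_nonneg (mul_nonneg (by positivity) (h.nonneg _)) (Real.rpow_nonneg hδ _)
  have e2 : 0 ≤ 2 ^ k * q (k - 1) * (2 * δ) ^ α :=
    mul_nonneg (mul_nonneg (by positivity) (h.nonneg _)) (Real.rpow_nonneg hδ _)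
  rw [incrementBound, ← ENNReal.ofReal_mul hX0, ← ENNReal.ofReal_mul hY0, ← ENNReal.ofReal_natCast k,
    ← ENNReal.ofReal_mul (by positivity), ← ENNReal.ofReal_add (by positivity) (by positivity),
    ← ENNReal.ofReal_natCast (k + 1), ← ENNReal.ofReal_mul (by positivity),
    Real.enorm_eq_ofReal_abs, ENNReal.ofReal_le_ofReal_iff (by positivity)] at h1
  simpa using h1

/-- A sequence of discretisation maps of a bounded set `K`, at the dyadic scales. -/
structure DyadicGrid (K : Set E) (R : ℝ) (π : ℕ → E → E) : Prop where
  mem : ∀ n, ∀ x ∈ K, π n x ∈ K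
  dist_le : ∀ n, ∀ x ∈ K, dist (π n x) x ≤ (1 / 2) ^ n
  two_le : 2 ≤ R
  diam_le : ∀ x ∈ K, ∀ y ∈ K, dist x y ≤ R

/-- The points of two successive levels of a dyadic grid. -/
def gridPoints (K : Set E) (π : ℕ → E → E) (n : ℕ) : Set E := π n '' K ∪ π (n + 1) '' K

/-- On the simplices of level `n`, `g` is bounded by `2 ^ (n * (α' - α))` times the `α'`-mass. -/
def DyadicBound (K : Set E) (π : ℕ → E → E) {k : ℕ} (g : (Fin (k + 1) → E) → ℝ) (Z α' α : ℝ) :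
    Prop :=
  ∀ (n : ℕ) (s : Fin (k + 1) → E), (∀ i, s i ∈ gridPoints K π n) →
    |g s| ≤ Z * 2 ^ ((n : ℝ) * (α' - α)) * tupleMass α' s

/-- The limit of the values of `g` on the discretisations of a tuple. -/
noncomputable def dyadicLimit (π : ℕ → E → E) {k : ℕ} (g : (Fin (k + 1) → E) → ℝ)
    (v : Fin (k + 1) → E) : ℝ :=
  limUnder atTop fun n => g fun i => π n (v i)

/-- The loss 2^(n(α'-α)) permitted at level n, times the gain from pairs at distance of order
2^(-n), is the summable 2^(-nα). -/
theorem two_rpow_mul_rpow (n : ℕ) (α' α : ℝ) :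
    (2 : ℝ) ^ ((n : ℝ) * (α' - α)) * (2 * (2 * (1 / 2) ^ n)) ^ α' =
      4 ^ α' * ((2 : ℝ) ^ (-α)) ^ n := by
  have h2 : (0 : ℝ) < 2 := two_pos
  rw [← mul_assoc, Real.mul_rpow (by norm_num) (by positivity), ← Real.rpow_natCast (2 ^ (-α)) n,
    ← Real.rpow_mul h2.le, one_div, inv_pow, Real.inv_rpow (by positivity),
    ← Real.rpow_natCast 2 n, ← Real.rpow_mul h2.le, ← Real.rpow_neg h2.le]
  rw [mul_left_comm, ← Real.rpow_add h2]
  congr 1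
  · norm_num
  · congr 1
    ring

variable {K : Set E} {R : ℝ} {π : ℕ → E → E} {k : ℕ} {g : (Fin (k + 1) → E) → ℝ}
  {Z α' β' α β : ℝ}

theorem DyadicGrid.mem_gridPoints (n : ℕ) {x : E} (hx : x ∈ K) : π n x ∈ gridPoints K π n :=
  Or.inl ⟨x, hx, rfl⟩

theorem DyadicGrid.succ_mem_gridPoints (n : ℕ) {x : E} (hx : x ∈ K) :
    π (n + 1) x ∈ gridPoints K π n :=
  Or.inr ⟨x, hx, rfl⟩

theorem DyadicGrid.gridPoints_subset (hπ : DyadicGrid K R π) (n : ℕ) : gridPoints K π n ⊆ K := by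
  rintro _ (⟨x, hx, rfl⟩ | ⟨x, hx, rfl⟩)
  exacts [hπ.mem _ _ hx, hπ.mem _ _ hx]

theorem IsFlatCochain.mono {B : Type*} [AddCommGroup B] {n : ℕ} {S T : Set E}
    {g : (Fin n → E) → B} (h : IsFlatCochain T g) (hST : S ⊆ T) : IsFlatCochain S g :=
  ⟨fun v hv => h.degenerate v fun i => hST (hv i), fun u hu => h.closed u fun i => hST (hu i)⟩

/-- The assumptions on the restriction of a cochain to a dyadic grid. -/
structure IsDyadicCochain (K : Set E) (R : ℝ) (π : ℕ → E → E) {k : ℕ}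
    (g : (Fin (k + 1) → E) → ℝ) (Z α' β' α β : ℝ) : Prop where
  grid : DyadicGrid K R π
  flat : IsFlatCochain (⋃ n, gridPoints K π n) g
  bound : DyadicBound K π g Z α' α
  coboundary_bound : DyadicBound (k := k + 1) K π (coboundary g) Z β' β
  Z_nonneg : 0 ≤ Z
  α_pos : 0 < α
  β_pos : 0 < β
  α_lt : α < α'
  β_lt : β < β'
  α'_le : α' ≤ 1
  β'_le : β' ≤ 1

theorem IsDyadicCochain.coboundary_isDyadic (h : IsDyadicCochain K R π g Z α' β' α β) :
    IsDyadicCochain (k := k + 1) K R π (coboundary g) Z β' β' β β where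
  grid := h.grid
  flat := h.flat.coboundary_isFlat
  bound := h.coboundary_bound
  coboundary_bound n s _ := by
    rw [coboundary_coboundary, abs_zero]
    exact mul_nonneg (mul_nonneg h.Z_nonneg (by positivity)) (tupleMass_nonneg _ _)
  Z_nonneg := h.Z_nonneg
  α_pos := h.β_pos
  β_pos := h.β_pos
  α_lt := h.β_lt
  β_lt := h.β_lt
  α'_le := h.β'_le
  β'_le := h.β'_le

theorem four_rpow_le {a : ℝ} (h : a ≤ 1) : (4 : ℝ) ^ a ≤ 4 := by
  simpa using Real.rpow_le_rpow_of_exponent_le (by norm_num : (1 : ℝ) ≤ 4) h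

theorem two_rpow_neg_lt_one {a : ℝ} (h : 0 < a) : (2 : ℝ) ^ (-a) < 1 :=
  Real.rpow_lt_one_of_one_lt_of_neg (by norm_num) (by linarith)

theorem IsDyadicCochain.abs_sub_le (h : IsDyadicCochain K R π g Z α' β' α β) (n : ℕ)
    {q : ℕ → ℝ} {v s w : Fin (k + 1) → E} (hv : VolumeBound v (2 * (1 / 2) ^ n) q k)
    (hs : ∀ i, s i ∈ gridPoints K π n) (hsv : ∀ i, dist (s i) (v i) ≤ 2 * (1 / 2) ^ n)
    (hw : ∀ i, w i ∈ gridPoints K π n) (hwv : ∀ i, dist (w i) (v i) ≤ 2 * (1 / 2) ^ n) :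
    |g s - g w| ≤ (k + 1) ^ 2 * 2 ^ (k + 3) * Z * (q k * ((2 : ℝ) ^ (-β)) ^ n +
      q (k - 1) * ((2 : ℝ) ^ (-α)) ^ n) := by
  have hZ := h.Z_nonneg
  have hα' : α' ∈ Icc (0 : ℝ) 1 := ⟨(h.α_pos.trans h.α_lt).le, h.α'_le⟩
  have hβ' : β' ∈ Icc (0 : ℝ) 1 := ⟨(h.β_pos.trans h.β_lt).le, h.β'_le⟩
  have h1 := (h.flat.mono (subset_iUnion _ n)).abs_sub_le hα' hβ'
    (mul_nonneg hZ (by positivity)) (mul_nonneg hZ (by positivity)) (h.bound n)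
    (h.coboundary_bound n) hv hs hsv hw hwv
  refine h1.trans ?_
  have hq := hv.nonneg k
  have hq' := hv.nonneg (k - 1)
  have ea := two_rpow_mul_rpow n α' α
  have eb := two_rpow_mul_rpow n β' β
  have e1 : Z * 2 ^ ((n : ℝ) * (β' - β)) * (2 ^ (k + 1) * q k * (2 * (2 * (1 / 2) ^ n)) ^ β') ≤
      2 ^ (k + 3) * Z * (q k * ((2 : ℝ) ^ (-β)) ^ n) := by
    calc _ = 2 ^ (k + 1) * Z * q k *
          (2 ^ ((n : ℝ) * (β' - β)) * (2 * (2 * (1 / 2) ^ n)) ^ β') := by ring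
      _ = 2 ^ (k + 1) * Z * q k * (4 ^ β' * ((2 : ℝ) ^ (-β)) ^ n) := by rw [eb]
      _ ≤ 2 ^ (k + 1) * Z * q k * (4 * ((2 : ℝ) ^ (-β)) ^ n) := by
          gcongr; exact four_rpow_le h.β'_le
      _ = _ := by ring
  have e2 : Z * 2 ^ ((n : ℝ) * (α' - α)) * (2 ^ k * q (k - 1) * (2 * (2 * (1 / 2) ^ n)) ^ α') ≤
      2 ^ (k + 3) * Z * (q (k - 1) * ((2 : ℝ) ^ (-α)) ^ n) := by
    calc _ = 2 ^ k * Z * q (k - 1) *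
          (2 ^ ((n : ℝ) * (α' - α)) * (2 * (2 * (1 / 2) ^ n)) ^ α') := by ring
      _ = 2 ^ k * Z * q (k - 1) * (4 ^ α' * ((2 : ℝ) ^ (-α)) ^ n) := by rw [ea]
      _ ≤ 2 ^ (k + 1) * Z * q (k - 1) * (4 * ((2 : ℝ) ^ (-α)) ^ n) := by
          gcongr
          · norm_num
          · omega
          · exact four_rpow_le h.α'_le
      _ = _ := by ring
  have e3 : 0 ≤ 2 ^ (k + 3) * Z * (q k * ((2 : ℝ) ^ (-β)) ^ n) := by positivity
  have e4 : 0 ≤ 2 ^ (k + 3) * Z * (q (k - 1) * ((2 : ℝ) ^ (-α)) ^ n) := by positivity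
  have hk : (0 : ℝ) ≤ k := by positivity
  calc _ ≤ (k + 1 : ℝ) * (2 ^ (k + 3) * Z * (q k * ((2 : ℝ) ^ (-β)) ^ n) +
        k * (2 ^ (k + 3) * Z * (q (k - 1) * ((2 : ℝ) ^ (-α)) ^ n))) := by gcongr
    _ ≤ (k + 1 : ℝ) * ((k + 1) * (2 ^ (k + 3) * Z * (q k * ((2 : ℝ) ^ (-β)) ^ n)) +
        (k + 1) * (2 ^ (k + 3) * Z * (q (k - 1) * ((2 : ℝ) ^ (-α)) ^ n))) := by
        refine mul_le_mul_of_nonneg_left (add_le_add ?_ ?_) (by positivity)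
        · nlinarith
        · exact mul_le_mul_of_nonneg_right (by linarith) e4
    _ = _ := by ring

theorem IsDyadicCochain.volumeBound (h : IsDyadicCochain K R π g Z α' β' α β) (n : ℕ)
    {v : Fin (k + 1) → E} (hv : ∀ i, v i ∈ K) :
    VolumeBound v (2 * (1 / 2) ^ n) (fun j => R ^ j) k := by
  refine volumeBound_pow (by positivity) ?_ v (fun i j => h.grid.diam_le _ (hv i) _ (hv j)) k
  refine le_trans ?_ h.grid.two_le
  have : ((1 : ℝ) / 2) ^ n ≤ 1 := pow_le_one₀ (by norm_num) (by norm_num)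
  linarith

theorem DyadicGrid.dist_le_two_mul (h : DyadicGrid K R π) (n : ℕ) {x : E} (hx : x ∈ K) :
    dist (π n x) x ≤ 2 * (1 / 2) ^ n ∧ dist (π (n + 1) x) x ≤ 2 * (1 / 2) ^ n := by
  have h0 : (0 : ℝ) ≤ (1 / 2) ^ n := by positivity
  constructor
  · have := h.dist_le n x hx
    linarith
  · have := h.dist_le (n + 1) x hx
    rw [pow_succ] at this
    linarith

/-- Geometric bound for the increments of the discretisations. -/
theorem IsDyadicCochain.dist_succ_le (h : IsDyadicCochain K R π g Z α' β' α β) (n : ℕ)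
    {q : ℕ → ℝ} {v : Fin (k + 1) → E} (hv : ∀ i, v i ∈ K)
    (hq : VolumeBound v (2 * (1 / 2) ^ n) q k) :
    dist (g fun i => π n (v i)) (g fun i => π (n + 1) (v i)) ≤
      (k + 1) ^ 2 * 2 ^ (k + 3) * Z * (q k * ((2 : ℝ) ^ (-β)) ^ n +
        q (k - 1) * ((2 : ℝ) ^ (-α)) ^ n) := by
  rw [Real.dist_eq]
  exact h.abs_sub_le n hq (fun i => DyadicGrid.mem_gridPoints n (hv i))
    (fun i => (h.grid.dist_le_two_mul n (hv i)).1)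
    (fun i => DyadicGrid.succ_mem_gridPoints n (hv i))
    (fun i => (h.grid.dist_le_two_mul n (hv i)).2)

theorem summable_geometric_pair (A B : ℝ) (hα : 0 < α) (hβ : 0 < β) (n : ℕ) :
    HasSum (fun m : ℕ => A * ((2 : ℝ) ^ (-β)) ^ (m + n) + B * ((2 : ℝ) ^ (-α)) ^ (m + n))
      (A * ((2 : ℝ) ^ (-β)) ^ n / (1 - 2 ^ (-β)) + B * ((2 : ℝ) ^ (-α)) ^ n / (1 - 2 ^ (-α))) := by
  have key : ∀ (A : ℝ) {a : ℝ}, 0 < a → HasSum (fun m : ℕ => A * ((2 : ℝ) ^ (-a)) ^ (m + n))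
      (A * ((2 : ℝ) ^ (-a)) ^ n / (1 - 2 ^ (-a))) := by
    intro A a ha
    have := (hasSum_geometric_of_lt_one (r := (2 : ℝ) ^ (-a)) (by positivity)
      (two_rpow_neg_lt_one ha)).mul_left (A * ((2 : ℝ) ^ (-a)) ^ n)
    rw [div_eq_mul_inv]
    refine this.congr_fun fun m => ?_
    rw [pow_add]; ring
  exact (key A hβ).add (key B hα)

theorem IsDyadicCochain.tendsto (h : IsDyadicCochain K R π g Z α' β' α β)
    {v : Fin (k + 1) → E} (hv : ∀ i, v i ∈ K) :
    Tendsto (fun n => g fun i => π n (v i)) atTop (𝓝 (dyadicLimit π g v)) := by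
  have hc : CauchySeq fun n => g fun i => π n (v i) := by
    refine cauchySeq_of_dist_le_of_summable _
      (fun n => h.dist_succ_le n hv (h.volumeBound n hv)) (Summable.mul_left _ ?_)
    simpa using (summable_geometric_pair (R ^ k) (R ^ (k - 1)) h.α_pos h.β_pos 0).summable
  exact hc.tendsto_limUnder

/-- The increments from level n on form a geometric tail. The bound q is left free, so that both the
crude and the sharp volume bounds can be inserted. -/
theorem IsDyadicCochain.dist_limit_le (h : IsDyadicCochain K R π g Z α' β' α β)
    {v : Fin (k + 1) → E} (hv : ∀ i, v i ∈ K) (n : ℕ) {q : ℕ → ℝ}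
    (hq : ∀ m, n ≤ m → VolumeBound v (2 * (1 / 2) ^ m) q k) :
    dist (g fun i => π n (v i)) (dyadicLimit π g v) ≤
      (k + 1) ^ 2 * 2 ^ (k + 3) * Z * (q k * ((2 : ℝ) ^ (-β)) ^ n / (1 - 2 ^ (-β)) +
        q (k - 1) * ((2 : ℝ) ^ (-α)) ^ n / (1 - 2 ^ (-α))) := by
  have hs := (summable_geometric_pair (q k) (q (k - 1)) h.α_pos h.β_pos n).mul_left
    ((k + 1) ^ 2 * 2 ^ (k + 3) * Z)
  have := dist_le_tsum_of_dist_le_of_tendsto₀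
    (f := fun m => g fun i => π (m + n) (v i)) (d := fun m => (k + 1) ^ 2 * 2 ^ (k + 3) * Z *
      (q k * ((2 : ℝ) ^ (-β)) ^ (m + n) + q (k - 1) * ((2 : ℝ) ^ (-α)) ^ (m + n)))
    (fun m => by
      have := h.dist_succ_le (m + n) hv (hq (m + n) (Nat.le_add_left n m))
      rwa [show m.succ + n = m + n + 1 by omega]) hs.summable
    ((h.tendsto hv).comp (tendsto_add_atTop_nat n))
  rw [hs.tsum_eq] at this
  simpa using this

theorem coboundary_dyadicLimit (h : IsDyadicCochain K R π g Z α' β' α β)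
    {u : Fin (k + 1 + 1) → E} (hu : ∀ i, u i ∈ K) :
    coboundary (dyadicLimit π g) u = dyadicLimit (k := k + 1) π (coboundary g) u := by
  refine tendsto_nhds_unique ?_ (h.coboundary_isDyadic.tendsto hu)
  unfold coboundary
  refine tendsto_finsetSum _ fun i _ => ?_
  exact (h.tendsto fun j => hu _).const_smul _

/-- The discretisations of a degenerate tuple have volume of order 2^(-n), hence α'-mass of order
2^(-nα'), which beats the permitted growth 2^(n(α'-α)). -/
theorem tendsto_zero_of_degenerate {g : (Fin (k + 2) → E) → ℝ} (hπ : DyadicGrid K R π)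
    (hb : DyadicBound (k := k + 1) K π g Z α' α) (hZ : 0 ≤ Z) (hα : 0 < α) (hα' : α < α')
    (hα'1 : α' ≤ 1) {v : Fin (k + 2) → E} (hv : ∀ i, v i ∈ K) (hd : ¬ AffineIndependent ℝ v) :
    Tendsto (fun n => g fun i => π n (v i)) atTop (𝓝 0) := by
  have hR : 0 ≤ R := by linarith [hπ.two_le]
  set C : ℝ := Z * ((R ^ k) ^ (1 - α') * ((k + 2 : ℕ) * R ^ k) ^ α') with hC
  refine squeeze_zero_norm (a := fun n => C * ((2 : ℝ) ^ (-α)) ^ n) (fun n => ?_) ?_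
  · rw [Real.norm_eq_abs]
    refine (hb n _ fun i => DyadicGrid.mem_gridPoints n (hv i)).trans ?_
    have h1 : maxFaceVolume (fun i => π n (v i)) ≤ R ^ k :=
      maxFaceVolume_le_iff.2 fun i => gramVolume_le_pow _ fun a b =>
        hπ.diam_le _ (hπ.mem _ _ (hv _)) _ (hπ.mem _ _ (hv _))
    have h2 : gramVolume (fun i => π n (v i)) ≤ ((k + 2 : ℕ) * R ^ k) * (1 / 2) ^ n := by
      have := gramVolume_le_add_of_dist_le (by positivity)
        (fun i => hπ.dist_le n _ (hv i)) hv (fun i => hπ.mem n _ (hv i)) hπ.diam_le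
      rw [gramVolume_eq_zero hd, zero_add] at this
      calc _ ≤ _ := this
        _ = _ := by ring
    have h3 : (2 : ℝ) ^ ((n : ℝ) * (α' - α)) * ((1 / 2) ^ n) ^ α' = ((2 : ℝ) ^ (-α)) ^ n := by
      have := two_rpow_mul_rpow n α' α
      rw [← mul_assoc, Real.mul_rpow (by norm_num) (by positivity), mul_left_comm] at this
      norm_num at this ⊢
      have h4 : (4 : ℝ) ^ α' ≠ 0 := by positivity
      exact this.resolve_right h4
    rw [tupleMass_succ]
    calc _ ≤ Z * 2 ^ ((n : ℝ) * (α' - α)) *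
          ((R ^ k) ^ (1 - α') * (((k + 2 : ℕ) * R ^ k) * (1 / 2) ^ n) ^ α') := by
          refine mul_le_mul_of_nonneg_left ?_ (mul_nonneg hZ (by positivity))
          refine mul_le_mul ?_ ?_ (Real.rpow_nonneg (gramVolume_nonneg _) _) (by positivity)
          · exact Real.rpow_le_rpow (maxFaceVolume_nonneg _) h1 (by linarith)
          · exact Real.rpow_le_rpow (gramVolume_nonneg _) h2 (by linarith)
      _ = C * (2 ^ ((n : ℝ) * (α' - α)) * ((1 / 2) ^ n) ^ α') := by
          rw [Real.mul_rpow (by positivity) (by positivity), hC]; ring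
      _ = _ := by rw [h3]
  · have := (tendsto_pow_atTop_nhds_zero_of_lt_one (r := (2 : ℝ) ^ (-α)) (by positivity)
      (two_rpow_neg_lt_one hα)).const_mul C
    simpa using this

theorem IsDyadicCochain.isFlatCochain_limit (h : IsDyadicCochain K R π g Z α' β' α β) :
    IsFlatCochain K (dyadicLimit π g) where
  degenerate v hv hd := by
    rcases k with _ | k
    · have : Subsingleton (Fin (0 + 1)) := inferInstanceAs (Subsingleton (Fin 1))
      exact absurd (affineIndependent_of_subsingleton ℝ v) hd
    · exact tendsto_nhds_unique (h.tendsto hv)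
        (tendsto_zero_of_degenerate h.grid h.bound h.Z_nonneg h.α_pos h.α_lt h.α'_le hv hd)
  closed u hu hd := by
    rw [coboundary_dyadicLimit h hu]
    exact tendsto_nhds_unique (h.coboundary_isDyadic.tendsto hu)
      (tendsto_zero_of_degenerate h.grid h.coboundary_bound h.Z_nonneg h.β_pos h.β_lt h.β'_le hu hd)

end DyadicLimit

/-! ### Mass bound and continuity of the limit -/

section DyadicLimitBound

open Filter Topology

variable {E : Type*} [NormedAddCommGroup E] [InnerProductSpace ℝ E] [FiniteDimensional ℝ E]
  {K : Set E} {R : ℝ} {π : ℕ → E → E} {k : ℕ} {g : (Fin (k + 1) → E) → ℝ} {Z α' β' α β : ℝ}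

theorem tupleMass_eq_mul_rpow (α : ℝ) {n : ℕ} {v : Fin (n + 2) → E} (hv : AffineIndependent ℝ v) :
    tupleMass α (n := n + 1) v =
      maxFaceVolume v * (gramVolume v / maxFaceVolume v) ^ α := by
  have hQ := maxFaceVolume_pos hv
  rw [tupleMass_succ, Real.div_rpow (gramVolume_nonneg v) hQ.le, Real.rpow_sub hQ, Real.rpow_one]
  ring

/-- The constant in the bound of the limit of a dyadic cochain. -/
noncomputable def limitConstant (k : ℕ) (R α β : ℝ) : ℝ :=
  2 ^ (k + 3) * R + (k + 1) ^ 2 * 2 ^ (k + 3) * (R / (1 - 2 ^ (-β)) + 1 / (1 - 2 ^ (-α)))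

theorem two_rpow_neg_pow (n : ℕ) (a : ℝ) : ((2 : ℝ) ^ (-a)) ^ n = ((1 / 2) ^ n) ^ a := by
  rw [one_div, inv_pow, Real.inv_rpow (by positivity), ← Real.rpow_natCast, ← Real.rpow_natCast,
    ← Real.rpow_mul two_pos.le, ← Real.rpow_mul two_pos.le, ← Real.rpow_neg two_pos.le]
  congr 1
  ring

/-- The first level with 2·2^(-n) below the height. The upper bound comes from minimality of that
level, or from h ≤ R at level 0; both use R ≥ 2. -/
theorem exists_dyadic_scale {h R : ℝ} (hR : 2 ≤ R) (h0 : 0 < h) (hhR : h ≤ R) :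
    ∃ n : ℕ, 2 * (1 / 2) ^ n ≤ h ∧ h ≤ 2 * R * (1 / 2) ^ n := by
  classical
  have hex : ∃ n : ℕ, 2 * (1 / 2 : ℝ) ^ n ≤ h := by
    obtain ⟨n, hn⟩ := exists_pow_lt_of_lt_one (half_pos h0) (by norm_num : (1 / 2 : ℝ) < 1)
    exact ⟨n, by linarith⟩
  refine ⟨Nat.find hex, Nat.find_spec hex, ?_⟩
  rcases hn : Nat.find hex with _ | n
  · simp; linarith
  · have := Nat.find_min hex (m := n) (by omega)
    rw [not_le] at this
    have hp : (0 : ℝ) < (1 / 2) ^ n := by positivity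
    rw [pow_succ]
    nlinarith

/-- Write Q for the largest facet volume and t for the height, and start at the level n with mesh
comparable to t. From there on the displacements stay below t, so face volumes are stable. At level
n the factor 2^(n(α'-α)) is of order t^(α-α') and turns Q t^α' into Q t^α. The later increments add
multiples of Q t 2^(-nβ) and Q 2^(-nα), both at most of order Q t^α. -/
theorem IsDyadicCochain.abs_limit_le (h : IsDyadicCochain K R π g Z α' β' α β)
    {v : Fin (k + 1) → E} (hv : ∀ i, v i ∈ K) (hi : AffineIndependent ℝ v) :
    |dyadicLimit π g v| ≤ limitConstant k R α β * (Z * tupleMass α v) := by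
  have hZ := h.Z_nonneg
  have hR2 := h.grid.two_le
  have hR : 0 < R := by linarith
  have hrα : (0 : ℝ) < 1 - 2 ^ (-α) := by linarith [two_rpow_neg_lt_one h.α_pos]
  have hrβ : (0 : ℝ) < 1 - 2 ^ (-β) := by linarith [two_rpow_neg_lt_one h.β_pos]
  have hα1 : α ≤ 1 := (h.α_lt.trans_le h.α'_le).le
  have hα'0 : 0 ≤ α' := (h.α_pos.trans h.α_lt).le
  have htri : ∀ n, |dyadicLimit π g v| ≤ |g fun i => π n (v i)| +
      dist (g fun i => π n (v i)) (dyadicLimit π g v) := by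
    intro n
    have := abs_sub_abs_le_abs_sub (dyadicLimit π g v) (g fun i => π n (v i))
    rw [dist_comm, Real.dist_eq]; linarith
  rcases k with _ | k
  -- For points the mass is 1 and level 0 suffices.
  · have h1 := h.dist_limit_le hv 0 fun m _ => h.volumeBound m hv
    have h2 := h.bound 0 (fun i => π 0 (v i)) fun i => DyadicGrid.mem_gridPoints 0 (hv i)
    have h3 := htri 0
    simp only [tupleMass_point, CharP.cast_eq_zero, zero_mul, Real.rpow_zero, mul_one, zero_add,
      pow_zero, one_pow, one_mul, Nat.zero_sub, limitConstant] at h1 h2 h3 ⊢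
    have h4 : 1 / (1 - (2 : ℝ) ^ (-β)) ≤ R / (1 - 2 ^ (-β)) := by gcongr; linarith
    have h5 : 2 ^ 3 * Z * (1 / (1 - (2 : ℝ) ^ (-β)) + 1 / (1 - 2 ^ (-α))) ≤
        2 ^ 3 * Z * (R / (1 - 2 ^ (-β)) + 1 / (1 - 2 ^ (-α))) := by gcongr
    have h6 : Z ≤ 2 ^ 3 * R * Z := by nlinarith
    linarith
  · set Q := maxFaceVolume v with hQdef
    have hQ : 0 < Q := maxFaceVolume_pos hi
    set t := gramVolume v / Q with ht
    have ht0 : 0 < t := div_pos (gramVolume_pos hi) hQ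
    have htR : t ≤ R := height_le_diam hi fun i j => h.grid.diam_le _ (hv i) _ (hv j)
    have hvol : gramVolume v = Q * t := by rw [ht]; field_simp
    obtain ⟨n, hn, hn'⟩ := exists_dyadic_scale hR2 ht0 htR
    have hp : (0 : ℝ) < (1 / 2) ^ n := by positivity
    have hV : ∀ m, n ≤ m → VolumeBound v (2 * (1 / 2) ^ m) (faceVolume v) (k + 1) := by
      intro m hm
      refine volumeBound_faceVolume hi (by positivity) (le_trans ?_ hn)
      have : ((1 : ℝ) / 2) ^ m ≤ (1 / 2) ^ n :=
        pow_le_pow_of_le_one (by norm_num) (by norm_num) hm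
      linarith
    have h1 := h.dist_limit_le hv n hV
    have h2 := h.bound n (fun i => π n (v i)) fun i => DyadicGrid.mem_gridPoints n (hv i)
    have h3 := (hV n le_rfl).tupleMass_le hα'0 h.α'_le
      fun a => (h.grid.dist_le_two_mul n (hv a)).1
    have hf1 : faceVolume v (k + 1) ≤ Q * t := hvol ▸ faceVolume_self_le v
    have hf0 : faceVolume v k ≤ Q := faceVolume_pred_le v
    have hmass : tupleMass α (n := k + 1) v = Q * t ^ α := tupleMass_eq_mul_rpow α hi
    have htα : 0 < t ^ α := Real.rpow_pos_of_pos ht0 _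
    have hcα : ((2 : ℝ) ^ (-α)) ^ n ≤ t ^ α := by
      rw [two_rpow_neg_pow]
      exact Real.rpow_le_rpow hp.le (by linarith) h.α_pos.le
    have hcβ : ((2 : ℝ) ^ (-β)) ^ n ≤ 1 :=
      pow_le_one₀ (by positivity) (two_rpow_neg_lt_one h.β_pos).le
    have htt : t ≤ R * t ^ α := by
      calc t = t ^ (1 - α) * t ^ α := by rw [← Real.rpow_add ht0]; simp
        _ ≤ R * t ^ α := by
            refine mul_le_mul_of_nonneg_right ?_ htα.le
            calc t ^ (1 - α) ≤ R ^ (1 - α) := Real.rpow_le_rpow ht0.le htR (by linarith)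
              _ ≤ R ^ (1 : ℝ) :=
                Real.rpow_le_rpow_of_exponent_le (by linarith) (by linarith [h.α_pos])
              _ = R := Real.rpow_one R
    have hmain : |g fun i => π n (v i)| ≤ 2 ^ (k + 4) * R * Z * (Q * t ^ α) := by
      refine h2.trans ?_
      have e1 : (2 ^ (k + 1) * faceVolume v k) ^ (1 - α') *
          (2 ^ (k + 2) * faceVolume v (k + 1)) ^ α' ≤ 2 ^ (k + 2) * Q * t ^ α' := by
        calc _ ≤ (2 ^ (k + 2) * Q) ^ (1 - α') * (2 ^ (k + 2) * (Q * t)) ^ α' := by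
              have n0 := faceVolume_nonneg v k
              have n1 := faceVolume_nonneg v (k + 1)
              have := h.α'_le
              refine mul_le_mul (Real.rpow_le_rpow (by positivity) ?_ (by linarith))
                (Real.rpow_le_rpow (by positivity) (by gcongr) hα'0) (by positivity)
                (by positivity)
              gcongr
              · norm_num
              · omega
          _ = (2 ^ (k + 2) * Q) ^ (1 - α') * (2 ^ (k + 2) * Q) ^ α' * t ^ α' := by
              rw [← mul_assoc, Real.mul_rpow (by positivity) ht0.le, ← mul_assoc]
          _ = _ := by rw [← Real.rpow_add (by positivity)]; simp
      have e2 : (2 : ℝ) ^ ((n : ℝ) * (α' - α)) * t ^ α' ≤ 2 * R * t ^ α := by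
        have hab : 0 ≤ α' - α := by linarith [h.α_lt]
        have e3 : t ^ (α' - α) ≤ 2 * R * ((1 / 2) ^ n) ^ (α' - α) := by
          calc t ^ (α' - α) ≤ (2 * R * (1 / 2) ^ n) ^ (α' - α) :=
                Real.rpow_le_rpow ht0.le hn' hab
            _ = (2 * R) ^ (α' - α) * ((1 / 2) ^ n) ^ (α' - α) :=
                Real.mul_rpow (by positivity) (by positivity)
            _ ≤ _ := by
                refine mul_le_mul_of_nonneg_right ?_ (by positivity)
                calc (2 * R) ^ (α' - α) ≤ (2 * R) ^ (1 : ℝ) :=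
                      Real.rpow_le_rpow_of_exponent_le (by linarith)
                        (by linarith [h.α_pos, h.α'_le])
                  _ = _ := Real.rpow_one _
        have e4 : (2 : ℝ) ^ ((n : ℝ) * (α' - α)) * ((1 / 2) ^ n) ^ (α' - α) = 1 := by
          rw [← two_rpow_neg_pow, ← Real.rpow_natCast, ← Real.rpow_mul two_pos.le,
            ← Real.rpow_add two_pos]
          convert Real.rpow_zero _ using 2
          ring
        calc _ = (2 : ℝ) ^ ((n : ℝ) * (α' - α)) * t ^ (α' - α) * t ^ α := by
              rw [mul_assoc, ← Real.rpow_add ht0]; simp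
          _ ≤ (2 : ℝ) ^ ((n : ℝ) * (α' - α)) * (2 * R * ((1 / 2) ^ n) ^ (α' - α)) * t ^ α := by
              gcongr
          _ = 2 * R * t ^ α * ((2 : ℝ) ^ ((n : ℝ) * (α' - α)) * ((1 / 2) ^ n) ^ (α' - α)) := by
              ring
          _ = _ := by rw [e4, mul_one]
      calc _ ≤ Z * 2 ^ ((n : ℝ) * (α' - α)) * (2 ^ (k + 2) * Q * t ^ α') := by
            gcongr; exact h3.trans e1
        _ = 2 ^ (k + 2) * Q * Z * ((2 : ℝ) ^ ((n : ℝ) * (α' - α)) * t ^ α') := by ring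
        _ ≤ 2 ^ (k + 2) * Q * Z * (2 * R * t ^ α) := by gcongr
        _ = 2 ^ (k + 3) * R * Z * (Q * t ^ α) := by ring
        _ ≤ _ := by gcongr <;> norm_num
    have hinc : dist (g fun i => π n (v i)) (dyadicLimit π g v) ≤
        ((k + 1 : ℕ) + 1) ^ 2 * 2 ^ (k + 1 + 3) * Z *
          (R / (1 - 2 ^ (-β)) + 1 / (1 - 2 ^ (-α))) * (Q * t ^ α) := by
      refine h1.trans ?_
      refine (mul_le_mul_of_nonneg_left (c := (Q * R * t ^ α / (1 - 2 ^ (-β)) +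
        Q * t ^ α / (1 - 2 ^ (-α)))) ?_ (by positivity)).trans (le_of_eq (by push_cast; ring))
      refine add_le_add (div_le_div_of_nonneg_right ?_ hrβ.le) (div_le_div_of_nonneg_right ?_ hrα.le)
      · calc _ ≤ Q * t * 1 := by
              refine mul_le_mul hf1 hcβ (by positivity) (by positivity)
          _ ≤ Q * (R * t ^ α) := by rw [mul_one]; gcongr
          _ = _ := by ring
      · exact mul_le_mul hf0 hcα (by positivity) hQ.le
    refine (htri n).trans ((add_le_add hmain hinc).trans (le_of_eq ?_))
    rw [hmass, limitConstant]
    ring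

theorem IsDyadicCochain.abs_coboundary_limit_le (h : IsDyadicCochain K R π g Z α' β' α β)
    {u : Fin (k + 1 + 1) → E} (hu : ∀ i, u i ∈ K) (hi : AffineIndependent ℝ u) :
    |coboundary (dyadicLimit π g) u| ≤
      limitConstant (k + 1) R β β * (Z * tupleMass (n := k + 1) β u) := by
  rw [coboundary_dyadicLimit h hu]
  exact h.coboundary_isDyadic.abs_limit_le hu hi

/-- The grid maps are discontinuous, but if v and w differ by less than 2^(-n), both discretisations
at level n are within 2·2^(-n) of v. Their values therefore differ by the level-n increment bound,
and the remaining two errors are uniform tails. -/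
theorem IsDyadicCochain.continuousOn_limit (h : IsDyadicCochain K R π g Z α' β' α β) :
    ContinuousOn (dyadicLimit π g) {v | ∀ i, v i ∈ K} := by
  have hrα : (0 : ℝ) < 1 - 2 ^ (-α) := by linarith [two_rpow_neg_lt_one h.α_pos]
  have hrβ : (0 : ℝ) < 1 - 2 ^ (-β) := by linarith [two_rpow_neg_lt_one h.β_pos]
  set T : ℕ → ℝ := fun n => (k + 1) ^ 2 * 2 ^ (k + 3) * Z *
    (R ^ k * ((2 : ℝ) ^ (-β)) ^ n / (1 - 2 ^ (-β)) +
      R ^ (k - 1) * ((2 : ℝ) ^ (-α)) ^ n / (1 - 2 ^ (-α))) with hT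
  set T' : ℕ → ℝ := fun n => (k + 1) ^ 2 * 2 ^ (k + 3) * Z *
    (R ^ k * ((2 : ℝ) ^ (-β)) ^ n + R ^ (k - 1) * ((2 : ℝ) ^ (-α)) ^ n) with hT'
  have hlim : Tendsto (fun n => T n + T' n + T n) atTop (𝓝 0) := by
    have ha := tendsto_pow_atTop_nhds_zero_of_lt_one (r := (2 : ℝ) ^ (-α)) (by positivity)
      (two_rpow_neg_lt_one h.α_pos)
    have hb := tendsto_pow_atTop_nhds_zero_of_lt_one (r := (2 : ℝ) ^ (-β)) (by positivity)
      (two_rpow_neg_lt_one h.β_pos)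
    have e1 : Tendsto T atTop (𝓝 0) := by
      simpa using ((((hb.const_mul (R ^ k)).div_const (1 - 2 ^ (-β))).add
        ((ha.const_mul (R ^ (k - 1))).div_const (1 - 2 ^ (-α)))).const_mul
          ((k + 1) ^ 2 * 2 ^ (k + 3) * Z))
    have e2 : Tendsto T' atTop (𝓝 0) := by
      simpa using (((hb.const_mul (R ^ k)).add
        (ha.const_mul (R ^ (k - 1)))).const_mul ((k + 1) ^ 2 * 2 ^ (k + 3) * Z))
    simpa using (e1.add e2).add e1
  rw [Metric.continuousOn_iff]
  intro v hv ε hε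
  obtain ⟨n, hn⟩ := (hlim.eventually_lt_const hε).exists
  refine ⟨(1 / 2) ^ n, by positivity, fun w hw hwv => lt_of_le_of_lt ?_ hn⟩
  have hv1 := h.dist_limit_le hv n fun m _ => h.volumeBound m hv
  have hw1 := h.dist_limit_le hw n fun m _ => h.volumeBound m hw
  have hvw := h.abs_sub_le n (h.volumeBound n hv)
    (fun i => DyadicGrid.mem_gridPoints n (hv i)) (fun i => (h.grid.dist_le_two_mul n (hv i)).1)
    (fun i => DyadicGrid.mem_gridPoints n (hw i)) (fun i => by
      have h1 := h.grid.dist_le n _ (hw i)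
      have h2 := (dist_le_pi_dist w v i).trans hwv.le
      linarith [dist_triangle (π n (w i)) (w i) (v i)])
  rw [← Real.dist_eq, dist_comm] at hvw
  rw [dist_comm] at hw1
  refine (dist_triangle _ (g fun i => π n (w i)) _).trans ?_
  have := dist_triangle (g fun i => π n (w i)) (g fun i => π n (v i)) (dyadicLimit π g v)
  linarith

theorem IsDyadicCochain.limit_comp_perm (h : IsDyadicCochain K R π g Z α' β' α β)
    (e : Equiv.Perm (Fin (k + 1)))
    (hg : ∀ v : Fin (k + 1) → E, (∀ i, v i ∈ ⋃ n, gridPoints K π n) →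
      g (v ∘ e) = (Equiv.Perm.sign e : ℤ) * g v)
    {v : Fin (k + 1) → E} (hv : ∀ i, v i ∈ K) :
    dyadicLimit π g (v ∘ e) = (Equiv.Perm.sign e : ℤ) * dyadicLimit π g v := by
  refine tendsto_nhds_unique (h.tendsto (v := v ∘ e) fun i => hv _) ?_
  refine ((h.tendsto hv).const_mul ((Equiv.Perm.sign e : ℤ) : ℝ)).congr fun n => ?_
  exact (hg (fun i => π n (v i)) fun i =>
    mem_iUnion.2 ⟨n, DyadicGrid.mem_gridPoints n (hv i)⟩).symm

end DyadicLimitBound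

/-! ### Barycentric coordinates on the star of a point -/

section StarSubdivision

variable {E : Type*} [AddCommGroup E] [Module ℝ E]

theorem mem_convexHull_range_iff {ι : Type*} [Fintype ι] {v : ι → E} {x : E} :
    x ∈ convexHull ℝ (range v) ↔
      ∃ a : ι → ℝ, (∀ i, 0 ≤ a i) ∧ ∑ i, a i = 1 ∧ ∑ i, a i • v i = x := by
  classical
  have h : convexHull ℝ (range v) = Fintype.linearCombination ℝ v '' stdSimplex ℝ ι := by
    rw [← convexHull_basis_eq_stdSimplex, LinearMap.image_convexHull, ← range_comp]
    congr 2
    funext i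
    simp [Fintype.linearCombination_apply, ite_smul]
  rw [h]
  simp [stdSimplex, Fintype.linearCombination_apply, and_assoc]

theorem affineIndependent_iff_sum {ι : Type*} [Fintype ι] {v : ι → E} :
    AffineIndependent ℝ v ↔
      ∀ a : ι → ℝ, ∑ i, a i = 0 → ∑ i, a i • v i = 0 → ∀ i, a i = 0 := by
  rw [affineIndependent_iff_of_fintype]
  refine forall_congr' fun a => forall_congr' fun h => ?_
  rw [Finset.univ.weightedVSub_eq_linear_combination h]

theorem sum_smul_update {ι : Type*} [Fintype ι] [DecidableEq ι] (v : ι → E) (l a : ι → ℝ) (j : ι) :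
    ∑ i, a i • Function.update v j (∑ i, l i • v i) i =
      ∑ i, ((if i = j then 0 else a i) + a j * l i) • v i := by
  simp only [add_smul, Finset.sum_add_distrib, mul_smul, ← Finset.smul_sum]
  rw [← Finset.add_sum_erase _ _ (Finset.mem_univ j),
    ← Finset.add_sum_erase Finset.univ (fun i => (if i = j then 0 else a i) • v i)
      (Finset.mem_univ j)]
  simp only [Function.update_self, if_true, zero_smul, zero_add]
  rw [add_comm]
  congr 1
  refine Finset.sum_congr rfl fun i hi => ?_
  rw [Function.update_of_ne (Finset.ne_of_mem_erase hi), if_neg (Finset.ne_of_mem_erase hi)]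

theorem sum_update_weights {ι : Type*} [Fintype ι] [DecidableEq ι] {l : ι → ℝ} (hl : ∑ i, l i = 1)
    (a : ι → ℝ) (j : ι) :
    ∑ i, ((if i = j then 0 else a i) + a j * l i) = ∑ i, a i := by
  rw [Finset.sum_add_distrib, ← Finset.mul_sum, hl, mul_one,
    ← Finset.add_sum_erase Finset.univ a (Finset.mem_univ j),
    ← Finset.add_sum_erase Finset.univ (fun i => if i = j then 0 else a i) (Finset.mem_univ j)]
  rw [if_pos rfl, zero_add, add_comm]
  congr 1
  exact Finset.sum_congr rfl fun i hi => if_neg (Finset.ne_of_mem_erase hi)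

theorem AffineIndependent.weights_unique {ι : Type*} [Fintype ι] {v : ι → E}
    (hv : AffineIndependent ℝ v) {a b : ι → ℝ} (h : ∑ i, a i = ∑ i, b i)
    (h' : ∑ i, a i • v i = ∑ i, b i • v i) : a = b := by
  funext i
  refine sub_eq_zero.1 (affineIndependent_iff_sum.1 hv (fun i => a i - b i) ?_ ?_ i)
  · rw [Finset.sum_sub_distrib, h, sub_self]
  · simp only [sub_smul, Finset.sum_sub_distrib, h', sub_self]

theorem AffineIndependent.update_of_weight_ne_zero {ι : Type*} [Fintype ι] [DecidableEq ι]
    {v : ι → E} (hv : AffineIndependent ℝ v) {l : ι → ℝ} (hl : ∑ i, l i = 1) {j : ι}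
    (hj : l j ≠ 0) : AffineIndependent ℝ (Function.update v j (∑ i, l i • v i)) := by
  rw [affineIndependent_iff_sum]
  intro a ha h0
  rw [sum_smul_update] at h0
  have hb := affineIndependent_iff_sum.1 hv _ ((sum_update_weights hl a j).trans ha) h0
  have haj : a j = 0 := by
    have := hb j
    simp only [if_true, zero_add, mul_eq_zero] at this
    exact this.resolve_right hj
  intro i
  by_cases hi : i = j
  · rw [hi, haj]
  · simpa [hi, haj] using hb i

theorem not_affineIndependent_update_of_weight_eq_zero {ι : Type*} [Fintype ι] [DecidableEq ι]
    {v : ι → E} {l : ι → ℝ} (hl : ∑ i, l i = 1) {j : ι}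
    (hj : l j = 0) : ¬ AffineIndependent ℝ (Function.update v j (∑ i, l i • v i)) := by
  intro h
  have := affineIndependent_iff_sum.1 h (fun i => if i = j then -1 else l i) ?_ ?_ j
  · simp at this
  · rw [← Finset.add_sum_erase _ _ (Finset.mem_univ j), if_pos rfl,
      Finset.sum_congr rfl fun i hi => if_neg (Finset.ne_of_mem_erase hi)]
    rw [← Finset.add_sum_erase _ _ (Finset.mem_univ j), hj] at hl
    linarith
  · rw [sum_smul_update]
    refine Finset.sum_eq_zero fun i _ => ?_
    by_cases hi : i = j
    · simp [hi, hj]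
    · simp [hi]

/-- The number s is the weight of the new vertex; the remaining weights x_i - s l_i are nonnegative
and vanish at j. -/
theorem mem_convexHull_update {ι : Type*} [Fintype ι] [DecidableEq ι] {v : ι → E} {l x : ι → ℝ}
    (hl : ∑ i, l i = 1) (hx : ∑ i, x i = 1) {s : ℝ} (hs : 0 ≤ s) {j : ι}
    (h0 : ∀ i, s * l i ≤ x i) (hj : x j = s * l j) :
    ∑ i, x i • v i ∈ convexHull ℝ (range (Function.update v j (∑ i, l i • v i))) := by
  set a : ι → ℝ := fun i => if i = j then s else x i - s * l i with ha
  have hxa : x = fun i => (if i = j then 0 else a i) + a j * l i := by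
    funext i
    by_cases hi : i = j
    · simp [ha, hi, hj]
    · simp [ha, hi]
  refine mem_convexHull_range_iff.2 ⟨a, fun i => ?_, ?_, ?_⟩
  · by_cases hi : i = j
    · simpa [ha, hi] using hs
    · simpa [ha, hi] using h0 i
  · rw [← sum_update_weights hl a j, ← hxa, hx]
  · rw [sum_smul_update, hxa]

/-- Barycentric description of a simplex of the star of a point `∑ i, l i • v i`. -/
theorem exists_of_mem_convexHull_update {ι : Type*} [Fintype ι] [DecidableEq ι] {v : ι → E}
    {l : ι → ℝ} (hl : ∑ i, l i = 1) {j : ι} {y : E}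
    (hy : y ∈ convexHull ℝ (range (Function.update v j (∑ i, l i • v i)))) :
    ∃ (x : ι → ℝ) (s : ℝ), 0 ≤ s ∧ ∑ i, x i = 1 ∧ ∑ i, x i • v i = y ∧ (∀ i, s * l i ≤ x i) ∧
      x j = s * l j := by
  obtain ⟨a, ha, ha1, rfl⟩ := mem_convexHull_range_iff.1 hy
  refine ⟨_, a j, ha j, (sum_update_weights hl a j).trans ha1, (sum_smul_update v l a j).symm,
    fun i => ?_, by simp⟩
  by_cases hi : i = j
  · simp [hi]
  · simpa [hi] using ha i

end StarSubdivision

/-! ### Cochains are flat: star subdivision and Radon points -/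

section CochainRelations

variable {d k : ℕ}

local notation "E" => EuclideanSpace ℝ (Fin d)

theorem OrderedSimplex.carrier_oriented (s : OrderedSimplex d k) :
    s.oriented.carrier = convexHull ℝ (range s.points) := rfl

theorem OrderedSimplex.vertices_oriented (s : OrderedSimplex d k) :
    s.oriented.vertices = range s.points := rfl

theorem OrderedSimplex.oriented_reindex (s : OrderedSimplex d k) {e : Equiv.Perm (Fin (k + 1))}
    (he : Equiv.Perm.sign e = 1) : OrderedSimplex.oriented (s.reindex e) = s.oriented :=
  (Quotient.sound (s := orientationSetoid d k) ⟨e, he, rfl⟩ :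
    OrderedSimplex.oriented s = OrderedSimplex.oriented (s.reindex e)).symm

theorem evalVertices_of_affineIndependent {K : Set E} {f : OrientedSimplex d k → ℝ}
    {v : Fin (k + 1) → E} (h : AffineIndependent ℝ v) (hK : convexHull ℝ (range v) ⊆ K) :
    evalVertices K f v = f (OrderedSimplex.oriented ⟨v, h⟩) := dif_pos ⟨h, hK⟩

theorem evalVertices_of_not_affineIndependent {K : Set E} {f : OrientedSimplex d k → ℝ}
    {v : Fin (k + 1) → E} (h : ¬ AffineIndependent ℝ v) : evalVertices K f v = 0 :=
  dif_neg fun h' => h h'.1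

theorem convexHull_range_subset {K : Set E} (hK : Convex ℝ K) {ι : Type*} {v : ι → E}
    (hv : ∀ i, v i ∈ K) : convexHull ℝ (range v) ⊆ K :=
  convexHull_min (by rintro _ ⟨i, rfl⟩; exact hv i) hK

/-- The simplices with vertices in `T`. -/
def simplicesOn (d k : ℕ) (T : Set (EuclideanSpace ℝ (Fin d))) : Set (OrientedSimplex d k) :=
  {σ | σ.vertices ⊆ T}

theorem simplicesOn_finite {T : Set E} (hT : T.Finite) : (simplicesOn d k T).Finite := by
  have h1 : {v : Fin (k + 1) → E | ∀ i, v i ∈ T}.Finite := by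
    have := Set.Finite.pi (ι := Fin (k + 1)) (t := fun _ => T) fun _ => hT
    exact this.subset fun v hv i _ => hv i
  have h2 : {s : OrderedSimplex d k | ∀ i, s.points i ∈ T}.Finite :=
    Set.Finite.of_finite_image (f := fun s : OrderedSimplex d k => s.points)
      (h1.subset (by rintro _ ⟨s, hs, rfl⟩; exact hs))
      (fun s _ t _ h => Affine.Simplex.ext (congrFun h))
  refine (h2.image OrderedSimplex.oriented).subset fun σ hσ => ?_
  induction σ using Quotient.inductionOn with
  | _ s => exact ⟨s, fun i => hσ ⟨i, rfl⟩, rfl⟩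

theorem simplicesOn_subset {K : Set E} (hK : Convex ℝ K) {T : Set E} (hT : T ⊆ K) :
    simplicesOn d k T ⊆ simplicesIn k K :=
  fun _ hσ => convexHull_min (hσ.trans hT) hK

theorem evalVertices_comp_perm {K : Set E} (hK : Convex ℝ K) {T : Set E} (hT : T ⊆ K)
    {f : OrientedSimplex d k → ℝ} (hf : IsCochainOn (simplicesOn d k T) f)
    {v : Fin (k + 1) → E} (hv : ∀ i, v i ∈ T) (e : Equiv.Perm (Fin (k + 1))) :
    evalVertices K f (v ∘ e) = (Equiv.Perm.sign e : ℤ) * evalVertices K f v := by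
  by_cases h : AffineIndependent ℝ v
  · have h' : AffineIndependent ℝ (v ∘ e) := (affineIndependent_equiv e).2 h
    rw [evalVertices_of_affineIndependent h' (convexHull_range_subset hK fun i => hT (hv _)),
      evalVertices_of_affineIndependent h (convexHull_range_subset hK fun i => hT (hv _))]
    set s : OrderedSimplex d k := ⟨v, h⟩ with hs
    have hr : (⟨v ∘ e, h'⟩ : OrderedSimplex d k) = s.reindex e.symm := rfl
    have hsign : Equiv.Perm.sign e.symm = Equiv.Perm.sign e := Equiv.Perm.sign_symm e
    have hmem : ∀ w : Fin (k + 1) → E, (∀ i, w i ∈ T) → ∀ hw : AffineIndependent ℝ w,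
        OrderedSimplex.oriented (⟨w, hw⟩ : OrderedSimplex d k) ∈ simplicesOn d k T := by
      rintro w hw _ _ ⟨i, rfl⟩
      exact hw i
    rcases Int.units_eq_one_or (Equiv.Perm.sign e) with h1 | h1
    · rw [hr, s.oriented_reindex (hsign.trans h1), h1]
      simp
    · rw [hr, hf.antisymm s e.symm (hsign.trans h1) (hmem v hv h) (hmem (v ∘ e) (fun i => hv _) h'),
        h1]
      simp
  · have h' : ¬ AffineIndependent ℝ (v ∘ e) := fun h' => h ((affineIndependent_equiv e).1 h')
    rw [evalVertices_of_not_affineIndependent h, evalVertices_of_not_affineIndependent h', mul_zero]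

/-- The edge vectors change by a rank-one perturbation of the identity, whose determinant is the
weight l j. -/
theorem sameOrientation_update {v : Fin (k + 1) → E} (hv : AffineIndependent ℝ v)
    {l : Fin (k + 1) → ℝ} (hl : ∑ i, l i = 1) {j : Fin (k + 1)} (hj : 0 < l j) :
    SameOrientation (⟨v, hv⟩ : OrderedSimplex d k)
      ⟨Function.update v j (∑ i, l i • v i), hv.update_of_weight_ne_zero hl hj.ne'⟩ := by
  have he : ∑ i, l i • v i - v 0 = ∑ i : Fin k, l i.succ • (v i.succ - v 0) := by
    have h1 : ∑ i, l i • (v i - v 0) = ∑ i, l i • v i - v 0 := by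
      simp only [smul_sub, Finset.sum_sub_distrib, ← Finset.sum_smul, hl, one_smul]
    rw [← h1, Fin.sum_univ_succ]
    simp
  have hl' : l 0 + ∑ i : Fin k, l i.succ = 1 := by rw [← Fin.sum_univ_succ, hl]
  set e := ∑ i, l i • v i with hedef
  cases j using Fin.cases with
  | zero =>
    refine ⟨1 + Matrix.replicateCol Unit (fun _ : Fin k => (1 : ℝ)) * Matrix.replicateRow Unit
      (fun i : Fin k => - l i.succ), fun i => ?_, ?_⟩
    · simp only [Function.update_self, Function.update_of_ne (Fin.succ_ne_zero i)]
      simp only [Matrix.add_apply, Matrix.one_apply, Matrix.mul_apply, Matrix.replicateCol_apply,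
        Matrix.replicateRow_apply, one_mul, Finset.univ_unique, Finset.sum_const,
        Finset.card_singleton, one_smul, add_smul, ite_smul, zero_smul, neg_smul,
        Finset.sum_add_distrib, Finset.sum_ite_eq, Finset.mem_univ, if_true,
        Finset.sum_neg_distrib, ← he]
      abel
    · rw [Matrix.det_one_add_replicateCol_mul_replicateRow]
      simp only [dotProduct, mul_one, Finset.sum_neg_distrib]
      linarith
  | succ j =>
    refine ⟨1 + Matrix.replicateCol Unit (fun i : Fin k => if i = j then (1 : ℝ) else 0) * Matrix.replicateRow Unit
      (fun i : Fin k => l i.succ - if i = j then 1 else 0), fun i => ?_, ?_⟩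
    · simp only [Function.update_of_ne (Fin.succ_ne_zero j).symm]
      simp only [Matrix.add_apply, Matrix.one_apply, Matrix.mul_apply, Matrix.replicateCol_apply,
        Matrix.replicateRow_apply, Finset.univ_unique, Finset.sum_const,
        Finset.card_singleton, one_smul, add_smul, ite_smul, zero_smul,
        Finset.sum_add_distrib, Finset.sum_ite_eq, Finset.mem_univ, if_true, mul_smul, sub_smul]
      by_cases hi : i = j
      · subst hi
        simpa using he
      · rw [Function.update_of_ne (fun h => hi (Fin.succ_injective _ h))]
        simp [hi]
    · rw [Matrix.det_one_add_replicateCol_mul_replicateRow]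
      simpa [dotProduct] using hj

/-- A point with coordinates x lies in the piece whose index minimises x_i / l_i. If it lies in two
pieces, the weight of the star point is the same in both, which puts it in a simplex of smaller
dimension. -/
theorem isSubdivision_star {v : Fin (k + 1) → E} (hv : AffineIndependent ℝ v)
    {l : Fin (k + 1) → ℝ} (hl0 : ∀ i, 0 ≤ l i) (hl : ∑ i, l i = 1)
    {𝒦 : Finset (OrientedSimplex d k)}
    (h𝒦 : ∀ τ, τ ∈ 𝒦 ↔ ∃ (j : Fin (k + 1)) (hj : l j ≠ 0), τ = OrderedSimplex.oriented
      ⟨Function.update v j (∑ i, l i • v i), hv.update_of_weight_ne_zero hl hj⟩) :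
    IsSubdivision 𝒦 (OrderedSimplex.oriented ⟨v, hv⟩) where
  orientation τ hτ := by
    obtain ⟨j, hj, rfl⟩ := (h𝒦 τ).1 hτ
    exact ⟨_, _, rfl, rfl, sameOrientation_update hv hl (lt_of_le_of_ne (hl0 j) hj.symm)⟩
  nonoverlapping τ hτ τ' hτ' hne := by
    obtain ⟨j, hj, rfl⟩ := (h𝒦 τ).1 hτ
    obtain ⟨j', hj', rfl⟩ := (h𝒦 τ').1 hτ'
    have hjj : j ≠ j' := by rintro rfl; exact hne rfl
    rw [OrderedSimplex.carrier_oriented, OrderedSimplex.carrier_oriented]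
    set e := ∑ i, l i • v i with he
    -- The overlap of pieces j and j' lies in the hull of v with both vertices replaced by e; e is
    -- repeated, so this hull is null.
    set w := Function.update (Function.update v j e) j' e with hw
    have hw0 : gramVolume w = 0 := gramVolume_eq_zero
      (not_affineIndependent_of_eq hjj (by simp [hw, Function.update_of_ne hjj]))
    refine measure_mono_null (t := convexHull ℝ (range w)) ?_ (by
      rw [euclideanHausdorffMeasure_convexHull, hw0]; simp)
    rintro y ⟨hy, hy'⟩
    obtain ⟨x, s, hs, hx1, hxy, hx, hxj⟩ := exists_of_mem_convexHull_update hl hy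
    obtain ⟨x', s', hs', hx1', hxy', hx', hxj'⟩ := exists_of_mem_convexHull_update hl hy'
    obtain rfl : x = x' := hv.weights_unique (hx1.trans hx1'.symm) (hxy.trans hxy'.symm)
    have hpos : ∀ i, l i ≠ 0 → 0 < l i := fun i hi => lt_of_le_of_ne (hl0 i) hi.symm
    have hss : s = s' := by
      refine le_antisymm ?_ ?_
      · have := hx j'; rw [hxj'] at this
        exact le_of_mul_le_mul_right this (hpos j' hj')
      · have := hx' j; rw [hxj] at this
        exact le_of_mul_le_mul_right this (hpos j hj)
    subst hss
    set a : Fin (k + 1) → ℝ := fun i => if i = j then s else x i - s * l i with ha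
    have hxa : x = fun i => (if i = j then 0 else a i) + a j * l i := by
      funext i
      by_cases hi : i = j
      · simp [ha, hi, hxj]
      · simp [ha, hi]
    have haj' : a j' = 0 := by simp [ha, hjj.symm, hxj']
    have ha0 : ∀ i, 0 ≤ a i := fun i => by
      by_cases hi : i = j
      · simpa [ha, hi] using hs
      · simpa [ha, hi] using hx i
    refine mem_convexHull_range_iff.2 ⟨a, ha0, ?_, ?_⟩
    · rw [← sum_update_weights hl a j, ← hxa, hx1]
    · calc ∑ i, a i • w i = ∑ i, a i • Function.update v j e i := by
            refine Finset.sum_congr rfl fun i _ => ?_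
            by_cases hi : i = j'
            · rw [hi, haj', zero_smul, zero_smul]
            · rw [hw, Function.update_of_ne hi]
        _ = ∑ i, x i • v i := by
            rw [he, sum_smul_update]
            exact Finset.sum_congr rfl fun i _ => by rw [congrFun hxa i]
        _ = y := hxy
  union := by
    rw [OrderedSimplex.carrier_oriented]
    refine Subset.antisymm (iUnion₂_subset fun τ hτ => ?_) fun y hy => ?_
    · obtain ⟨j, hj, rfl⟩ := (h𝒦 τ).1 hτ
      rw [OrderedSimplex.carrier_oriented]
      refine convexHull_range_subset (convex_convexHull ℝ _) fun i => ?_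
      refine forall_update_mem ?_ (fun i => subset_convexHull ℝ _ (mem_range_self i)) j i
      exact mem_convexHull_range_iff.2 ⟨l, hl0, hl, rfl⟩
    · obtain ⟨x, hx0, hx1, rfl⟩ := mem_convexHull_range_iff.1 hy
      have hne : (Finset.univ.filter fun i => l i ≠ 0).Nonempty := by
        by_contra h
        rw [Finset.not_nonempty_iff_eq_empty, Finset.filter_eq_empty_iff] at h
        refine zero_ne_one (hl ▸ (Finset.sum_eq_zero fun i hi => ?_).symm)
        simpa using h hi
      obtain ⟨j, hj, hmin⟩ := Finset.exists_min_image _ (fun i => x i / l i) hne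
      have hj' : l j ≠ 0 := (Finset.mem_filter.1 hj).2
      refine mem_iUnion₂.2 ⟨_, (h𝒦 _).2 ⟨j, hj', rfl⟩, ?_⟩
      refine mem_convexHull_update (s := x j / l j) hl hx1 (div_nonneg (hx0 j) (hl0 j))
        (fun i => ?_) (div_mul_cancel₀ _ hj').symm
      by_cases hi : l i = 0
      · rw [hi, mul_zero]; exact hx0 i
      · have hi' : 0 < l i := lt_of_le_of_ne (hl0 i) (Ne.symm hi)
        rw [← le_div_iff₀ hi']
        exact hmin i (by simpa using hi)

theorem evalVertices_eq_sum_update {K : Set E} (hK : Convex ℝ K) {T : Set E} (hT : T ⊆ K)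
    {f : OrientedSimplex d k → ℝ} (hf : IsCochainOn (simplicesOn d k T) f)
    {v : Fin (k + 1) → E} (hvT : ∀ i, v i ∈ T) (hv : AffineIndependent ℝ v)
    {e : E} (heT : e ∈ T) (he : e ∈ convexHull ℝ (range v)) :
    evalVertices K f v = ∑ j, evalVertices K f (Function.update v j e) := by
  classical
  obtain ⟨l, hl0, hl, rfl⟩ := mem_convexHull_range_iff.1 he
  set e := ∑ i, l i • v i with hedef
  set F : {j : Fin (k + 1) // l j ≠ 0} → OrientedSimplex d k := fun j => OrderedSimplex.oriented
      ⟨Function.update v j e, hv.update_of_weight_ne_zero hl j.2⟩ with hF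
  -- A subdivision is a set of simplices, so distinct indices must give distinct pieces for the sum
  -- over the set to equal the sum over indices. The vertex v j tells them apart.
  have hinj : Function.Injective F := by
    rintro ⟨j, hj⟩ ⟨j', hj'⟩ h
    by_contra hne
    have hjj : j ≠ j' := fun h => hne (Subtype.ext h)
    have hvert := congrArg OrientedSimplex.vertices h
    have h1 : v j ∈ range (Function.update v j' e) :=
      ⟨j, Function.update_of_ne hjj _ _⟩
    have h2 : v j ∈ range (Function.update v j e) :=
      hvert.symm.subset h1
    obtain ⟨i, hi⟩ := h2
    by_cases hij : i = j
    · subst hij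
      rw [Function.update_self] at hi
      refine not_affineIndependent_of_eq hjj.symm ?_ (hv.update_of_weight_ne_zero hl hj')
      rw [← hedef, Function.update_self, Function.update_of_ne hjj, hi]
    · rw [Function.update_of_ne hij] at hi
      exact hij (hv.injective hi)
  have hmemT : ∀ j i, Function.update v j e i ∈ T := fun j => forall_update_mem heT hvT j
  have hsub : IsSubdivision (Finset.univ.image F) (OrderedSimplex.oriented ⟨v, hv⟩) := by
    refine isSubdivision_star hv hl0 hl fun τ => ?_
    simp only [Finset.mem_image, Finset.mem_univ, true_and, Subtype.exists, hF]
    exact ⟨fun ⟨j, hj, h⟩ => ⟨j, hj, h.symm⟩, fun ⟨j, hj, h⟩ => ⟨j, hj, h.symm⟩⟩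
  rw [evalVertices_of_affineIndependent hv (convexHull_range_subset hK fun i => hT (hvT _)),
    hf.additive _ ?_ _ ?_ hsub, Finset.sum_image hinj.injOn]
  · rw [← Finset.sum_filter_add_sum_filter_not Finset.univ fun j => l j ≠ 0]
    rw [Finset.sum_eq_zero (s := Finset.univ.filter fun j => ¬ l j ≠ 0), add_zero]
    · rw [Finset.sum_subtype (Finset.univ.filter fun j => l j ≠ 0) (p := fun j => l j ≠ 0)
        (by simp)]
      refine Finset.sum_congr rfl fun j _ => ?_
      rw [evalVertices_of_affineIndependent (hv.update_of_weight_ne_zero hl j.2)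
        (convexHull_range_subset hK fun i => hT (hmemT _ i))]
    · intro j hj
      refine evalVertices_of_not_affineIndependent
        (not_affineIndependent_update_of_weight_eq_zero hl ?_)
      simpa using hj
  · rintro _ ⟨i, rfl⟩
    exact hvT i
  · intro τ hτ
    simp only [Finset.coe_image, Finset.coe_univ, image_univ] at hτ
    obtain ⟨j, rfl⟩ := hτ
    rintro _ ⟨i, rfl⟩
    exact hmemT _ i

/-- Additivity over the star of e, rewritten as a cone formula by moving e to the front of each
piece. For dependent v both sides vanish, because all cones lie in the affine span of v, which is
too small. -/
theorem evalVertices_eq_coboundary {K : Set E} (hK : Convex ℝ K) {T : Set E} (hT : T ⊆ K)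
    {f : OrientedSimplex d k → ℝ} (hf : IsCochainOn (simplicesOn d k T) f)
    {v : Fin (k + 1) → E} (hvT : ∀ i, v i ∈ T)
    {e : E} (heT : e ∈ T) (he : e ∈ convexHull ℝ (range v)) :
    evalVertices K f v =
      coboundary (fun w => evalVertices K f (Fin.cons e w : Fin (k + 1) → E)) v := by
  have hcons : ∀ j : Fin (k + 1),
      (Fin.cons e (j.removeNth v) : Fin (k + 1) → E) = Function.update v j e ∘ j.cycleRange.symm := by
    intro j
    rw [← Fin.cons_removeNth_eq_comp_cycleRange_symm, Function.update_self, Fin.removeNth_update]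
  by_cases hv : AffineIndependent ℝ v
  · rw [evalVertices_eq_sum_update hK hT hf hvT hv heT he]
    refine Finset.sum_congr rfl fun j _ => ?_
    beta_reduce
    rw [hcons, evalVertices_comp_perm hK hT hf (forall_update_mem heT hvT j),
      Equiv.Perm.sign_symm, Fin.sign_cycleRange, zsmul_eq_mul, ← mul_assoc]
    push_cast
    rw [← mul_pow]
    simp
  · rw [evalVertices_of_not_affineIndependent hv]
    refine (Finset.sum_eq_zero fun j _ => ?_).symm
    beta_reduce
    rw [evalVertices_of_not_affineIndependent, smul_zero]
    rw [hcons, affineIndependent_equiv]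
    intro hw
    have h1 : affineSpan ℝ (range (Function.update v j e)) ≤ affineSpan ℝ (range v) := by
      refine affineSpan_le.2 ?_
      rintro _ ⟨i, rfl⟩
      exact forall_update_mem (convexHull_subset_affineSpan _ he)
        (fun i => subset_affineSpan ℝ _ ⟨i, rfl⟩) j i
    refine hv ((affineIndependent_iff_le_finrank_vectorSpan ℝ v (n := k) (by simp)).2 ?_)
    rw [affineIndependent_iff_le_finrank_vectorSpan ℝ _ (n := k) (by simp)] at hw
    refine hw.trans (Submodule.finrank_mono ?_)
    rw [← direction_affineSpan, ← direction_affineSpan]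
    exact AffineSubspace.direction_le h1

/-- The coboundary of a cochain vanishes on degenerate tuples, by finitely many of the cochain
relations. -/
theorem exists_finset_coboundary_eq_zero {K : Set E} (hK : Convex ℝ K) {u : Fin (k + 2) → E}
    (hu : ∀ i, u i ∈ K) (hd : ¬ AffineIndependent ℝ u) :
    ∃ S : Finset (OrientedSimplex d k), (S : Set (OrientedSimplex d k)) ⊆ simplicesIn k K ∧
      ∀ f, IsCochainOn (S : Set (OrientedSimplex d k)) f →
        coboundary (evalVertices K f) u = 0 := by
  -- Removing one vertex leaves one of the two Radon parts intact, so e lies in every face. All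
  -- faces can be coned from the same apex, which makes the coboundary a double coboundary.
  obtain ⟨I, e, he, he'⟩ := Convex.radon_partition hd
  have heu : ∀ i : Fin (k + 2), e ∈ convexHull ℝ (range (i.removeNth u)) := by
    intro i
    by_cases hi : i ∈ I
    · refine convexHull_mono ?_ he'
      rintro _ ⟨j, hj, rfl⟩
      obtain ⟨l, rfl⟩ := Fin.exists_succAbove_eq (x := j) (y := i) (by rintro rfl; exact hj hi)
      exact ⟨l, rfl⟩
    · refine convexHull_mono ?_ he
      rintro _ ⟨j, hj, rfl⟩
      obtain ⟨l, rfl⟩ := Fin.exists_succAbove_eq (x := j) (y := i) (by rintro rfl; exact hi hj)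
      exact ⟨l, rfl⟩
  set T : Set E := insert e (range u) with hTdef
  have hT : T ⊆ K := by
    refine insert_subset ?_ (by rintro _ ⟨i, rfl⟩; exact hu i)
    exact convexHull_range_subset hK (fun i => hu _) (heu 0)
  have hfin : T.Finite := (finite_range u).insert e
  refine ⟨(simplicesOn_finite hfin).toFinset, ?_, fun f hf => ?_⟩
  · rw [Finite.coe_toFinset]; exact simplicesOn_subset hK hT
  · rw [Finite.coe_toFinset] at hf
    have : coboundary (evalVertices K f) u = coboundary (coboundary
        fun w => evalVertices K f (Fin.cons e w : Fin (k + 1) → E)) u := by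
      refine Finset.sum_congr rfl fun i _ => ?_
      rw [evalVertices_eq_coboundary hK hT hf (v := i.removeNth u) (fun j => Or.inr ⟨_, rfl⟩)
        (Or.inl rfl) (heu i)]
    rw [this, coboundary_coboundary]

theorem exists_finset_comp_perm {K : Set E} (hK : Convex ℝ K) {v : Fin (k + 1) → E}
    (hv : ∀ i, v i ∈ K) :
    ∃ S : Finset (OrientedSimplex d k), (S : Set (OrientedSimplex d k)) ⊆ simplicesIn k K ∧
      ∀ f, IsCochainOn (S : Set (OrientedSimplex d k)) f → ∀ e : Equiv.Perm (Fin (k + 1)),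
        evalVertices K f (v ∘ e) = (Equiv.Perm.sign e : ℤ) * evalVertices K f v := by
  have hT : range v ⊆ K := by rintro _ ⟨i, rfl⟩; exact hv i
  refine ⟨(simplicesOn_finite (finite_range v)).toFinset, ?_, fun f hf e => ?_⟩
  · rw [Finite.coe_toFinset]; exact simplicesOn_subset hK hT
  · rw [Finite.coe_toFinset] at hf
    exact evalVertices_comp_perm hK hT hf (fun i => ⟨i, rfl⟩) e

theorem boundaryValue_eq_coboundary {K : Set E} {f : OrientedSimplex d k → ℝ}
    {s : OrderedSimplex d (k + 1)} (hs : s.oriented ∈ simplicesIn (k + 1) K) :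
    boundaryValue f s = coboundary (evalVertices K f) s.points := by
  refine Finset.sum_congr rfl fun i _ => ?_
  have hi : AffineIndependent ℝ (i.removeNth s.points) := (oppositeFace s i).independent
  rw [evalVertices_of_affineIndependent hi]
  · simp only [zsmul_eq_mul]; push_cast; rfl
  · refine (convexHull_mono ?_).trans hs
    rintro _ ⟨j, rfl⟩
    exact ⟨_, rfl⟩

end CochainRelations

/-! ### Alternating forms as orientations -/

section AlternatingDet

variable {V : Type*} [AddCommGroup V] [Module ℝ V]

theorem AlternatingMap.map_sum_smul {n : ℕ} (F : V [⋀^Fin n]→ₗ[ℝ] ℝ)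
    (c : Matrix (Fin n) (Fin n) ℝ) (v : Fin n → V) :
    F (fun i => ∑ j, c i j • v j) = c.det * F v := by
  have h := (F.compLinearMap (Fintype.linearCombination ℝ v)).eq_smul_basis_det
    (Pi.basisFun ℝ (Fin n))
  have h1 := congrArg (fun G => G fun i => c i) h
  simp only [AlternatingMap.compLinearMap_apply, AlternatingMap.smul_apply,
    Pi.basisFun_det_apply, Fintype.linearCombination_apply, Pi.basisFun_apply] at h1
  rw [mul_comm]
  refine h1.trans ?_
  rw [smul_eq_mul]
  congr 2
  · funext i
    simp [Pi.single_apply, ite_smul]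

theorem AlternatingMap.map_cons_sub {n : ℕ} (F : V [⋀^Fin (n + 1)]→ₗ[ℝ] ℝ) (v : Fin (n + 1) → V) :
    F (Fin.cons (v 0) fun i => v i.succ - v 0) = F v := by
  set w : Fin (n + 1) → V := Fin.cons (v 0) fun i => v i.succ - v 0 with hw
  have h := F.map_sum_smul (Matrix.of fun i j => (if i = j then 1 else 0) +
    (if j = 0 ∧ i ≠ 0 then 1 else 0)) w
  rw [Matrix.det_of_isLowerTriangular] at h
  · have h1 : ∏ i : Fin (n + 1), (Matrix.of fun i j : Fin (n + 1) => (if i = j then (1 : ℝ) else 0) +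
        (if j = 0 ∧ i ≠ 0 then 1 else 0)) i i = 1 := by
      refine Finset.prod_eq_one fun i _ => ?_
      by_cases hi : i = 0 <;> simp [hi]
    rw [h1, one_mul] at h
    rw [← h]
    congr 1
    funext i
    simp only [Matrix.of_apply, add_smul, ite_smul, one_smul, zero_smul, Finset.sum_add_distrib,
      Finset.sum_ite_eq, Finset.mem_univ, if_true]
    refine Fin.cases ?_ (fun i => ?_) i
    · simp [hw]
    · rw [Finset.sum_eq_single 0]
      · simp [hw, Fin.succ_ne_zero]
      · intro j _ hj
        simp [hj]
      · simp
  · intro i j hij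
    have hij' : i < j := hij
    have : j ≠ 0 := ((Fin.zero_le i).trans_lt hij').ne'
    simp [hij'.ne, this]

/-- The value of an alternating map on the vertices of a simplex is multiplied by the determinant of
the change of the edge vectors. -/
theorem AlternatingMap.map_eq_det_mul {n : ℕ} (F : V [⋀^Fin (n + 1)]→ₗ[ℝ] ℝ)
    {v w : Fin (n + 1) → V} {c : Matrix (Fin n) (Fin n) ℝ} {b : Fin n → ℝ}
    (hc : ∀ i, w i.succ - w 0 = ∑ j, c i j • (v j.succ - v 0))
    (hb : w 0 = v 0 + ∑ j, b j • (v j.succ - v 0)) :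
    F w = c.det * F v := by
  rw [← F.map_cons_sub w, ← F.map_cons_sub v]
  have h1 := (F.curryLeft (w 0)).map_sum_smul c fun j => v j.succ - v 0
  simp only [AlternatingMap.curryLeft_apply_apply, Matrix.vecCons] at h1
  simp only [hc]
  rw [h1]
  congr 1
  have h2 : F.curryLeft (w 0) (fun j => v j.succ - v 0) =
      F.curryLeft (v 0) (fun j => v j.succ - v 0) := by
    let L : V →ₗ[ℝ] ℝ :=
      { toFun := fun x => F.curryLeft x fun j => v j.succ - v 0
        map_add' := fun x y => by rw [map_add, AlternatingMap.add_apply]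
        map_smul' := fun r x => by rw [map_smul, AlternatingMap.smul_apply, RingHom.id_apply] }
    change L (w 0) = L (v 0)
    rw [hb, map_add, map_sum, Finset.sum_eq_zero, add_zero]
    intro j _
    rw [map_smul]
    change b j • F.curryLeft _ _ = 0
    rw [AlternatingMap.curryLeft_apply_apply]
    rw [F.map_eq_zero_of_eq _ (i := 0) (j := j.succ) (by simp) (Fin.succ_ne_zero j).symm, smul_zero]
  exact h2

/-- The determinant in the basis v of the span, composed with a linear projection onto the span. -/
theorem exists_alternatingMap_ne_zero {n : ℕ} {v : Fin n → V} (hv : LinearIndependent ℝ v) :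
    ∃ D : V [⋀^Fin n]→ₗ[ℝ] ℝ, D v = 1 ∧ ∀ w : Fin n → V,
      (∀ i, w i ∈ Submodule.span ℝ (range v)) → LinearIndependent ℝ w → D w ≠ 0 := by
  set U := Submodule.span ℝ (range v) with hU
  obtain ⟨p, hp⟩ := U.subtype.exists_leftInverse_of_injective U.ker_subtype
  have hpU : ∀ x (hx : x ∈ U), p x = ⟨x, hx⟩ := fun x hx => LinearMap.congr_fun hp ⟨x, hx⟩
  set b := Module.Basis.span hv with hb
  refine ⟨b.det.compLinearMap p, ?_, fun w hw hwi => ?_⟩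
  · rw [AlternatingMap.compLinearMap_apply]
    have : (fun i => p (v i)) = b := by
      funext i
      have hi : v i ∈ U := Submodule.subset_span ⟨i, rfl⟩
      rw [hpU _ hi, Subtype.ext_iff, hb, Module.Basis.span_apply]
    rw [this, Module.Basis.det_self]
  · rw [AlternatingMap.compLinearMap_apply]
    set w' : Fin n → U := fun i => p (w i) with hw'
    have hw'i : LinearIndependent ℝ w' := by
      refine LinearIndependent.of_comp U.subtype ?_
      have : U.subtype ∘ w' = w := by
        funext i
        simp [hw', hpU _ (hw i)]
      rwa [this]
    have hcard : Fintype.card (Fin n) = Module.finrank ℝ U := by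
      rw [Module.finrank_eq_card_basis b]
    have : FiniteDimensional ℝ U := Module.Basis.finiteDimensional_of_finite b
    exact ((Module.Basis.is_basis_iff_det b).1
      ⟨hw'i, hw'i.span_eq_top_of_card_eq_finrank' hcard⟩).ne_zero

end AlternatingDet

/-! ### Homogenisation: simplices as sections of cones -/

section Lift

variable {E : Type*} [AddCommGroup E] [Module ℝ E]

/-- The embedding of `E` in `ℝ × E` as an affine hyperplane. -/
def coneLift (x : E) : ℝ × E := (1, x)

theorem sum_smul_coneLift {ι : Type*} [Fintype ι] (a : ι → ℝ) (v : ι → E) :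
    ∑ i, a i • coneLift (v i) = (∑ i, a i, ∑ i, a i • v i) := by
  simp [coneLift, Prod.ext_iff, Prod.fst_sum, Prod.snd_sum]

theorem linearIndependent_coneLift_iff {ι : Type*} [Fintype ι] {v : ι → E} :
    LinearIndependent ℝ (fun i => coneLift (v i)) ↔ AffineIndependent ℝ v := by
  rw [Fintype.linearIndependent_iff, affineIndependent_iff_sum]
  simp only [sum_smul_coneLift, Prod.mk_eq_zero, and_imp]

theorem mem_convexHull_of_mem_openCone {n : ℕ} {v : Fin n → E} {x : ℝ × E}
    (hx : x ∈ openCone fun i => coneLift (v i)) (hn : n ≠ 0) :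
    0 < x.1 ∧ x.1⁻¹ • x.2 ∈ convexHull ℝ (range v) := by
  obtain ⟨a, ha, rfl⟩ := hx
  rw [sum_smul_coneLift]
  have : Nonempty (Fin n) := ⟨⟨0, Nat.pos_of_ne_zero hn⟩⟩
  have h0 : 0 < ∑ i, a i := Finset.sum_pos (fun i _ => ha i) Finset.univ_nonempty
  refine ⟨h0, mem_convexHull_range_iff.2 ⟨fun i => (∑ i, a i)⁻¹ * a i, fun i => ?_, ?_, ?_⟩⟩
  · exact mul_nonneg (inv_nonneg.2 h0.le) (ha i).le
  · rw [← Finset.mul_sum, inv_mul_cancel₀ h0.ne']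
  · simp only [mul_smul, Finset.smul_sum]

theorem mem_openCone_of_mem_convexHull {n : ℕ} {v : Fin (n + 1) → E} {x : ℝ × E} (h0 : 0 < x.1)
    (hx : x.1⁻¹ • x.2 ∈ convexHull ℝ (range v))
    (hN : ∀ i : Fin (n + 1),
      x ∉ Submodule.span ℝ (range (i.removeNth fun i => coneLift (v i)))) :
    x ∈ openCone fun i => coneLift (v i) := by
  obtain ⟨a, ha, ha1, hax⟩ := mem_convexHull_range_iff.1 hx
  have hxe : x = ∑ i, (x.1 * a i) • coneLift (v i) := by
    rw [sum_smul_coneLift]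
    refine Prod.ext ?_ ?_
    · rw [← Finset.mul_sum, ha1, mul_one]
    · simp only [mul_smul, ← Finset.smul_sum, hax]
      rw [smul_smul, mul_inv_cancel₀ h0.ne', one_smul]
  refine ⟨fun i => x.1 * a i, fun i => mul_pos h0 (lt_of_le_of_ne (ha i) fun h => hN i ?_), hxe⟩
  rw [hxe]
  refine Submodule.sum_mem _ fun j _ => ?_
  by_cases hj : j = i
  · rw [hj, ← h, mul_zero, zero_smul]; exact Submodule.zero_mem _
  · obtain ⟨l, rfl⟩ := Fin.exists_succAbove_eq hj
    exact Submodule.smul_mem _ _ (Submodule.subset_span ⟨l, rfl⟩)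

end Lift

/-! ### Cones with a common interior point come from overlapping simplices -/

section Overlap

variable {E : Type*} [NormedAddCommGroup E] [InnerProductSpace ℝ E] [FiniteDimensional ℝ E]
  [MeasurableSpace E] [BorelSpace E]

/-- Simplices of the same affine span with a common relative interior point overlap. -/
theorem euclideanHausdorffMeasure_inter_ne_zero {k : ℕ} {v w : Fin (k + 1) → E}
    (hv : AffineIndependent ℝ v) {x : ℝ × E}
    (hxv : x ∈ openCone fun i => coneLift (v i)) (hxw : x ∈ openCone fun i => coneLift (w i))
    (hvw : ∀ i, coneLift (v i) ∈ Submodule.span ℝ (range fun i => coneLift (w i))) :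
    μHE[k] (convexHull ℝ (range v) ∩ convexHull ℝ (range w)) ≠ 0 := by
  obtain ⟨hx0, hyv⟩ := mem_convexHull_of_mem_openCone hxv (Nat.succ_ne_zero k)
  set y := x.1⁻¹ • x.2 with hy
  obtain ⟨a, ha, hax⟩ := hxw
  have hcoord : ∀ i, ∃ c : Fin (k + 1) → ℝ, ∑ j, c j • coneLift (w j) = coneLift (v i) := fun i =>
    (Submodule.mem_span_range_iff_exists_fun ℝ).1 (hvw i)
  choose c hc using hcoord
  rw [sum_smul_coneLift] at hax
  have hx1 : x.1 = ∑ i, a i := by rw [hax]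
  have hx2 : x.2 = ∑ i, a i • w i := by rw [hax]
  have hyw : y = ∑ i, (x.1⁻¹ * a i) • w i := by
    rw [hy, hx2, Finset.smul_sum]
    simp only [mul_smul]
  have hc1 : ∀ i, ∑ j, c i j = 1 := fun i => by
    have := hc i
    rw [sum_smul_coneLift] at this
    exact congrArg Prod.fst this
  have hc2 : ∀ i, ∑ j, c i j • w j = v i := fun i => by
    have := hc i
    rw [sum_smul_coneLift] at this
    exact congrArg Prod.snd this
  have hb1 : ∑ j, x.1⁻¹ * a j = 1 := by rw [← Finset.mul_sum, ← hx1, inv_mul_cancel₀ hx0.ne']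
  -- The coordinates of y with respect to w are strictly positive, so a small step from y towards
  -- any v i stays in the simplex w.
  obtain ⟨ε, hε0, hε1, hε⟩ : ∃ ε : ℝ, 0 < ε ∧ ε ≤ 1 ∧
      ∀ i j, 0 ≤ (1 - ε) * (x.1⁻¹ * a j) + ε * c i j := by
    have hev : ∀ᶠ ε : ℝ in nhdsWithin 0 (Ioi 0),
        ∀ i j, 0 ≤ (1 - ε) * (x.1⁻¹ * a j) + ε * c i j := by
      rw [Filter.eventually_all]; intro i
      rw [Filter.eventually_all]; intro j
      have hcont : Continuous fun ε : ℝ => (1 - ε) * (x.1⁻¹ * a j) + ε * c i j := by fun_prop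
      have h0 : (0 : ℝ) < (1 - 0) * (x.1⁻¹ * a j) + 0 * c i j := by
        have := mul_pos (inv_pos.2 hx0) (ha j)
        simpa using this
      exact (hcont.continuousWithinAt.eventually_const_lt h0).mono fun ε h => h.le
    have h1 : ∀ᶠ ε : ℝ in nhdsWithin 0 (Ioi 0), ε ≤ 1 :=
      (eventually_le_nhds zero_lt_one).filter_mono nhdsWithin_le_nhds
    obtain ⟨ε, ⟨h2, h3⟩, h4⟩ := ((hev.and h1).and self_mem_nhdsWithin).exists
    exact ⟨ε, h4, h3, h2⟩
  -- The copy of v shrunk towards y by the factor ε is nondegenerate and lies in both simplices.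
  set z : Fin (k + 1) → E := fun i => (1 - ε) • y + ε • v i with hz
  have hzi : AffineIndependent ℝ z := by
    rw [affineIndependent_iff_sum] at hv ⊢
    intro l hl hl0
    refine hv l hl ?_
    simp only [hz, smul_add, Finset.sum_add_distrib, ← Finset.sum_smul, hl, zero_smul,
      zero_add, smul_comm _ ε, ← Finset.smul_sum] at hl0
    exact (smul_eq_zero.1 hl0).resolve_left hε0.ne'
  have hsub : convexHull ℝ (range z) ⊆ convexHull ℝ (range v) ∩ convexHull ℝ (range w) := by
    refine convexHull_min ?_ ((convex_convexHull ℝ _).inter (convex_convexHull ℝ _))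
    rintro _ ⟨i, rfl⟩
    constructor
    · exact convex_convexHull ℝ _ hyv (subset_convexHull ℝ _ ⟨i, rfl⟩) (by linarith) hε0.le
        (by ring)
    · refine mem_convexHull_range_iff.2 ⟨_, hε i, ?_, ?_⟩
      · rw [Finset.sum_add_distrib, ← Finset.mul_sum Finset.univ _ (1 - ε), hb1,
          ← Finset.mul_sum, hc1]
        ring
      · simp only [add_smul, Finset.sum_add_distrib, mul_smul (1 - ε), mul_smul ε,
          ← Finset.smul_sum, hc2, ← hyw, hz]
  intro h0
  have := measure_mono_null hsub h0
  rw [euclideanHausdorffMeasure_convexHull] at this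
  refine (mul_ne_zero (cornerVolume_ne_zero k) ?_) this
  simpa using gramVolume_pos hzi

end Overlap

/-! ### Flat alternating functions are cochains -/

section CochainOfFlat

variable {d k : ℕ}

local notation "E" => EuclideanSpace ℝ (Fin d)

theorem OrderedSimplex.exists_reindex_eq {s t : OrderedSimplex d k} (h : s.oriented = t.oriented) :
    ∃ e : Equiv.Perm (Fin (k + 1)), Equiv.Perm.sign e = 1 ∧ s.reindex e = t :=
  Quotient.exact (s := orientationSetoid d k) h

theorem SameOrientation.alternatingMap_pos {s t : OrderedSimplex d k} (h : SameOrientation s t)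
    (hts : t.points 0 ∈ convexHull ℝ (range s.points)) (D : (ℝ × E) [⋀^Fin (k + 1)]→ₗ[ℝ] ℝ)
    (hD : 0 < D fun i => coneLift (s.points i)) : 0 < D fun i => coneLift (t.points i) := by
  obtain ⟨c, hc, hdet⟩ := h
  obtain ⟨a, -, ha1, hat⟩ := mem_convexHull_range_iff.1 hts
  have hsub : ∀ x y : E, coneLift x - coneLift y = ((0 : ℝ), x - y) := fun x y => by
    simp [coneLift]
  rw [D.map_eq_det_mul (v := fun i => coneLift (s.points i))
    (w := fun i => coneLift (t.points i)) (c := c) (b := fun j => a j.succ)]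
  · exact mul_pos hdet hD
  · intro i
    simp only [hsub, hc]
    refine Prod.ext ?_ ?_ <;> simp [Prod.fst_sum, Prod.snd_sum]
  · rw [Fin.sum_univ_succ] at ha1 hat
    simp only [hsub]
    refine Prod.ext ?_ ?_
    · simp [coneLift, Prod.fst_sum]
    · have : t.points 0 = s.points 0 + ∑ j : Fin k, a j.succ • (s.points j.succ - s.points 0) := by
        simp only [smul_sub, Finset.sum_sub_distrib, ← Finset.sum_smul]
        rw [← hat, eq_sub_of_add_eq ha1]
        module
      simpa [coneLift, Prod.snd_sum] using this

/-- Lift to cones in ℝ × E. Off the spans of the facets, a point of the cone over σ lies in the open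
cone of exactly one piece: at least one because the pieces cover σ, at most one because they do not
overlap. All pieces are positively oriented for D, so the oriented indicators satisfy the desired
relation, and g inherits it. -/
theorem IsFlatCochain.eq_sum_of_isSubdivision {K : Set E} {g : (Fin (k + 1) → E) → ℝ} (hg : IsFlatCochain K g) {s : OrderedSimplex d k}
    (hs : s.oriented ∈ simplicesIn k K) {𝒦 : Finset (OrientedSimplex d k)}
    (h𝒦 : IsSubdivision 𝒦 s.oriented) (t : OrientedSimplex d k → OrderedSimplex d k)
    (ht : ∀ τ, (t τ).oriented = τ) : g s.points = ∑ τ ∈ 𝒦, g (t τ).points := by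
  classical
  have hcarrier : ∀ τ, τ.carrier = convexHull ℝ (range (t τ).points) := fun τ => by
    conv_lhs => rw [← ht τ]
    rfl
  have hsub : ∀ τ ∈ 𝒦, convexHull ℝ (range (t τ).points) ⊆ convexHull ℝ (range s.points) := by
    intro τ hτ
    rw [← hcarrier, ← s.carrier_oriented, ← h𝒦.union]
    exact subset_biUnion_of_mem (u := fun τ : OrientedSimplex d k => τ.carrier) hτ
  have hslin : LinearIndependent ℝ fun i => coneLift (s.points i) :=
    linearIndependent_coneLift_iff.2 s.independent
  obtain ⟨D, hDs, hD⟩ := exists_alternatingMap_ne_zero hslin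
  set U := Submodule.span ℝ (range fun i => coneLift (s.points i)) with hUdef
  have hU : Module.finrank ℝ U = k + 1 := by
    rw [finrank_span_eq_card hslin, Fintype.card_fin]
  have hmemU : ∀ x ∈ convexHull ℝ (range s.points), coneLift x ∈ U := by
    intro x hx
    obtain ⟨a, -, ha1, rfl⟩ := mem_convexHull_range_iff.1 hx
    have : coneLift (∑ i, a i • s.points i) = ∑ i, a i • coneLift (s.points i) := by
      rw [sum_smul_coneLift, ha1]; rfl
    rw [this]
    exact Submodule.sum_mem _ fun i _ => Submodule.smul_mem _ _ (Submodule.subset_span ⟨i, rfl⟩)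
  have hDt : ∀ τ ∈ 𝒦, 0 < D fun i => coneLift ((t τ).points i) := by
    intro τ hτ
    obtain ⟨s', t', hs', ht', hor⟩ := h𝒦.orientation τ hτ
    obtain ⟨e, he, rfl⟩ := OrderedSimplex.exists_reindex_eq hs'.symm
    obtain ⟨e', he', het⟩ := OrderedSimplex.exists_reindex_eq (ht'.trans (ht τ).symm)
    have h1 : 0 < D fun i => coneLift ((s.reindex e).points i) := by
      have := D.map_perm (fun i => coneLift (s.points i)) e.symm
      rw [Equiv.Perm.sign_symm, he, one_smul] at this
      exact (this.trans hDs).symm ▸ zero_lt_one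
    have h2 : t'.points 0 ∈ convexHull ℝ (range (s.reindex e).points) := by
      have h3 : range (s.reindex e).points = range s.points :=
        e.symm.surjective.range_comp s.points
      have h4 : t'.points 0 ∈ range (t τ).points := by
        rw [← het]
        exact ⟨e' 0, by simp [Affine.Simplex.reindex]⟩
      rw [h3]
      exact hsub τ hτ (subset_convexHull ℝ _ h4)
    have h5 := hor.alternatingMap_pos h2 D h1
    have h6 := D.map_perm (fun i => coneLift (t'.points i)) e'.symm
    rw [Equiv.Perm.sign_symm, he', one_smul] at h6
    rw [← het]
    exact h6.symm ▸ h5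
  -- The index `none` stands for σ itself and will enter with coefficient -1.
  set r : Option (OrientedSimplex d k) → OrderedSimplex d k := fun j => j.elim s t with hr
  set J : Finset (Option (OrientedSimplex d k)) := Finset.insertNone 𝒦 with hJ
  have hrJ : ∀ j ∈ J, convexHull ℝ (range (r j).points) ⊆ convexHull ℝ (range s.points) := by
    rintro (_ | τ) hj
    · exact subset_rfl
    · exact hsub τ (Finset.some_mem_insertNone.1 hj)
  have hrD : ∀ j ∈ J, 0 < D fun i => coneLift ((r j).points i) := by
    rintro (_ | τ) hj
    · exact hDs.symm ▸ zero_lt_one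
    · exact hDt τ (Finset.some_mem_insertNone.1 hj)
  have hrU : ∀ j ∈ J, ∀ i, coneLift ((r j).points i) ∈ U := fun j hj i =>
    hmemU _ (hrJ j hj (subset_convexHull ℝ _ ⟨i, rfl⟩))
  have hrlin : ∀ j, LinearIndependent ℝ fun i => coneLift ((r j).points i) := fun j =>
    linearIndependent_coneLift_iff.2 (r j).independent
  have hspan : ∀ j ∈ J, Submodule.span ℝ (range fun i => coneLift ((r j).points i)) = U := by
    intro j hj
    refine Submodule.eq_of_le_of_finrank_eq (Submodule.span_le.2 ?_) ?_
    · rintro _ ⟨i, rfl⟩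
      exact hrU j hj i
    · rw [finrank_span_eq_card (hrlin j), hU, Fintype.card_fin]
  set 𝒩 : Set (Submodule ℝ (ℝ × E)) := ⋃ j ∈ J, range fun i : Fin (k + 1) =>
    Submodule.span ℝ (range (i.removeNth fun i => coneLift ((r j).points i))) with h𝒩
  have key := sum_eq_zero_of_sum_indicator_eq_zero (n := k + 1) U hU (coneLift '' K)
    (fun v => g fun i => (v i).2) D hD ?_ ?_ J (fun j i => coneLift ((r j).points i)) hrU ?_
    (fun j _ => hrlin j) (fun j => j.elim (-1) fun _ => 1) 𝒩 ?_ ?_ ?_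
  · rw [hJ, Finset.sum_insertNone] at key
    simp only [Option.elim, one_mul, hr] at key
    have h0 : -1 * g s.points + ∑ τ ∈ 𝒦, g (t τ).points = 0 := key
    linarith
  · intro v _ hvK hv
    choose w hwK hwv using hvK
    obtain rfl : v = fun i => coneLift (w i) := funext fun i => (hwv i).symm
    exact hg.degenerate w hwK fun h => hv (linearIndependent_coneLift_iff.2 h)
  -- There are k+2 vectors in a space of dimension k+1, so the tuple is degenerate and flatness
  -- applies.
  · intro u huU huK
    choose w hwK hwu using huK
    obtain rfl : u = fun i => coneLift (w i) := funext fun i => (hwu i).symm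
    refine hg.closed w hwK fun h => ?_
    have h1 : LinearIndependent ℝ fun i => (⟨coneLift (w i), huU i⟩ : U) :=
      LinearIndependent.of_comp U.subtype (linearIndependent_coneLift_iff.2 h)
    have := h1.fintype_card_le_finrank
    rw [hU, Fintype.card_fin] at this
    omega
  · exact fun j hj i => ⟨_, hs (hrJ j hj (subset_convexHull ℝ _ ⟨i, rfl⟩)), rfl⟩
  · exact J.finite_toSet.biUnion fun j _ => finite_range _
  · intro N hN hle
    obtain ⟨j, hj, i, rfl⟩ := mem_iUnion₂.1 hN
    have h1 := Submodule.finrank_mono hle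
    have h2 := finrank_range_le_card (R := ℝ)
      (b := i.removeNth fun i => coneLift ((r j).points i))
    rw [Fintype.card_fin] at h2
    rw [hU] at h1
    exact absurd (h1.trans h2) (by omega)
  · intro x hxU hxN
    have hcone : ∀ j ∈ J, 0 < x.1 → x.1⁻¹ • x.2 ∈ convexHull ℝ (range (r j).points) →
        x ∈ openCone fun i => coneLift ((r j).points i) := fun j hj h0 hx =>
      mem_openCone_of_mem_convexHull h0 hx fun i => hxN _ (mem_iUnion₂.2 ⟨j, hj, i, rfl⟩)
    have hnone : none ∈ J := Finset.none_mem_insertNone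
    have hsome : ∀ τ ∈ 𝒦, some τ ∈ J := fun τ hτ => Finset.some_mem_insertNone.2 hτ
    have hsign : ∀ j ∈ J, (SignType.sign (D fun i => coneLift ((r j).points i)) : ℝ) = 1 :=
      fun j hj => by rw [sign_pos (hrD j hj)]; rfl
    rw [Finset.sum_congr rfl fun j hj => by rw [hsign j hj, mul_one], hJ, Finset.sum_insertNone]
    simp only [Option.elim, one_mul]
    by_cases hx : x ∈ openCone fun i => coneLift ((r none).points i)
    · obtain ⟨h0, hy⟩ := mem_convexHull_of_mem_openCone hx (Nat.succ_ne_zero k)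
      have hy' : x.1⁻¹ • x.2 ∈ ⋃ τ ∈ 𝒦, τ.carrier := by rw [h𝒦.union]; exact hy
      obtain ⟨τ, hτ, hyτ⟩ := mem_iUnion₂.1 hy'
      have hxτ := hcone (some τ) (hsome τ hτ) h0 (by rw [hcarrier] at hyτ; exact hyτ)
      rw [indicator_of_mem hx, Finset.sum_eq_single τ, indicator_of_mem hxτ]
      · simp
      · intro τ' hτ' hne
        rw [indicator_of_notMem]
        intro hxτ'
        refine euclideanHausdorffMeasure_inter_ne_zero (t τ).independent hxτ hxτ' (fun i => ?_) ?_
        · rw [hspan _ (hsome τ' hτ')]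
          exact hrU _ (hsome τ hτ) i
        · have := h𝒦.nonoverlapping τ hτ τ' hτ' hne.symm
          rw [hcarrier τ, hcarrier τ'] at this
          exact this
      · exact fun h => absurd hτ h
    · rw [indicator_of_notMem hx, mul_zero, zero_add]
      refine Finset.sum_eq_zero fun τ hτ => indicator_of_notMem (fun hxτ => hx ?_) _
      obtain ⟨h0, hy⟩ := mem_convexHull_of_mem_openCone hxτ (Nat.succ_ne_zero k)
      exact hcone none hnone h0 (hsub τ hτ hy)

/-- The function of oriented simplices with given values as a function of the vertices. -/
noncomputable def ofVertices (g : (Fin (k + 1) → E) → ℝ) (σ : OrientedSimplex d k) : ℝ :=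
  g (Quotient.out (s := orientationSetoid d k) σ).points

theorem oriented_out (σ : OrientedSimplex d k) :
    OrderedSimplex.oriented (Quotient.out (s := orientationSetoid d k) σ) = σ :=
  Quotient.out_eq (s := orientationSetoid d k) σ

theorem mem_of_oriented_mem {K : Set E} {s : OrderedSimplex d k}
    (hs : s.oriented ∈ simplicesIn k K) (i : Fin (k + 1)) : s.points i ∈ K :=
  hs (subset_convexHull ℝ _ ⟨i, rfl⟩)

theorem ofVertices_oriented {K : Set E} {g : (Fin (k + 1) → E) → ℝ}
    (hg : ∀ v : Fin (k + 1) → E, (∀ i, v i ∈ K) → ∀ e : Equiv.Perm (Fin (k + 1)),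
      g (v ∘ e) = (Equiv.Perm.sign e : ℤ) * g v) {s : OrderedSimplex d k}
    (hs : s.oriented ∈ simplicesIn k K) : ofVertices g s.oriented = g s.points := by
  obtain ⟨e, he, h⟩ := OrderedSimplex.exists_reindex_eq (oriented_out s.oriented).symm
  unfold ofVertices
  rw [← h]
  have := hg s.points (mem_of_oriented_mem hs) e.symm
  rw [Equiv.Perm.sign_symm, he, Units.val_one, Int.cast_one, one_mul] at this
  exact this

theorem evalVertices_ofVertices {K : Set E} (hK : Convex ℝ K) {g : (Fin (k + 1) → E) → ℝ}
    (hg : ∀ v : Fin (k + 1) → E, (∀ i, v i ∈ K) → ∀ e : Equiv.Perm (Fin (k + 1)),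
      g (v ∘ e) = (Equiv.Perm.sign e : ℤ) * g v) (hf : IsFlatCochain K g) {v : Fin (k + 1) → E}
    (hv : ∀ i, v i ∈ K) : evalVertices K (ofVertices g) v = g v := by
  by_cases h : AffineIndependent ℝ v
  · have hsub := convexHull_range_subset hK hv
    rw [evalVertices_of_affineIndependent h hsub]
    exact ofVertices_oriented hg (s := ⟨v, h⟩) hsub
  · rw [evalVertices_of_not_affineIndependent h, hf.degenerate v hv h]

/-- An alternating function of the vertices which is flat on a convex set is a cochain. -/
theorem IsFlatCochain.isCochainOn_ofVertices {K : Set E} {g : (Fin (k + 1) → E) → ℝ} (hf : IsFlatCochain K g)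
    (hg : ∀ v : Fin (k + 1) → E, (∀ i, v i ∈ K) → ∀ e : Equiv.Perm (Fin (k + 1)),
      g (v ∘ e) = (Equiv.Perm.sign e : ℤ) * g v) :
    IsCochainOn (simplicesIn k K) (ofVertices g) where
  antisymm s e he hs hse := by
    rw [ofVertices_oriented hg hs, ofVertices_oriented hg hse]
    have := hg s.points (mem_of_oriented_mem hs) e.symm
    rw [Equiv.Perm.sign_symm, he, Units.val_neg, Units.val_one, Int.cast_neg, Int.cast_one,
      neg_one_mul] at this
    exact this
  additive σ hσ 𝒦 _ h𝒦 := by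
    rw [← oriented_out σ] at hσ h𝒦
    exact hf.eq_sum_of_isSubdivision hσ h𝒦 _ oriented_out

end CochainOfFlat

/-! ### Dyadic grids -/

section GridConstruction

variable {d : ℕ}

local notation "E" => EuclideanSpace ℝ (Fin d)

/-- The index of the cell of side `1 / M` which contains `x`. -/
noncomputable def cellIndex (M : ℝ) (x : EuclideanSpace ℝ (Fin d)) (i : Fin d) : ℤ := ⌊x i * M⌋

theorem dist_le_of_cellIndex_eq {M : ℝ} (hM : 0 < M) {x y : E}
    (h : cellIndex M x = cellIndex M y) : dist x y ≤ (d + 1) / M := by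
  have h1 : ∀ i, |x i - y i| ≤ 1 / M := by
    intro i
    have := Int.abs_sub_lt_one_of_floor_eq_floor (congrFun h i)
    rw [← sub_mul, abs_mul, abs_of_pos hM] at this
    rw [le_div_iff₀ hM]
    exact this.le
  rw [EuclideanSpace.dist_eq]
  refine Real.sqrt_le_iff.2 ⟨by positivity, ?_⟩
  calc ∑ i, dist (x i) (y i) ^ 2 ≤ ∑ _i : Fin d, (1 / M) ^ 2 := by
        refine Finset.sum_le_sum fun i _ => ?_
        rw [Real.dist_eq]
        exact pow_le_pow_left₀ (abs_nonneg _) (h1 i) 2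
    _ = d * (1 / M) ^ 2 := by simp
    _ ≤ (d + 1) ^ 2 * (1 / M) ^ 2 := by
        gcongr
        have : (0 : ℝ) ≤ d := by positivity
        nlinarith
    _ = _ := by ring

open Classical in
/-- A point of `K` in the cell with index `z`. -/
noncomputable def cellPoint (K : Set E) (M : ℝ) (z : Fin d → ℤ) : E :=
  if h : ∃ y ∈ K, cellIndex M y = z then h.choose else 0

theorem cellPoint_spec {K : Set E} (M : ℝ) {x : E} (hx : x ∈ K) :
    cellPoint K M (cellIndex M x) ∈ K ∧
      cellIndex M (cellPoint K M (cellIndex M x)) = cellIndex M x := by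
  have h : ∃ y ∈ K, cellIndex M y = cellIndex M x := ⟨x, hx, rfl⟩
  rw [cellPoint, dif_pos h]
  exact h.choose_spec

theorem image_cellPoint_card {K : Set E} {ρ M : ℕ} (hρ : ∀ x ∈ K, ‖x‖ ≤ ρ) :
    ((fun x => cellPoint K M (cellIndex M x)) '' K).Finite ∧
      ((fun x => cellPoint K M (cellIndex M x)) '' K).ncard ≤ (2 * (ρ * M) + 1) ^ d := by
  classical
  set B : Finset (Fin d → ℤ) := Fintype.piFinset fun _ => Finset.Icc (-(ρ * M : ℕ) : ℤ) (ρ * M : ℕ)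
  have hsub : (fun x => cellPoint K M (cellIndex M x)) '' K ⊆
      ((B.image (cellPoint K M) : Finset E) : Set E) := by
    rintro _ ⟨x, hx, rfl⟩
    rw [Finset.coe_image]
    refine ⟨_, ?_, rfl⟩
    rw [Finset.mem_coe, Fintype.mem_piFinset]
    intro i
    have h1 : |x i| ≤ ρ := (PiLp.norm_apply_le x i).trans (hρ x hx)
    have h2 := abs_le.1 h1
    have hM : (0 : ℝ) ≤ M := by positivity
    rw [Finset.mem_Icc]
    constructor
    · refine Int.le_floor.2 ?_
      push_cast
      nlinarith
    · refine Int.floor_le_iff.2 ?_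
      push_cast
      nlinarith
  refine ⟨(Finset.finite_toSet _).subset hsub, ?_⟩
  calc _ ≤ (B.image (cellPoint K M)).card := by
        rw [← Set.ncard_coe_finset]
        exact Set.ncard_le_ncard hsub (Finset.finite_toSet _)
    _ ≤ B.card := Finset.card_image_le
    _ = _ := by
        rw [Fintype.card_piFinset]
        simp only [Int.card_Icc, Finset.prod_const, Finset.card_univ, Fintype.card_fin]
        congr 1
        omega

/-- Existence of dyadic grids with the expected number of points. -/
theorem exists_dyadicGrid {K : Set E} (hK : Bornology.IsBounded K) :
    ∃ (R : ℝ) (π : ℕ → E → E) (N : ℕ), DyadicGrid K R π ∧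
      ∀ n, (gridPoints K π n).Finite ∧ (gridPoints K π n).ncard ≤ N * 2 ^ (n * d) := by
  obtain ⟨r, hr⟩ := hK.exists_norm_le
  obtain ⟨ρ, hρr⟩ := exists_nat_ge (max r 1)
  have hρ : ∀ x ∈ K, ‖x‖ ≤ ρ := fun x hx => (hr x hx).trans ((le_max_left _ _).trans hρr)
  have hρ1 : (1 : ℝ) ≤ ρ := (le_max_right _ _).trans hρr
  have hρ1' : 1 ≤ ρ := by exact_mod_cast hρ1
  -- A cell of side 1/M has diameter at most (d+1)/M, which is 2^(-n).
  set M : ℕ → ℕ := fun n => 2 ^ n * (d + 1) with hM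
  set π : ℕ → E → E := fun n x => cellPoint K (M n) (cellIndex (M n) x) with hπ
  have hMpos : ∀ n, 0 < M n := fun n => by positivity
  have hcard : ∀ n, (π n '' K).Finite ∧
      (π n '' K).ncard ≤ (3 * ρ * (d + 1)) ^ d * 2 ^ (n * d) := by
    intro n
    obtain ⟨h1, h2⟩ := image_cellPoint_card (M := M n) hρ
    refine ⟨h1, h2.trans ?_⟩
    rw [pow_mul, ← mul_pow]
    refine Nat.pow_le_pow_left ?_ d
    have h3 : 1 ≤ ρ * M n := Nat.mul_pos hρ1' (hMpos n)
    calc 2 * (ρ * M n) + 1 ≤ 3 * (ρ * M n) := by omega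
      _ = _ := by rw [hM]; ring
  refine ⟨2 * ρ, π, (3 * ρ * (d + 1)) ^ d * (1 + 2 ^ d), ⟨?_, ?_, ?_, ?_⟩,
    fun n => ⟨(hcard n).1.union (hcard (n + 1)).1, ?_⟩⟩
  · exact fun n x hx => (cellPoint_spec _ hx).1
  · intro n x hx
    refine (dist_le_of_cellIndex_eq (by exact_mod_cast hMpos n) (cellPoint_spec _ hx).2).trans ?_
    rw [hM]
    push_cast
    rw [div_le_iff₀ (by positivity), one_div, inv_pow, inv_mul_cancel_left₀ (by positivity)]
  · linarith
  · intro x hx y hy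
    refine (dist_le_norm_add_norm x y).trans ?_
    linarith [hρ x hx, hρ y hy]
  · refine (Set.ncard_union_le _ _).trans ((add_le_add (hcard n).2 (hcard (n + 1)).2).trans ?_)
    refine le_of_eq ?_
    rw [add_mul n, pow_add]
    ring

end GridConstruction

/-! ### Random cochains as flat cochains with values in classes of random variables -/

section RandomCochain

open Filter Topology

variable {Ω : Type*} [MeasurableSpace Ω] {P : Measure Ω}

/-- This makes the estimates for group-valued flat cochains available in L^q. -/
theorem isSubadditive_eLpNorm {q : ℝ≥0∞} (hq : 1 ≤ q) :
    IsSubadditive fun f : Ω →ₘ[P] ℝ => eLpNorm f q P where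
  zero := by rw [eLpNorm_congr_ae AEEqFun.coeFn_zero, eLpNorm_zero]
  add f g := by
    rw [eLpNorm_congr_ae (AEEqFun.coeFn_add f g)]
    exact eLpNorm_add_le f.aestronglyMeasurable g.aestronglyMeasurable hq
  neg f := by rw [eLpNorm_congr_ae (AEEqFun.coeFn_neg f), eLpNorm_neg]

section

variable {E : Type*}

theorem measurable_coboundary {n : ℕ} {h : Ω → (Fin n → E) → ℝ}
    (hm : ∀ v, Measurable fun ω => h ω v) (u : Fin (n + 1) → E) :
    Measurable fun ω => coboundary (h ω) u :=
  Finset.measurable_fun_sum _ fun i _ => (hm _).const_smul ((-1 : ℤ) ^ (i : ℕ))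

/-- A measurable random function of tuples, as a function of tuples with values in the classes of
random variables. -/
noncomputable def aeTuple (P : Measure Ω) {n : ℕ} (h : Ω → (Fin n → E) → ℝ)
    (hm : ∀ v, Measurable fun ω => h ω v) (v : Fin n → E) : Ω →ₘ[P] ℝ :=
  AEEqFun.mk (fun ω => h ω v) (hm v).aestronglyMeasurable

theorem coboundary_aeTuple {n : ℕ} {h : Ω → (Fin n → E) → ℝ}
    (hm : ∀ v, Measurable fun ω => h ω v) (u : Fin (n + 1) → E) :
    coboundary (aeTuple P h hm) u = aeTuple P (fun ω => coboundary (h ω))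
      (measurable_coboundary hm) u := by
  refine AEEqFun.toGerm_injective ?_
  change AEEqFun.toGermAddMonoidHom _ = _
  unfold coboundary
  rw [map_sum]
  simp only [map_zsmul]
  change _ = ((fun ω => ∑ i : Fin (n + 1), (-1 : ℤ) ^ (i : ℕ) • h ω (i.removeNth u) : Ω → ℝ) : Germ (ae P) ℝ)
  have : (fun ω => ∑ i : Fin (n + 1), (-1 : ℤ) ^ (i : ℕ) • h ω (i.removeNth u)) =
      ∑ i : Fin (n + 1), (-1 : ℤ) ^ (i : ℕ) • fun ω => h ω (i.removeNth u) := by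
    funext ω
    simp
  rw [this]
  change _ = Germ.coeAddHom (ae P) _
  rw [map_sum]
  simp only [map_zsmul]
  rfl

theorem eLpNorm_aeTuple {n : ℕ} {h : Ω → (Fin n → E) → ℝ}
    (hm : ∀ v, Measurable fun ω => h ω v) (q : ℝ≥0∞) (v : Fin n → E) :
    eLpNorm (aeTuple P h hm v) q P = eLpNorm (fun ω => h ω v) q P :=
  eLpNorm_congr_ae (AEEqFun.coeFn_mk _ _)

end

variable {E : Type*} [NormedAddCommGroup E] [InnerProductSpace ℝ E]

/-- A random function of tuples which is almost surely flat, for each tuple separately. -/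
structure IsRandomFlatCochain (P : Measure Ω) (K : Set E) {n : ℕ} (h : Ω → (Fin n → E) → ℝ) :
    Prop where
  measurable : ∀ v, Measurable fun ω => h ω v
  degenerate : ∀ v : Fin n → E, (∀ i, v i ∈ K) → ¬ AffineIndependent ℝ v → ∀ᵐ ω ∂P, h ω v = 0
  closed : ∀ u : Fin (n + 1) → E, (∀ i, u i ∈ K) → ¬ AffineIndependent ℝ u →
    ∀ᵐ ω ∂P, coboundary (h ω) u = 0

variable {K : Set E}

theorem IsRandomFlatCochain.coboundary_isRandomFlat {n : ℕ} {h : Ω → (Fin n → E) → ℝ}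
    (hh : IsRandomFlatCochain P K h) : IsRandomFlatCochain P K fun ω => coboundary (h ω) :=
  ⟨measurable_coboundary hh.measurable, hh.closed, fun u _ _ =>
    Eventually.of_forall fun ω => coboundary_coboundary (h ω) u⟩

/-- Relations that hold almost surely for each tuple separately become exact identities between
classes, with no common null set needed. -/
theorem IsRandomFlatCochain.isFlatCochain {n : ℕ} {h : Ω → (Fin n → E) → ℝ}
    (hh : IsRandomFlatCochain P K h) : IsFlatCochain K (aeTuple P h hh.measurable) where
  degenerate v hv hd := AEEqFun.ext ((AEEqFun.coeFn_mk _ _).trans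
    ((show (fun ω => h ω v) =ᵐ[P] 0 from hh.degenerate v hv hd).trans AEEqFun.coeFn_zero.symm))
  closed u hu hd := by
    rw [coboundary_aeTuple]
    exact AEEqFun.ext ((AEEqFun.coeFn_mk _ _).trans
      ((show (fun ω => coboundary (h ω) u) =ᵐ[P] 0 from hh.closed u hu hd).trans
        AEEqFun.coeFn_zero.symm))

variable [FiniteDimensional ℝ E]

theorem IsRandomFlatCochain.eLpNorm_le_of_small {k : ℕ} {h : Ω → (Fin (k + 1) → E) → ℝ}
    (hh : IsRandomFlatCochain P K h) (hK : Convex ℝ K) {q : ℝ≥0∞} (hq : 1 ≤ q) {α : ℝ}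
    (hα : α ∈ Icc (0 : ℝ) 1) {X : ℝ≥0∞}
    (hX : ∀ s : Fin (k + 1) → E, (∀ i, s i ∈ K) → (∀ i j, dist (s i) (s j) ≤ 1) →
      AffineIndependent ℝ s →
      eLpNorm (fun ω => h ω s) q P ≤ X * ENNReal.ofReal (tupleMass α s))
    {R : ℝ} {p : ℕ} (hp : R * (9 / 10) ^ p ≤ 1) (hR : ∀ x ∈ K, ∀ y ∈ K, dist x y ≤ R)
    {s : Fin (k + 1) → E} (hs : ∀ i, s i ∈ K) :
    eLpNorm (fun ω => h ω s) q P ≤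
      2 ^ (p * (k + 1) ^ 2) * X * ENNReal.ofReal (tupleMass α s) := by
  have h1 := hh.isFlatCochain.le_of_small hK (isSubadditive_eLpNorm hq) hα (X := X) ?_ hp hs
    fun i j => hR _ (hs i) _ (hs j)
  · rw [mul_assoc, ← eLpNorm_aeTuple hh.measurable]
    exact h1
  · intro s hs hs1
    rw [eLpNorm_aeTuple]
    by_cases hd : AffineIndependent ℝ s
    · exact hX s hs hs1 hd
    · rw [eLpNorm_congr_ae (show (fun ω => h ω s) =ᵐ[P] 0 from hh.degenerate s hs hd), eLpNorm_zero]
      exact zero_le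

theorem tendsto_incrementBound (k : ℕ) {X Y : ℝ≥0∞} (hX : X ≠ ∞) (hY : Y ≠ ∞) {α β : ℝ}
    (hα : 0 < α) (hβ : 0 < β) (q : ℕ → ℝ) {δ : ℕ → ℝ} (hδ : Tendsto δ atTop (𝓝 0)) :
    Tendsto (fun n => incrementBound k X Y α β (δ n) q) atTop (𝓝 0) := by
  have key : ∀ (c : ℝ) {a : ℝ}, 0 < a →
      Tendsto (fun n => ENNReal.ofReal (c * (2 * δ n) ^ a)) atTop (𝓝 0) := by
    intro c a ha
    have h1 : Tendsto (fun n => (2 * δ n) ^ a) atTop (𝓝 0) := by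
      have := (hδ.const_mul 2).rpow_const (p := a) (Or.inr ha.le)
      rwa [mul_zero, Real.zero_rpow ha.ne'] at this
    simpa using ENNReal.tendsto_ofReal (h1.const_mul c)
  have e1 := ENNReal.Tendsto.const_mul (key (2 ^ (k + 1) * q k) hβ) (Or.inr hY)
  have e2 := ENNReal.Tendsto.const_mul (key (2 ^ k * q (k - 1)) hα) (Or.inr hX)
  have e3 := ENNReal.Tendsto.const_mul e2 (Or.inr (ENNReal.natCast_ne_top k))
  simpa [incrementBound] using e1.add e3

/-- The almost sure limit of the discretised values is the value itself. -/
theorem IsRandomFlatCochain.ae_eq_of_tendsto {k : ℕ} {h : Ω → (Fin (k + 1) → E) → ℝ}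
    [IsFiniteMeasure P] (hh : IsRandomFlatCochain P K h) {q : ℝ≥0∞} (hq : 1 ≤ q)
    {α β : ℝ} (hα : α ∈ Ioc (0 : ℝ) 1) (hβ : β ∈ Ioc (0 : ℝ) 1) {X Y : ℝ≥0∞} (hX : X ≠ ∞)
    (hY : Y ≠ ∞)
    (hhX : ∀ s : Fin (k + 1) → E, (∀ i, s i ∈ K) →
      eLpNorm (fun ω => h ω s) q P ≤ X * ENNReal.ofReal (tupleMass α s))
    (hhY : ∀ s : Fin (k + 2) → E, (∀ i, s i ∈ K) →
      eLpNorm (fun ω => coboundary (h ω) s) q P ≤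
        Y * ENNReal.ofReal (tupleMass (n := k + 1) β s))
    {R : ℝ} {π : ℕ → E → E} (hπ : DyadicGrid K R π) {v : Fin (k + 1) → E} (hv : ∀ i, v i ∈ K)
    {f : Ω → ℝ} (hf : ∀ᵐ ω ∂P, Tendsto (fun n => h ω fun i => π n (v i)) atTop (𝓝 (f ω))) :
    f =ᵐ[P] fun ω => h ω v := by
  have hhalf : Tendsto (fun n : ℕ => ((1 : ℝ) / 2) ^ n) atTop (𝓝 0) :=
    tendsto_pow_atTop_nhds_zero_of_lt_one (by norm_num) (by norm_num)
  -- The increment estimate in L^q, for moving all vertices from the grid points of level n to v.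
  have hbound : ∀ n, eLpNorm ((fun ω => h ω fun i => π n (v i)) - fun ω => h ω v) q P ≤
      (k + 1 : ℕ) * incrementBound k X Y α β ((1 / 2) ^ n) (fun j => R ^ j) := by
    intro n
    have hδ : ((1 : ℝ) / 2) ^ n ≤ R := by
      have : ((1 : ℝ) / 2) ^ n ≤ 1 := pow_le_one₀ (by norm_num) (by norm_num)
      linarith [hπ.two_le]
    have hV := volumeBound_pow (δ := (1 / 2) ^ n) (by positivity) hδ v
      (fun i j => hπ.diam_le _ (hv i) _ (hv j)) k
    have h1 := hh.isFlatCochain.sub_le (isSubadditive_eLpNorm hq) (Ioc_subset_Icc_self hα)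
      (Ioc_subset_Icc_self hβ) (X := X) (Y := Y)
      (fun s hs => by rw [eLpNorm_aeTuple]; exact hhX s hs)
      (fun s hs => by
        rw [coboundary_aeTuple, eLpNorm_aeTuple (measurable_coboundary hh.measurable)]
        exact hhY s hs)
      hV (s := fun i => π n (v i)) (w := v) (fun i => hπ.mem n _ (hv i))
      (fun i => hπ.dist_le n _ (hv i)) hv (fun i => by simp)
    refine le_trans (le_of_eq (eLpNorm_congr_ae ?_)) h1
    refine ((AEEqFun.coeFn_sub _ _).trans ?_).symm
    exact (AEEqFun.coeFn_mk _ _).sub (AEEqFun.coeFn_mk _ _)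
  have hlim : Tendsto (fun n => eLpNorm ((fun ω => h ω fun i => π n (v i)) - fun ω => h ω v) q P)
      atTop (𝓝 0) := by
    refine tendsto_of_tendsto_of_tendsto_of_le_of_le tendsto_const_nhds ?_ (fun n => zero_le)
      hbound
    have := ENNReal.Tendsto.const_mul (a := ((k + 1 : ℕ) : ℝ≥0∞))
      (tendsto_incrementBound k hX hY hα.1 hβ.1 (fun j => R ^ j) hhalf)
      (Or.inr (ENNReal.natCast_ne_top _))
    simpa using this
  -- The same sequence converges almost surely to f and in L^q to the value at v; both imply
  -- convergence in measure, where limits are unique.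
  refine tendstoInMeasure_ae_unique (u := atTop)
    (tendstoInMeasure_of_tendsto_ae (fun n => (hh.measurable _).aestronglyMeasurable) hf)
    (tendstoInMeasure_of_tendsto_eLpNorm (zero_lt_one.trans_le hq).ne'
      (fun n => (hh.measurable _).aestronglyMeasurable) (hh.measurable v).aestronglyMeasurable hlim)

end RandomCochain

/-! ### The weighted moment sum over all grid simplices -/

section GridSum

variable {E : Type*} [NormedAddCommGroup E] [InnerProductSpace ℝ E] {k : ℕ}

open Classical in
/-- The weighted sum of the `q`-th powers of the values of `g` on all simplices of a sequence of
finite sets. -/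
noncomputable def gridSum (G : ℕ → Finset E) (q : ℕ) (α a : ℝ) (g : (Fin (k + 1) → E) → ℝ) :
    ℝ≥0∞ :=
  ∑' n : ℕ, ∑ s ∈ (Fintype.piFinset fun _ : Fin (k + 1) => G n).filter (AffineIndependent ℝ ·),
    (‖g s‖ₑ / ENNReal.ofReal (2 ^ ((n : ℝ) * a) * tupleMass α s)) ^ q

/-- The constant in the bound for the expectation of a `gridSum`. -/
noncomputable def gridConstant (N d m q : ℕ) (a : ℝ) : ℝ≥0∞ :=
  ∑' n : ℕ, ((N * 2 ^ (n * d)) ^ m : ℕ) * ((ENNReal.ofReal (2 ^ ((n : ℝ) * a)))⁻¹) ^ q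

/-- A geometric series of ratio 2^(dm - aq): the number of grid tuples grows like 2^(ndm), the
weights decay like 2^(-naq). -/
theorem gridConstant_lt_top {N d m q : ℕ} {a : ℝ} (h : (d : ℝ) * m < a * q) :
    gridConstant N d m q a < ∞ := by
  have hterm : ∀ n : ℕ, (((N * 2 ^ (n * d)) ^ m : ℕ) : ℝ≥0∞) *
      ((ENNReal.ofReal (2 ^ ((n : ℝ) * a)))⁻¹) ^ q =
        (N : ℝ≥0∞) ^ m * (ENNReal.ofReal (2 ^ ((d : ℝ) * m - a * q))) ^ n := by
    intro n
    have h2 : (0 : ℝ) < 2 ^ ((n : ℝ) * a) := by positivity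
    have hN : ((N * 2 ^ (n * d)) ^ m : ℕ) = (ENNReal.ofReal ((N * 2 ^ (n * d)) ^ m : ℕ) : ℝ≥0∞) :=
      (ENNReal.ofReal_natCast _).symm
    have hN' : (N : ℝ≥0∞) = ENNReal.ofReal N := (ENNReal.ofReal_natCast _).symm
    rw [hN, hN', ← ENNReal.ofReal_inv_of_pos h2, ← ENNReal.ofReal_pow (by positivity),
      ← ENNReal.ofReal_pow (by positivity), ← ENNReal.ofReal_pow (by positivity),
      ← ENNReal.ofReal_mul (by positivity), ← ENNReal.ofReal_mul (by positivity)]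
    congr 1
    push_cast
    rw [mul_pow, mul_assoc]
    congr 1
    rw [← pow_mul, ← Real.rpow_neg two_pos.le, ← Real.rpow_natCast _ q, ← Real.rpow_natCast _ n,
      ← Real.rpow_natCast 2, ← Real.rpow_mul two_pos.le, ← Real.rpow_mul two_pos.le,
      ← Real.rpow_add two_pos]
    congr 1
    push_cast
    ring
  unfold gridConstant
  simp only [hterm]
  rw [ENNReal.tsum_mul_left, ENNReal.tsum_geometric]
  refine ENNReal.mul_lt_top (ENNReal.pow_lt_top (ENNReal.natCast_lt_top N)) ?_
  refine ENNReal.inv_lt_top.2 (tsub_pos_of_lt ?_)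
  rw [← ENNReal.ofReal_one, ENNReal.ofReal_lt_ofReal_iff zero_lt_one]
  exact Real.rpow_lt_one_of_one_lt_of_neg one_lt_two (by linarith)

variable {Ω : Type*} [MeasurableSpace Ω] {P : Measure Ω} {h : Ω → (Fin (k + 1) → E) → ℝ}

theorem measurable_gridSum (hm : ∀ v, Measurable fun ω => h ω v) (G : ℕ → Finset E) (q : ℕ)
    (α a : ℝ) : Measurable fun ω => gridSum G q α a (h ω) := by
  unfold gridSum
  refine Measurable.tsum fun n => Finset.measurable_fun_sum _ fun s _ => ?_
  exact ((hm s).enorm.div_const _).pow_const q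

theorem lintegral_enorm_pow_le {f : Ω → ℝ} {q : ℕ} (hq : q ≠ 0) {c : ℝ≥0∞}
    (h : eLpNorm f q P ≤ c) : ∫⁻ ω, ‖f ω‖ₑ ^ q ∂P ≤ c ^ q := by
  have hq' : (q : ℝ) ≠ 0 := by exact_mod_cast hq
  have h1 := eLpNorm_eq_lintegral_rpow_enorm_toReal (μ := P) (f := f) (p := q)
    (by exact_mod_cast hq) (ENNReal.natCast_ne_top q)
  simp only [ENNReal.toReal_natCast, ENNReal.rpow_natCast] at h1
  have h2 : eLpNorm f q P ^ q = ∫⁻ ω, ‖f ω‖ₑ ^ q ∂P := by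
    rw [h1, ← ENNReal.rpow_natCast, ← ENNReal.rpow_mul, one_div_mul_cancel hq', ENNReal.rpow_one]
  rw [← h2]
  gcongr

theorem eLpNorm_le_of_lintegral_le {f : Ω → ℝ} {q : ℕ} (hq : q ≠ 0) {M c : ℝ≥0∞}
    (h : ∫⁻ ω, ‖f ω‖ₑ ^ q ∂P ≤ M * c ^ q) : eLpNorm f q P ≤ M ^ (1 / (q : ℝ)) * c := by
  have hq' : (q : ℝ) ≠ 0 := by exact_mod_cast hq
  rw [eLpNorm_eq_lintegral_rpow_enorm_toReal (by exact_mod_cast hq) (ENNReal.natCast_ne_top q)]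
  simp only [ENNReal.toReal_natCast, ENNReal.rpow_natCast]
  refine (ENNReal.rpow_le_rpow h (by positivity)).trans (le_of_eq ?_)
  rw [ENNReal.mul_rpow_of_nonneg _ _ (by positivity), ← ENNReal.rpow_natCast, ← ENNReal.rpow_mul,
    mul_one_div_cancel hq', ENNReal.rpow_one]

theorem lintegral_gridSum_le (hm : ∀ v, Measurable fun ω => h ω v) {K : Set E} {G : ℕ → Finset E}
    (hG : ∀ n, (G n : Set E) ⊆ K) {N d : ℕ} (hcard : ∀ n, (G n).card ≤ N * 2 ^ (n * d)) {q : ℕ}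
    (hq : q ≠ 0) {α a : ℝ} {X : ℝ≥0∞}
    (hX : ∀ s : Fin (k + 1) → E, (∀ i, s i ∈ K) →
      eLpNorm (fun ω => h ω s) q P ≤ X * ENNReal.ofReal (tupleMass α s)) :
    ∫⁻ ω, gridSum G q α a (h ω) ∂P ≤ gridConstant N d (k + 1) q a * X ^ q := by
  classical
  have hmeas : ∀ (n : ℕ) (s : Fin (k + 1) → E), Measurable fun ω =>
      (‖h ω s‖ₑ / ENNReal.ofReal (2 ^ ((n : ℝ) * a) * tupleMass α s)) ^ q := fun n s =>
    ((hm s).enorm.div_const _).pow_const q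
  unfold gridSum gridConstant
  rw [lintegral_tsum fun n => (Finset.measurable_fun_sum _ fun s _ => hmeas n s).aemeasurable,
    ← ENNReal.tsum_mul_right]
  refine ENNReal.tsum_le_tsum fun n => ?_
  rw [lintegral_finsetSum _ fun s _ => hmeas n s]
  have hterm : ∀ s ∈ (Fintype.piFinset fun _ : Fin (k + 1) => G n).filter (AffineIndependent ℝ ·),
      ∫⁻ ω, (‖h ω s‖ₑ / ENNReal.ofReal (2 ^ ((n : ℝ) * a) * tupleMass α s)) ^ q ∂P ≤
        ((ENNReal.ofReal (2 ^ ((n : ℝ) * a)))⁻¹) ^ q * X ^ q := by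
    intro s hs
    rw [Finset.mem_filter, Fintype.mem_piFinset] at hs
    have hmass := tupleMass_pos α hs.2
    have h2 : (0 : ℝ) < 2 ^ ((n : ℝ) * a) := by positivity
    set w := ENNReal.ofReal (2 ^ ((n : ℝ) * a) * tupleMass α s) with hw
    have hw' : w = ENNReal.ofReal (2 ^ ((n : ℝ) * a)) * ENNReal.ofReal (tupleMass α s) :=
      ENNReal.ofReal_mul h2.le
    simp only [div_eq_mul_inv, mul_pow]
    rw [lintegral_mul_const _ ((hm s).enorm.pow_const q)]
    have h1 := lintegral_enorm_pow_le hq (hX s fun i => hG n (hs.1 i))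
    calc _ ≤ (X * ENNReal.ofReal (tupleMass α s)) ^ q * w⁻¹ ^ q := by gcongr
      _ = (X * ENNReal.ofReal (tupleMass α s) * w⁻¹) ^ q := (mul_pow _ _ _).symm
      _ = ((ENNReal.ofReal (2 ^ ((n : ℝ) * a)))⁻¹ * X) ^ q := by
          congr 1
          rw [hw', ENNReal.mul_inv (Or.inl (by simpa using h2)) (Or.inl ENNReal.ofReal_ne_top)]
          have := ENNReal.mul_inv_cancel (a := ENNReal.ofReal (tupleMass α s))
            (by simpa using hmass) ENNReal.ofReal_ne_top
          calc _ = (ENNReal.ofReal (2 ^ ((n : ℝ) * a)))⁻¹ * X *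
                (ENNReal.ofReal (tupleMass α s) * (ENNReal.ofReal (tupleMass α s))⁻¹) := by ring
            _ = _ := by rw [this, mul_one]
      _ = _ := mul_pow _ _ _
  refine (Finset.sum_le_sum hterm).trans ?_
  rw [Finset.sum_const, nsmul_eq_mul, ← mul_assoc]
  gcongr
  refine (Finset.card_filter_le _ _).trans ?_
  rw [Fintype.card_piFinset]
  simp only [Finset.prod_const, Finset.card_univ, Fintype.card_fin]
  exact Nat.pow_le_pow_left (hcard n) _

/-- Each single term is at most the whole sum; taking the q-th root gives a bound on all grid
simplices at once. -/
theorem abs_le_of_gridSum_le {G : ℕ → Finset E} {q : ℕ} (hq : q ≠ 0) {α a : ℝ}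
    {g : (Fin (k + 1) → E) → ℝ} {T : ℝ≥0∞} (hT : T ≠ ∞) (hgT : gridSum G q α a g ≤ T)
    (n : ℕ) {s : Fin (k + 1) → E} (hs : ∀ i, s i ∈ G n) (hi : AffineIndependent ℝ s) :
    |g s| ≤ T.toReal ^ (1 / (q : ℝ)) * 2 ^ ((n : ℝ) * a) * tupleMass α s := by
  classical
  have hq' : (q : ℝ) ≠ 0 := by exact_mod_cast hq
  have hmass := tupleMass_pos α hi
  have h2 : (0 : ℝ) < 2 ^ ((n : ℝ) * a) := by positivity
  set w := 2 ^ ((n : ℝ) * a) * tupleMass α s with hw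
  have hw0 : 0 < w := mul_pos h2 hmass
  have h1 : (‖g s‖ₑ / ENNReal.ofReal w) ^ q ≤ T := by
    refine le_trans ?_ ((ENNReal.le_tsum n).trans hgT)
    exact Finset.single_le_sum (f := fun s : Fin (k + 1) → E =>
      (‖g s‖ₑ / ENNReal.ofReal (2 ^ ((n : ℝ) * a) * tupleMass α s)) ^ q)
      (fun _ _ => zero_le) (Finset.mem_filter.2 ⟨Fintype.mem_piFinset.2 hs, hi⟩)
  have h3 : ‖g s‖ₑ / ENNReal.ofReal w ≤ T ^ (1 / (q : ℝ)) := by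
    rw [one_div, ENNReal.le_rpow_inv_iff (by positivity), ENNReal.rpow_natCast]
    exact h1
  rw [ENNReal.div_le_iff (by simpa using hw0) ENNReal.ofReal_ne_top] at h3
  have h4 : T ^ (1 / (q : ℝ)) = ENNReal.ofReal (T.toReal ^ (1 / (q : ℝ))) := by
    rw [← ENNReal.ofReal_rpow_of_nonneg ENNReal.toReal_nonneg (by positivity),
      ENNReal.ofReal_toReal hT]
  rw [h4, enorm_le_mul_ofReal_iff (by positivity) hw0.le] at h3
  rw [mul_assoc]
  exact h3

end GridSum

/-! ### Norms of functions of tuples and their measurability -/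

section TupleNorm

open Filter Topology

variable {E : Type*} [NormedAddCommGroup E] [InnerProductSpace ℝ E] {n : ℕ}

/-- The vertex tuples of nondegenerate simplices of diameter at most one with vertices in `K`. -/
def smallTuples (K : Set E) (n : ℕ) : Set (Fin (n + 1) → E) :=
  {v | (∀ i, v i ∈ K) ∧ AffineIndependent ℝ v ∧ Metric.diam (range v) ≤ 1}

/-- The norm of a function of tuples relative to the `α`-mass. -/
noncomputable def tupleNorm (α : ℝ) (K : Set E) (g : (Fin (n + 1) → E) → ℝ) : ℝ≥0∞ :=
  ⨆ v : smallTuples K n, ‖g v‖ₑ / (massConstant n * ENNReal.ofReal (tupleMass α v.1))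

theorem enorm_div_eq {x c m : ℝ} {M : ℝ≥0∞} (hm : 0 < m) (hx : |x| ≤ c * m) (hc : 0 ≤ c)
    (hM : M ≠ 0) (hM' : M ≠ ∞) :
    ‖x‖ₑ / (M * ENNReal.ofReal m) ≤ ENNReal.ofReal c / M := by
  refine ENNReal.div_le_of_le_mul ?_
  rw [← mul_assoc, ENNReal.div_mul_cancel hM hM', enorm_le_mul_ofReal_iff hc hm.le]
  exact hx

theorem tupleNorm_le {α c : ℝ} {K : Set E} {g : (Fin (n + 1) → E) → ℝ} (hc : 0 ≤ c)
    (h : ∀ v : Fin (n + 1) → E, (∀ i, v i ∈ K) → AffineIndependent ℝ v →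
      |g v| ≤ c * tupleMass α v) :
    tupleNorm α K g ≤ ENNReal.ofReal c / massConstant n :=
  iSup_le fun v => enorm_div_eq (tupleMass_pos α v.2.2.1) (h v v.2.1 v.2.2.1) hc
    (massConstant_ne_zero n) (massConstant_ne_top n)

theorem continuous_enorm_div_tupleMass [FiniteDimensional ℝ E] {α : ℝ} (h0 : 0 ≤ α) (h1 : α ≤ 1)
    {K : Set E}
    {g : (Fin (n + 1) → E) → ℝ} (hg : ContinuousOn g {v | ∀ i, v i ∈ K}) :
    Continuous fun v : smallTuples K n =>
      ‖g v‖ₑ / (massConstant n * ENNReal.ofReal (tupleMass α v.1)) := by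
  have heq : (fun v : smallTuples K n =>
      ‖g v‖ₑ / (massConstant n * ENNReal.ofReal (tupleMass α v.1))) =
      fun v : smallTuples K n => ENNReal.ofReal (|g v| / tupleMass α v.1) / massConstant n := by
    funext v
    have hm := tupleMass_pos α v.2.2.1
    rw [ENNReal.ofReal_div_of_pos hm, ← Real.enorm_eq_ofReal_abs, mul_comm, div_eq_mul_inv,
      ENNReal.mul_inv (Or.inl (by simpa using hm)) (Or.inl ENNReal.ofReal_ne_top), ← mul_assoc]
    rfl
  rw [heq]
  refine (ENNReal.continuous_div_const _ (massConstant_ne_zero n)).comp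
    (ENNReal.continuous_ofReal.comp ?_)
  have hg' : Continuous fun v : smallTuples K n => g v.1 :=
    hg.comp_continuous continuous_subtype_val fun v => v.2.1
  exact hg'.abs.div ((continuous_tupleMass h0 h1).comp continuous_subtype_val)
    fun v => (tupleMass_pos α v.2.2.1).ne'

theorem iSup_eq_biSup_of_dense {X : Type*} [TopologicalSpace X] {D : Set X} (hD : Dense D)
    {F : X → ℝ≥0∞} (hF : Continuous F) : ⨆ x, F x = ⨆ x ∈ D, F x := by
  refine le_antisymm (iSup_le fun x => ?_) (iSup₂_le fun x _ => le_iSup F x)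
  have hcl : IsClosed {x | F x ≤ ⨆ x ∈ D, F x} := isClosed_le hF continuous_const
  have : closure D ⊆ {x | F x ≤ ⨆ x ∈ D, F x} :=
    hcl.closure_subset_iff.2 fun y hy => le_iSup₂ (f := fun x (_ : x ∈ D) => F x) y hy
  exact this (hD x)

/-- For continuous g the quotient is continuous on the nondegenerate small tuples, so the supremum
may be taken over a countable dense set of them. -/
theorem measurable_tupleNorm [FiniteDimensional ℝ E] {Ω : Type*} [MeasurableSpace Ω] {α : ℝ}
    (h0 : 0 ≤ α) (h1 : α ≤ 1) {K : Set E} {g : Ω → (Fin (n + 1) → E) → ℝ}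
    (hm : ∀ v : Fin (n + 1) → E, (∀ i, v i ∈ K) → Measurable fun ω => g ω v)
    (hg : ∀ ω, ContinuousOn (g ω) {v | ∀ i, v i ∈ K}) :
    Measurable fun ω => tupleNorm α K (g ω) := by
  have : SecondCountableTopology E := secondCountable_of_proper
  obtain ⟨D, hDc, hD⟩ := TopologicalSpace.exists_countable_dense (smallTuples K n)
  have heq : (fun ω => tupleNorm α K (g ω)) = fun ω => ⨆ v ∈ D,
      ‖g ω v.1‖ₑ / (massConstant n * ENNReal.ofReal (tupleMass α v.1)) := by
    funext ω
    exact iSup_eq_biSup_of_dense hD (continuous_enorm_div_tupleMass h0 h1 (hg ω))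
  rw [heq]
  exact Measurable.biSup D hDc fun v _ => (hm v.1 v.2.1).enorm.div_const _

end TupleNorm

/-! ### Transfer of norms to oriented simplices -/

section FlatNorm

variable {d k : ℕ}

local notation "E" => EuclideanSpace ℝ (Fin d)

theorem oriented_mem_smallSimplicesIn_iff {K : Set E} (hK : Convex ℝ K) (s : OrderedSimplex d k) :
    s.oriented ∈ smallSimplicesIn k K ↔ s.points ∈ smallTuples K k := by
  have h1 : s.oriented ∈ simplicesIn k K ↔ ∀ i, s.points i ∈ K :=
    ⟨mem_of_oriented_mem, fun h => convexHull_range_subset hK h⟩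
  have h2 : Metric.diam s.oriented.carrier = Metric.diam (range s.points) := by
    rw [OrderedSimplex.carrier_oriented, convexHull_diam]
  simp only [smallSimplicesIn, mem_ofPred_eq, smallTuples, h1, h2, s.independent, true_and]

theorem massNorm_ofVertices {K : Set E} {g : (Fin (k + 1) → E) → ℝ}
    (hK : Convex ℝ K)
    (hg : ∀ v : Fin (k + 1) → E, (∀ i, v i ∈ K) → ∀ e : Equiv.Perm (Fin (k + 1)),
      g (v ∘ e) = (Equiv.Perm.sign e : ℤ) * g v) {α : ℝ} (hα : 0 ≤ α) :
    massNorm α K (ofVertices g) = tupleNorm α K g := by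
  have hterm : ∀ s : OrderedSimplex d k, s.oriented ∈ smallSimplicesIn k K →
      ‖ofVertices g s.oriented‖ₑ / simplexMass α k s.oriented.vertices =
        ‖g s.points‖ₑ / (massConstant k * ENNReal.ofReal (tupleMass α s.points)) := by
    intro s hs
    rw [ofVertices_oriented hg hs.1, s.vertices_oriented, simplexMass_range hα s.independent]
  refine le_antisymm (iSup₂_le fun σ hσ => ?_) (iSup_le fun v => ?_)
  · rw [← oriented_out σ] at hσ ⊢
    rw [hterm _ hσ]
    exact le_iSup (fun v : smallTuples K k =>
      ‖g v‖ₑ / (massConstant k * ENNReal.ofReal (tupleMass α v.1)))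
        ⟨_, (oriented_mem_smallSimplicesIn_iff hK _).1 hσ⟩
  · set s : OrderedSimplex d k := ⟨v, v.2.2.1⟩ with hs
    have hsm : s.oriented ∈ smallSimplicesIn k K :=
      (oriented_mem_smallSimplicesIn_iff hK s).2 v.2
    rw [show v.1 = s.points from rfl, ← hterm s hsm]
    exact le_iSup₂ (f := fun σ (_ : σ ∈ smallSimplicesIn k K) =>
      ‖ofVertices g σ‖ₑ / simplexMass α k σ.vertices) s.oriented hsm

theorem boundaryMassNorm_ofVertices {K : Set E} {g : (Fin (k + 1) → E) → ℝ}
    (hK : Convex ℝ K) (hf : IsFlatCochain K g)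
    (hg : ∀ v : Fin (k + 1) → E, (∀ i, v i ∈ K) → ∀ e : Equiv.Perm (Fin (k + 1)),
      g (v ∘ e) = (Equiv.Perm.sign e : ℤ) * g v) {β : ℝ} (hβ : 0 ≤ β) :
    boundaryMassNorm β K (ofVertices g) = tupleNorm (n := k + 1) β K (coboundary g) := by
  have hterm : ∀ s : OrderedSimplex d (k + 1), s.oriented ∈ smallSimplicesIn (k + 1) K →
      ‖boundaryValue (ofVertices g) s‖ₑ / simplexMass β (k + 1) s.oriented.vertices =
        ‖coboundary g s.points‖ₑ /
          (massConstant (k + 1) * ENNReal.ofReal (tupleMass β s.points)) := by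
    intro s hs
    rw [boundaryValue_eq_coboundary hs.1, s.vertices_oriented, simplexMass_range hβ s.independent]
    congr 2
    refine Finset.sum_congr rfl fun i _ => ?_
    rw [evalVertices_ofVertices hK hg hf]
    exact fun j => mem_of_oriented_mem hs.1 _
  refine le_antisymm (iSup₂_le fun s hs => ?_) (iSup_le fun v => ?_)
  · rw [hterm _ hs]
    exact le_iSup (fun v : smallTuples K (k + 1) =>
      ‖coboundary g v‖ₑ / (massConstant (k + 1) * ENNReal.ofReal (tupleMass β v.1)))
        ⟨_, (oriented_mem_smallSimplicesIn_iff hK _).1 hs⟩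
  · set s : OrderedSimplex d (k + 1) := ⟨v, v.2.2.1⟩ with hs
    have hsm : s.oriented ∈ smallSimplicesIn (k + 1) K :=
      (oriented_mem_smallSimplicesIn_iff hK s).2 v.2
    rw [show v.1 = s.points from rfl, ← hterm s hsm]
    exact le_iSup₂ (f := fun (s : OrderedSimplex d (k + 1))
      (_ : s.oriented ∈ smallSimplicesIn (k + 1) K) =>
        ‖boundaryValue (ofVertices g) s‖ₑ / simplexMass β (k + 1) s.oriented.vertices) s hsm

theorem flatNorm_ofVertices {K : Set E} {g : (Fin (k + 1) → E) → ℝ}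
    (hK : Convex ℝ K) (hf : IsFlatCochain K g)
    (hg : ∀ v : Fin (k + 1) → E, (∀ i, v i ∈ K) → ∀ e : Equiv.Perm (Fin (k + 1)),
      g (v ∘ e) = (Equiv.Perm.sign e : ℤ) * g v) {α β : ℝ} (hα : 0 ≤ α) (hβ : 0 ≤ β) :
    flatNorm α β K (ofVertices g) =
      tupleNorm α K g + tupleNorm (n := k + 1) β K (coboundary g) := by
  rw [flatNorm, massNorm_ofVertices hK hg hα, boundaryMassNorm_ofVertices hK hf hg hβ]

/-- Alternating functions of the vertices which are flat and continuous are measurable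
cochains. -/
theorem ofVertices_mem_cochains {K : Set E} {g : (Fin (k + 1) → E) → ℝ}
    (hK : Convex ℝ K) (hKc : IsClosed K) (hf : IsFlatCochain K g)
    (hg : ∀ v : Fin (k + 1) → E, (∀ i, v i ∈ K) → ∀ e : Equiv.Perm (Fin (k + 1)),
      g (v ∘ e) = (Equiv.Perm.sign e : ℤ) * g v)
    (hc : ContinuousOn g {v | ∀ i, v i ∈ K}) : ofVertices g ∈ cochains k K := by
  classical
  refine ⟨hf.isCochainOn_ofVertices hg, ?_⟩
  have hclosed : IsClosed {v : Fin (k + 1) → E | ∀ i, v i ∈ K} := by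
    simp only [ofPred_forall]
    exact isClosed_iInter fun i => hKc.preimage (continuous_apply i)
  have heq : evalVertices K (ofVertices g) =
      {v : Fin (k + 1) → E | ∀ i, v i ∈ K}.piecewise g fun _ => 0 := by
    funext v
    by_cases hv : ∀ i, v i ∈ K
    · rw [piecewise_eq_of_mem _ _ _ (show v ∈ {v : Fin (k + 1) → E | ∀ i, v i ∈ K} from hv),
        evalVertices_ofVertices hK hg hf hv]
    · rw [piecewise_eq_of_notMem _ _ _ (show v ∉ {v : Fin (k + 1) → E | ∀ i, v i ∈ K} from hv)]
      exact dif_neg fun h => hv fun i => h.2 (subset_convexHull ℝ _ ⟨i, rfl⟩)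
  rw [heq]
  exact hc.measurable_piecewise continuousOn_const hclosed.measurableSet

end FlatNorm

/-! ### Construction of the modification -/

section Modification

open Filter Topology

/-- The hypotheses under which values on a dyadic grid are extended to all tuples. -/
structure IsRandomDyadicCochain {E Ω : Type*} [NormedAddCommGroup E] [InnerProductSpace ℝ E]
    [MeasurableSpace Ω] (P : Measure Ω) (K : Set E) (R : ℝ) (π : ℕ → E → E)
    (G : ℕ → Finset E) (q : ℕ) {k : ℕ} (h : Ω → (Fin (k + 1) → E) → ℝ) (α' β' α β : ℝ) :
    Prop where
  grid : DyadicGrid K R π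
  coe_grid : ∀ n, (G n : Set E) = gridPoints K π n
  flat : IsRandomFlatCochain P K h
  degenerate : ∀ ω v, ¬ AffineIndependent ℝ v → h ω v = 0
  alternating : ∀ v : Fin (k + 1) → E, (∀ i, v i ∈ K) → ∀ᵐ ω ∂P,
    ∀ e : Equiv.Perm (Fin (k + 1)), h ω (v ∘ e) = (Equiv.Perm.sign e : ℤ) * h ω v
  q_ne_zero : q ≠ 0
  α_pos : 0 < α
  β_pos : 0 < β
  α_lt : α < α'
  β_lt : β < β'
  α'_le : α' ≤ 1
  β'_le : β' ≤ 1

/-- The sum which controls a random cochain and its coboundary on a dyadic grid. -/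
noncomputable def totalGridSum {E : Type*} [NormedAddCommGroup E] [InnerProductSpace ℝ E]
    (G : ℕ → Finset E) (q : ℕ) {k : ℕ} (α' β' α β : ℝ) (g : (Fin (k + 1) → E) → ℝ) : ℝ≥0∞ :=
  gridSum G q α' (α' - α) g + gridSum (k := k + 1) G q β' (β' - β) (coboundary g)

variable {E : Type*} [NormedAddCommGroup E] [InnerProductSpace ℝ E] [FiniteDimensional ℝ E]
  {Ω : Type*} [MeasurableSpace Ω] {P : Measure Ω} {K : Set E} {R : ℝ} {π : ℕ → E → E}
  {G : ℕ → Finset E} {q k : ℕ} {h : Ω → (Fin (k + 1) → E) → ℝ} {α' β' α β : ℝ}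

theorem measurable_totalGridSum (hm : ∀ v, Measurable fun ω => h ω v) :
    Measurable fun ω => totalGridSum G q α' β' α β (h ω) :=
  (measurable_gridSum hm _ _ _ _).add (measurable_gridSum (measurable_coboundary hm) _ _ _ _)

/-- The properties of a realisation which allow to pass to the limit. -/
structure IsGoodRealisation (K : Set E) (π : ℕ → E → E) (G : ℕ → Finset E) (q : ℕ)
    (α' β' α β : ℝ) (g : (Fin (k + 1) → E) → ℝ) : Prop where
  closed : ∀ u : Fin (k + 2) → E, (∀ i, u i ∈ ⋃ n, gridPoints K π n) → ¬ AffineIndependent ℝ u →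
    coboundary g u = 0
  alternating : ∀ v : Fin (k + 1) → E, (∀ i, v i ∈ ⋃ n, gridPoints K π n) →
    ∀ e : Equiv.Perm (Fin (k + 1)), g (v ∘ e) = (Equiv.Perm.sign e : ℤ) * g v
  sum_ne_top : totalGridSum G q α' β' α β g ≠ ∞

theorem countable_tuples {X : Type*} {S : Set X} (hS : S.Countable) (n : ℕ)
    (p : (Fin n → X) → Prop) : {u : Fin n → X | (∀ i, u i ∈ S) ∧ p u}.Countable := by
  refine (Set.countable_univ_pi (s := fun _ : Fin n => S) fun _ => hS).mono ?_
  exact fun u hu i _ => hu.1 i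

theorem IsRandomDyadicCochain.iUnion_subset (H : IsRandomDyadicCochain P K R π G q h α' β' α β) :
    ⋃ n, gridPoints K π n ⊆ K :=
  Set.iUnion_subset H.grid.gridPoints_subset

/-- Only countably many tuples have all entries in the grids, so the null sets of the individual
relations can be united. -/
theorem IsRandomDyadicCochain.ae_isGoodRealisation
    (H : IsRandomDyadicCochain P K R π G q h α' β' α β)
    (hsum : ∫⁻ ω, totalGridSum G q α' β' α β (h ω) ∂P ≠ ∞) :
    ∀ᵐ ω ∂P, IsGoodRealisation K π G q α' β' α β (h ω) := by
  have hcount : (⋃ n, gridPoints K π n).Countable :=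
    countable_iUnion fun n => H.coe_grid n ▸ (G n).countable_toSet
  have h1 : ∀ᵐ ω ∂P, ∀ u ∈ {u : Fin (k + 2) → E | (∀ i, u i ∈ ⋃ n, gridPoints K π n) ∧
      ¬ AffineIndependent ℝ u}, coboundary (h ω) u = 0 :=
    (ae_ball_iff (countable_tuples hcount _ _)).2 fun u hu =>
      H.flat.closed u (fun i => H.iUnion_subset (hu.1 i)) hu.2
  have h2 : ∀ᵐ ω ∂P, ∀ v ∈ {v : Fin (k + 1) → E | (∀ i, v i ∈ ⋃ n, gridPoints K π n) ∧ True},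
      ∀ e : Equiv.Perm (Fin (k + 1)), h ω (v ∘ e) = (Equiv.Perm.sign e : ℤ) * h ω v :=
    (ae_ball_iff (countable_tuples hcount _ _)).2 fun v hv =>
      H.alternating v fun i => H.iUnion_subset (hv.1 i)
  have h3 : ∀ᵐ ω ∂P, totalGridSum G q α' β' α β (h ω) < ∞ :=
    ae_lt_top (measurable_totalGridSum H.flat.measurable) hsum
  filter_upwards [h1, h2, h3] with ω h1 h2 h3
  exact ⟨fun u hu hd => h1 u ⟨hu, hd⟩, fun v hv => h2 v ⟨hv, trivial⟩, h3.ne⟩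

theorem IsRandomDyadicCochain.isDyadicCochain (H : IsRandomDyadicCochain P K R π G q h α' β' α β)
    {ω : Ω} (hω : IsGoodRealisation K π G q α' β' α β (h ω)) :
    IsDyadicCochain K R π (h ω) ((totalGridSum G q α' β' α β (h ω)).toReal ^ (1 / (q : ℝ)))
      α' β' α β where
  grid := H.grid
  flat := ⟨fun v _ hv => H.degenerate ω v hv, hω.closed⟩
  bound n s hs := by
    by_cases hi : AffineIndependent ℝ s
    · exact abs_le_of_gridSum_le H.q_ne_zero hω.sum_ne_top le_self_add n
        (fun i => Finset.mem_coe.1 (H.coe_grid n ▸ hs i)) hi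
    · rw [H.degenerate ω s hi, abs_zero]
      exact mul_nonneg (by positivity) (tupleMass_nonneg _ _)
  coboundary_bound n s hs := by
    by_cases hi : AffineIndependent ℝ s
    · exact abs_le_of_gridSum_le H.q_ne_zero hω.sum_ne_top le_add_self n
        (fun i => Finset.mem_coe.1 (H.coe_grid n ▸ hs i)) hi
    · rw [hω.closed s (fun i => mem_iUnion.2 ⟨n, hs i⟩) hi, abs_zero]
      exact mul_nonneg (by positivity) (tupleMass_nonneg _ _)
  Z_nonneg := by positivity
  α_pos := H.α_pos
  β_pos := H.β_pos
  α_lt := H.α_lt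
  β_lt := H.β_lt
  α'_le := H.α'_le
  β'_le := H.β'_le

theorem limitConstant_nonneg (k : ℕ) {R α β : ℝ} (hR : 0 ≤ R) (hα : 0 < α) (hβ : 0 < β) :
    0 ≤ limitConstant k R α β := by
  have hrα : (0 : ℝ) < 1 - 2 ^ (-α) := by linarith [two_rpow_neg_lt_one hα]
  have hrβ : (0 : ℝ) < 1 - 2 ^ (-β) := by linarith [two_rpow_neg_lt_one hβ]
  unfold limitConstant
  positivity

/-- The constant in the bound of the norm of the limit. -/
noncomputable def normConstant (k : ℕ) (R α β : ℝ) : ℝ≥0∞ :=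
  ENNReal.ofReal (limitConstant k R α β) / massConstant k +
    ENNReal.ofReal (limitConstant (k + 1) R β β) / massConstant (k + 1)

theorem normConstant_ne_top (k : ℕ) (R α β : ℝ) : normConstant k R α β ≠ ∞ :=
  ENNReal.add_ne_top.2 ⟨ENNReal.div_ne_top ENNReal.ofReal_ne_top (massConstant_ne_zero _),
    ENNReal.div_ne_top ENNReal.ofReal_ne_top (massConstant_ne_zero _)⟩

theorem IsDyadicCochain.tupleNorm_limit_le {g : (Fin (k + 1) → E) → ℝ} {Z : ℝ}
    (hg : IsDyadicCochain K R π g Z α' β' α β) :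
    tupleNorm α K (dyadicLimit π g) +
        tupleNorm (n := k + 1) β K (coboundary (dyadicLimit π g)) ≤
      normConstant k R α β * ENNReal.ofReal Z := by
  have hR : 0 ≤ R := by linarith [hg.grid.two_le]
  have hZ := hg.Z_nonneg
  have hL1 := limitConstant_nonneg k hR hg.α_pos hg.β_pos
  have hL2 := limitConstant_nonneg (k + 1) hR hg.β_pos hg.β_pos
  have e1 := tupleNorm_le (α := α) (K := K) (g := dyadicLimit π g) (mul_nonneg hL1 hZ)
    fun v hv hi => (hg.abs_limit_le hv hi).trans_eq (mul_assoc _ _ _).symm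
  have e2 := tupleNorm_le (n := k + 1) (α := β) (K := K) (g := coboundary (dyadicLimit π g))
    (mul_nonneg hL2 hZ)
    fun v hv hi => (hg.abs_coboundary_limit_le hv hi).trans_eq (mul_assoc _ _ _).symm
  refine (add_le_add e1 e2).trans (le_of_eq ?_)
  rw [ENNReal.ofReal_mul hL1, ENNReal.ofReal_mul hL2, normConstant, add_mul]
  simp only [div_eq_mul_inv]
  ring

/-- A random cochain with bounded moments has a continuous modification. -/
theorem IsRandomDyadicCochain.exists_modification [IsFiniteMeasure P]
    (H : IsRandomDyadicCochain P K R π G q h α' β' α β)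
    (hsum : ∫⁻ ω, totalGridSum G q α' β' α β (h ω) ∂P ≠ ∞) {X Y : ℝ≥0∞} (hX : X ≠ ∞)
    (hY : Y ≠ ∞)
    (hhX : ∀ s : Fin (k + 1) → E, (∀ i, s i ∈ K) →
      eLpNorm (fun ω => h ω s) q P ≤ X * ENNReal.ofReal (tupleMass α' s))
    (hhY : ∀ s : Fin (k + 2) → E, (∀ i, s i ∈ K) →
      eLpNorm (fun ω => coboundary (h ω) s) q P ≤
        Y * ENNReal.ofReal (tupleMass (n := k + 1) β' s)) :
    ∃ g : Ω → (Fin (k + 1) → E) → ℝ,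
      (∀ v : Fin (k + 1) → E, (∀ i, v i ∈ K) → Measurable fun ω => g ω v) ∧
      (∀ v : Fin (k + 1) → E, (∀ i, v i ∈ K) → ∀ᵐ ω ∂P, g ω v = h ω v) ∧
      (∀ ω, IsFlatCochain K (g ω)) ∧
      (∀ ω, ∀ v : Fin (k + 1) → E, (∀ i, v i ∈ K) → ∀ e : Equiv.Perm (Fin (k + 1)),
        g ω (v ∘ e) = (Equiv.Perm.sign e : ℤ) * g ω v) ∧
      (∀ ω, ContinuousOn (g ω) {v | ∀ i, v i ∈ K}) ∧
      (∀ ω, tupleNorm α K (g ω) + tupleNorm (n := k + 1) β K (coboundary (g ω)) < ∞) ∧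
      (∀ ω, (tupleNorm α K (g ω) + tupleNorm (n := k + 1) β K (coboundary (g ω))) ^ q ≤
        normConstant k R α β ^ q * totalGridSum G q α' β' α β (h ω)) := by
  classical
  -- A measurable set of full measure on which the limit exists with all its properties. Off T the
  -- modification is set to 0, so every realisation is a cochain of finite norm.
  obtain ⟨T, hT, hTm, hgood⟩ := (H.ae_isGoodRealisation hsum).exists_measurable_mem
  have hdyadic := fun ω (hω : ω ∈ T) => H.isDyadicCochain (hgood ω hω)
  set g : Ω → (Fin (k + 1) → E) → ℝ := fun ω => if ω ∈ T then dyadicLimit π (h ω) else 0 with hg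
  have hgT : ∀ ω ∈ T, g ω = dyadicLimit π (h ω) := fun ω hω => if_pos hω
  have hgT' : ∀ ω, ω ∉ T → g ω = 0 := fun ω hω => if_neg hω
  have hcob0 : coboundary (0 : (Fin (k + 1) → E) → ℝ) = 0 := by
    funext u; simp [coboundary]
  have hnorm0 : ∀ (n : ℕ) (a : ℝ), tupleNorm a K (0 : (Fin (n + 1) → E) → ℝ) = 0 := by
    intro n a
    simp [tupleNorm]
  have hZq : ∀ ω ∈ T, (ENNReal.ofReal
      ((totalGridSum G q α' β' α β (h ω)).toReal ^ (1 / (q : ℝ)))) ^ q =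
        totalGridSum G q α' β' α β (h ω) := by
    intro ω hω
    have hq' : (q : ℝ) ≠ 0 := by exact_mod_cast H.q_ne_zero
    rw [← ENNReal.ofReal_rpow_of_nonneg ENNReal.toReal_nonneg (by positivity),
      ENNReal.ofReal_toReal (hgood ω hω).sum_ne_top, ← ENNReal.rpow_natCast, ← ENNReal.rpow_mul,
      one_div_mul_cancel hq', ENNReal.rpow_one]
  refine ⟨g, fun v hv => ?_, fun v hv => ?_, fun ω => ?_, fun ω v hv e => ?_, fun ω => ?_,
    fun ω => ?_, fun ω => ?_⟩
  · refine measurable_of_tendsto_metrizable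
      -- Cutting off outside T makes the approximations converge everywhere to g.
      (f := fun n => T.indicator fun ω => h ω fun i => π n (v i))
      (fun n => (H.flat.measurable _).indicator hTm) (tendsto_pi_nhds.2 fun ω => ?_)
    by_cases hω : ω ∈ T
    · simp only [indicator_of_mem hω, hgT ω hω]
      exact (hdyadic ω hω).tendsto hv
    · simp only [indicator_of_notMem hω, hgT' ω hω]
      exact tendsto_const_nhds
  · refine H.flat.ae_eq_of_tendsto (q := q) ?_ ⟨H.α_pos.trans H.α_lt, H.α'_le⟩
      ⟨H.β_pos.trans H.β_lt, H.β'_le⟩ hX hY hhX hhY H.grid hv (f := fun ω => g ω v) ?_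
    · exact_mod_cast Nat.one_le_iff_ne_zero.2 H.q_ne_zero
    · filter_upwards [hT] with ω hω
      rw [hgT ω hω]
      exact (hdyadic ω hω).tendsto hv
  · by_cases hω : ω ∈ T
    · rw [hgT ω hω]
      exact (hdyadic ω hω).isFlatCochain_limit
    · rw [hgT' ω hω]
      exact ⟨fun _ _ _ => rfl, fun u _ _ => congrFun hcob0 u⟩
  · by_cases hω : ω ∈ T
    · rw [hgT ω hω]
      exact (hdyadic ω hω).limit_comp_perm e
        (fun v hv => (hgood ω hω).alternating v hv e) hv
    · simp [hgT' ω hω]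
  · by_cases hω : ω ∈ T
    · rw [hgT ω hω]
      exact (hdyadic ω hω).continuousOn_limit
    · rw [hgT' ω hω]
      exact continuousOn_const
  · by_cases hω : ω ∈ T
    · rw [hgT ω hω]
      exact (hdyadic ω hω).tupleNorm_limit_le.trans_lt
        (ENNReal.mul_lt_top (normConstant_ne_top _ _ _ _).lt_top ENNReal.ofReal_lt_top)
    · rw [hgT' ω hω, hcob0, hnorm0, hnorm0 (k + 1), add_zero]
      exact ENNReal.zero_lt_top
  · by_cases hω : ω ∈ T
    · rw [hgT ω hω, ← hZq ω hω, ← mul_pow]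
      exact pow_le_pow_left' (hdyadic ω hω).tupleNorm_limit_le q
    · rw [hgT' ω hω, hcob0, hnorm0, hnorm0 (k + 1), add_zero, zero_pow H.q_ne_zero]
      exact zero_le

end Modification

/-! ### Moment bounds for the given field -/

section RandomField

variable {d k : ℕ} {Ω : Type*} [MeasurableSpace Ω] {P : Measure Ω}

theorem measurable_evalVertices {K : Set (EuclideanSpace ℝ (Fin d))}
    {A : OrientedSimplex d k → Ω → ℝ} (hA : ∀ σ ∈ simplicesIn k K, Measurable (A σ))
    (v : Fin (k + 1) → EuclideanSpace ℝ (Fin d)) :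
    Measurable fun ω => evalVertices K (fun σ => A σ ω) v := by
  by_cases h : AffineIndependent ℝ v ∧ convexHull ℝ (range v) ⊆ K
  · have : (fun ω => evalVertices K (fun σ => A σ ω) v) = A (OrderedSimplex.oriented ⟨v, h.1⟩) := by
      funext ω
      exact dif_pos h
    rw [this]
    exact hA _ h.2
  · have : (fun ω => evalVertices K (fun σ => A σ ω) v) = fun _ => 0 := by
      funext ω
      exact dif_neg h
    rw [this]
    exact measurable_const

theorem isRandomFlatCochain_evalVertices {K : Set (EuclideanSpace ℝ (Fin d))} (hK : Convex ℝ K)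
    {A : OrientedSimplex d k → Ω → ℝ} (hA : ∀ σ ∈ simplicesIn k K, Measurable (A σ))
    (hrel : ∀ S : Finset (OrientedSimplex d k),
      (S : Set (OrientedSimplex d k)) ⊆ simplicesIn k K →
        ∀ᵐ ω ∂P, IsCochainOn (S : Set (OrientedSimplex d k)) (fun σ => A σ ω)) :
    IsRandomFlatCochain P K fun ω => evalVertices K fun σ => A σ ω where
  measurable := measurable_evalVertices hA
  degenerate v _ hd := Filter.Eventually.of_forall fun ω =>
    evalVertices_of_not_affineIndependent hd
  closed u hu hd := by
    obtain ⟨S, hS, hf⟩ := exists_finset_coboundary_eq_zero hK hu hd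
    filter_upwards [hrel S hS] with ω hω
    exact hf _ hω

theorem eLpNorm_le_of_div_le {f : Ω → ℝ} {q : ℕ} (hq : q ≠ 0) {M c m : ℝ≥0∞} (hc : c ≠ 0)
    (hc' : c ≠ ∞) (hm : m ≠ 0) (hm' : m ≠ ∞)
    (h : (∫⁻ ω, ‖f ω‖ₑ ^ q ∂P) / (c * m) ^ q ≤ M) :
    eLpNorm f q P ≤ M ^ (1 / (q : ℝ)) * c * m := by
  rw [mul_assoc]
  refine eLpNorm_le_of_lintegral_le hq ?_
  rwa [ENNReal.div_le_iff (pow_ne_zero _ (mul_ne_zero hc hm))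
    (ENNReal.pow_ne_top (ENNReal.mul_ne_top hc' hm'))] at h

theorem mem_smallTuples_of_dist_le {E : Type*} [NormedAddCommGroup E] [InnerProductSpace ℝ E]
    {n : ℕ} {K : Set E} {s : Fin (n + 1) → E}
    (hs : ∀ i, s i ∈ K) (hs1 : ∀ i j, dist (s i) (s j) ≤ 1) (hi : AffineIndependent ℝ s) :
    s ∈ smallTuples K n := by
  refine ⟨hs, hi, Metric.diam_le_of_forall_dist_le zero_le_one ?_⟩
  rintro _ ⟨i, rfl⟩ _ ⟨j, rfl⟩
  exact hs1 i j

variable {K : Set (EuclideanSpace ℝ (Fin d))} {A : OrientedSimplex d k → Ω → ℝ} {q : ℕ}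
  {α β : ℝ}

theorem eLpNorm_evalVertices_le (hK : Convex ℝ K) (hq : q ≠ 0) (hα : 0 ≤ α)
    {s : Fin (k + 1) → EuclideanSpace ℝ (Fin d)} (hs : ∀ i, s i ∈ K)
    (hs1 : ∀ i j, dist (s i) (s j) ≤ 1) (hi : AffineIndependent ℝ s) :
    eLpNorm (fun ω => evalVertices K (fun σ => A σ ω) s) q P ≤
      momentBound P q α β K A ^ (1 / (q : ℝ)) * massConstant k *
        ENNReal.ofReal (tupleMass α s) := by
  refine eLpNorm_le_of_div_le hq (massConstant_ne_zero k) (massConstant_ne_top k)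
    (by simpa using tupleMass_pos α hi) ENNReal.ofReal_ne_top ?_
  set σ : OrderedSimplex d k := ⟨s, hi⟩ with hσ
  have hsm : σ.oriented ∈ smallSimplicesIn k K :=
    (oriented_mem_smallSimplicesIn_iff hK σ).2 (mem_smallTuples_of_dist_le hs hs1 hi)
  have h1 : ∀ ω, evalVertices K (fun σ => A σ ω) s = A σ.oriented ω := fun ω =>
    evalVertices_of_affineIndependent hi (convexHull_range_subset hK hs)
  simp only [h1]
  rw [← simplexMass_range hα hi]
  exact (le_iSup₂ (f := fun σ (_ : σ ∈ smallSimplicesIn k K) =>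
    (∫⁻ ω, ‖A σ ω‖ₑ ^ q ∂P) / simplexMass α k σ.vertices ^ q) σ.oriented hsm).trans le_self_add

theorem eLpNorm_coboundary_evalVertices_le (hK : Convex ℝ K) (hq : q ≠ 0) (hβ : 0 ≤ β)
    {s : Fin (k + 2) → EuclideanSpace ℝ (Fin d)} (hs : ∀ i, s i ∈ K)
    (hs1 : ∀ i j, dist (s i) (s j) ≤ 1) (hi : AffineIndependent ℝ s) :
    eLpNorm (fun ω => coboundary (evalVertices K (fun σ => A σ ω)) s) q P ≤
      momentBound P q α β K A ^ (1 / (q : ℝ)) * massConstant (k + 1) *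
        ENNReal.ofReal (tupleMass (n := k + 1) β s) := by
  refine eLpNorm_le_of_div_le hq (massConstant_ne_zero _) (massConstant_ne_top _)
    (by simpa using tupleMass_pos (n := k + 1) β hi) ENNReal.ofReal_ne_top ?_
  set σ : OrderedSimplex d (k + 1) := ⟨s, hi⟩ with hσ
  have hsm : σ.oriented ∈ smallSimplicesIn (k + 1) K :=
    (oriented_mem_smallSimplicesIn_iff hK σ).2 (mem_smallTuples_of_dist_le hs hs1 hi)
  have h1 : ∀ ω, coboundary (evalVertices K (fun σ => A σ ω)) s =
      boundaryValue (fun σ => A σ ω) σ := fun ω => (boundaryValue_eq_coboundary hsm.1).symm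
  simp only [h1]
  rw [← simplexMass_range (n := k + 1) hβ hi]
  exact (le_iSup₂ (f := fun (s : OrderedSimplex d (k + 1))
    (_ : s.oriented ∈ smallSimplicesIn (k + 1) K) =>
      (∫⁻ ω, ‖boundaryValue (fun σ => A σ ω) s‖ₑ ^ q ∂P) /
        simplexMass β (k + 1) s.oriented.vertices ^ q) σ hsm).trans le_add_self

end RandomField

/-! ### Proof of the proposition -/

theorem proposition7p1 (d k : ℕ) (K : Set (EuclideanSpace ℝ (Fin d)))
    (hK : IsCompact K) (hKconv : Convex ℝ K)
    (α' β' : ℝ) (hα' : α' ∈ Set.Ioc (0 : ℝ) 1) (hβ' : β' ∈ Set.Ioc (0 : ℝ) 1)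
    (q : ℕ) (hq : 1 ≤ q)
    (α β : ℝ)
    (hα : α ∈ Set.Ioo 0 (min α' β' - (d : ℝ) * ((k : ℝ) + 1) / (q : ℝ)))
    (hβ : β ∈ Set.Ioo 0 (β' - (d : ℝ) * ((k : ℝ) + 2) / (q : ℝ))) :
    ∃ C : ℝ≥0, ∀ (Ω : Type*) [MeasurableSpace Ω] (P : Measure Ω) [IsProbabilityMeasure P]
      (A : OrientedSimplex d k → Ω → ℝ),
      (∀ σ ∈ simplicesIn k K, Measurable (A σ)) →
      (∀ S : Finset (OrientedSimplex d k), (S : Set (OrientedSimplex d k)) ⊆ simplicesIn k K →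
        ∀ᵐ ω ∂P, IsCochainOn (S : Set (OrientedSimplex d k)) (fun σ => A σ ω)) →
      momentBound P q α' β' K A < ∞ →
      ∃ B : OrientedSimplex d k → Ω → ℝ,
        (∀ σ ∈ simplicesIn k K, Measurable (B σ)) ∧
        (∀ σ ∈ simplicesIn k K, ∀ᵐ ω ∂P, B σ ω = A σ ω) ∧
        (∀ ω, (fun σ => B σ ω) ∈ flatCochains k α β K) ∧
        Measurable (fun ω => flatNorm α β K (fun σ => B σ ω)) ∧
        ∫⁻ ω, flatNorm α β K (fun σ => B σ ω) ^ q ∂P ≤ C * momentBound P q α' β' K A := by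
  have hq0 : q ≠ 0 := Nat.one_le_iff_ne_zero.1 hq
  have hqpos : (0 : ℝ) < q := by exact_mod_cast hq
  obtain ⟨R, π, N, hπ, hcard⟩ := exists_dyadicGrid hK.isBounded
  choose hfin hcard using hcard
  set G : ℕ → Finset (EuclideanSpace ℝ (Fin d)) := fun n => (hfin n).toFinset with hG
  have hGcoe : ∀ n, (G n : Set (EuclideanSpace ℝ (Fin d))) = gridPoints K π n := fun n =>
    (hfin n).coe_toFinset
  have hGK : ∀ n, (G n : Set (EuclideanSpace ℝ (Fin d))) ⊆ K := fun n =>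
    (hGcoe n).subset.trans (hπ.gridPoints_subset n)
  have hGcard : ∀ n, (G n).card ≤ N * 2 ^ (n * d) := fun n => by
    rw [← Set.ncard_eq_toFinset_card _ (hfin n)]
    exact hcard n
  -- The number of rounds of bisection, each shrinking the diameter by 9/10, that bring every
  -- simplex in K to diameter at most one.
  obtain ⟨p, hp⟩ : ∃ p : ℕ, R * (9 / 10 : ℝ) ^ p ≤ 1 := by
    have h0 := (tendsto_pow_atTop_nhds_zero_of_lt_one (r := (9 / 10 : ℝ)) (by norm_num)
      (by norm_num)).const_mul R
    rw [mul_zero] at h0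
    exact (h0.eventually_le_const zero_lt_one).exists
  have hαα' : α < α' - (d : ℝ) * ((k : ℝ) + 1) / q := by
    linarith [hα.2, min_le_left α' β']
  have hd1 : 0 ≤ (d : ℝ) * ((k : ℝ) + 1) / q := by positivity
  have hd2 : 0 ≤ (d : ℝ) * ((k : ℝ) + 2) / q := by positivity
  -- The conditions on α and β are precisely used as d(k+1) < (α'-α)q and d(k+2) < (β'-β)q, which
  -- make the two geometric series converge.
  have hc1 : gridConstant N d (k + 1) q (α' - α) < ∞ := by
    refine gridConstant_lt_top ?_
    rw [← div_lt_iff₀ hqpos]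
    push_cast
    linarith
  have hc2 : gridConstant N d (k + 1 + 1) q (β' - β) < ∞ := by
    refine gridConstant_lt_top ?_
    rw [← div_lt_iff₀ hqpos]
    push_cast
    rw [add_assoc, one_add_one_eq_two]
    linarith [hβ.2]
  -- The cost of bisection, times the normalisation between `simplexMass` and `tupleMass`.
  set c₁ : ℝ≥0∞ := 2 ^ (p * (k + 1) ^ 2) * massConstant k with hc₁
  set c₂ : ℝ≥0∞ := 2 ^ (p * (k + 1 + 1) ^ 2) * massConstant (k + 1) with hc₂
  have hc₁' : c₁ ≠ ∞ := ENNReal.mul_ne_top (ENNReal.pow_ne_top ENNReal.ofNat_ne_top)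
    (massConstant_ne_top _)
  have hc₂' : c₂ ≠ ∞ := ENNReal.mul_ne_top (ENNReal.pow_ne_top ENNReal.ofNat_ne_top)
    (massConstant_ne_top _)
  set D : ℝ≥0∞ := gridConstant N d (k + 1) q (α' - α) * c₁ ^ q +
    gridConstant N d (k + 1 + 1) q (β' - β) * c₂ ^ q with hD
  have hD' : D ≠ ∞ := ENNReal.add_ne_top.2
    ⟨ENNReal.mul_ne_top hc1.ne (ENNReal.pow_ne_top hc₁'),
      ENNReal.mul_ne_top hc2.ne (ENNReal.pow_ne_top hc₂')⟩
  have hL := normConstant_ne_top k R α β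
  -- The constant is fixed before the probability space and the field: the first factor compares
  -- norm and grid sum, the second the mean of the grid sum and the moment bound.
  refine ⟨(normConstant k R α β ^ q * D).toNNReal, fun Ω _ P _ A hA hrel hM => ?_⟩
  rw [ENNReal.coe_toNNReal (ENNReal.mul_ne_top (ENNReal.pow_ne_top hL) hD')]
  set M := momentBound P q α' β' K A with hMdef
  set h : Ω → (Fin (k + 1) → EuclideanSpace ℝ (Fin d)) → ℝ :=
    fun ω => evalVertices K fun σ => A σ ω with hh
  have hflat : IsRandomFlatCochain P K h := isRandomFlatCochain_evalVertices hKconv hA hrel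
  have hq1 : (1 : ℝ≥0∞) ≤ (q : ℝ≥0∞) := by exact_mod_cast hq
  have hMr : M ^ (1 / (q : ℝ)) ≠ ∞ := ENNReal.rpow_ne_top_of_nonneg (by positivity) hM.ne
  have hMq : (M ^ (1 / (q : ℝ))) ^ q = M := by
    rw [← ENNReal.rpow_natCast, ← ENNReal.rpow_mul, one_div_mul_cancel hqpos.ne', ENNReal.rpow_one]
  have hX : ∀ s : Fin (k + 1) → EuclideanSpace ℝ (Fin d), (∀ i, s i ∈ K) →
      eLpNorm (fun ω => h ω s) q P ≤ c₁ * M ^ (1 / (q : ℝ)) * ENNReal.ofReal (tupleMass α' s) := by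
    intro s hs
    refine (hflat.eLpNorm_le_of_small hKconv hq1 (Ioc_subset_Icc_self hα')
      (fun s hs hs1 hi => eLpNorm_evalVertices_le (β := β') hKconv hq0 hα'.1.le hs hs1 hi)
      hp hπ.diam_le hs).trans (le_of_eq ?_)
    rw [← hMdef, hc₁]
    ring
  have hY : ∀ s : Fin (k + 2) → EuclideanSpace ℝ (Fin d), (∀ i, s i ∈ K) →
      eLpNorm (fun ω => coboundary (h ω) s) q P ≤
        c₂ * M ^ (1 / (q : ℝ)) * ENNReal.ofReal (tupleMass (n := k + 1) β' s) := by
    intro s hs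
    refine (hflat.coboundary_isRandomFlat.eLpNorm_le_of_small (k := k + 1) hKconv hq1
      (Ioc_subset_Icc_self hβ')
      (fun s hs hs1 hi => eLpNorm_coboundary_evalVertices_le (α := α') hKconv hq0 hβ'.1.le
        hs hs1 hi) hp hπ.diam_le hs).trans (le_of_eq ?_)
    rw [← hMdef, hc₂]
    ring
  have hsum : ∫⁻ ω, totalGridSum G q α' β' α β (h ω) ∂P ≤ D * M := by
    unfold totalGridSum
    rw [lintegral_add_left (measurable_gridSum hflat.measurable _ _ _ _)]
    refine (add_le_add (lintegral_gridSum_le hflat.measurable hGK hGcard hq0 hX)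
      (lintegral_gridSum_le (k := k + 1) (measurable_coboundary hflat.measurable) hGK hGcard hq0
        hY)).trans (le_of_eq ?_)
    rw [mul_pow c₁, mul_pow c₂, hMq, hD, add_mul, mul_assoc, mul_assoc]
  have H : IsRandomDyadicCochain P K R π G q h α' β' α β :=
    { grid := hπ
      coe_grid := hGcoe
      flat := hflat
      degenerate := fun ω v hv => evalVertices_of_not_affineIndependent hv
      alternating := fun v hv => by
        obtain ⟨S, hS, hf⟩ := exists_finset_comp_perm hKconv hv
        filter_upwards [hrel S hS] with ω hω
        exact hf _ hω
      q_ne_zero := hq0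
      α_pos := hα.1
      β_pos := hβ.1
      α_lt := by linarith
      β_lt := by linarith [hβ.2]
      α'_le := hα'.2
      β'_le := hβ'.2 }
  obtain ⟨g, hgm, hgae, hgflat, hgalt, hgcont, hgtop, hgle⟩ := H.exists_modification
    (hsum.trans_lt (ENNReal.mul_lt_top hD'.lt_top hM)).ne
    (ENNReal.mul_ne_top hc₁' hMr) (ENNReal.mul_ne_top hc₂' hMr) hX hY
  have hnorm : ∀ ω, flatNorm α β K (ofVertices (g ω)) =
      tupleNorm α K (g ω) + tupleNorm (n := k + 1) β K (coboundary (g ω)) := fun ω =>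
    flatNorm_ofVertices hKconv (hgflat ω) (hgalt ω) hα.1.le hβ.1.le
  refine ⟨fun σ ω => ofVertices (g ω) σ, fun σ hσ => ?_, fun σ hσ => ?_, fun ω => ⟨?_, ?_⟩, ?_, ?_⟩
  · rw [← oriented_out σ] at hσ
    exact hgm _ (mem_of_oriented_mem hσ)
  · rw [← oriented_out σ] at hσ
    filter_upwards [hgae _ (mem_of_oriented_mem hσ)] with ω hω
    refine hω.trans ?_
    conv_rhs => rw [← oriented_out σ]
    exact evalVertices_of_affineIndependent _ hσ
  · exact ofVertices_mem_cochains hKconv hK.isClosed (hgflat ω) (hgalt ω) (hgcont ω)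
  · rw [hnorm]
    exact hgtop ω
  · simp only [hnorm]
    refine (measurable_tupleNorm hα.1.le (by linarith [hα'.2]) hgm hgcont).add
      (measurable_tupleNorm hβ.1.le (by linarith [hβ.2, hβ'.2])
        (fun v hv => ?_) fun ω => ?_)
    · exact Finset.measurable_fun_sum _ fun i _ =>
        (hgm _ fun j => hv _).const_smul ((-1 : ℤ) ^ (i : ℕ))
    · unfold coboundary
      refine continuousOn_finsetSum _ fun i _ => ?_
      have hi : ContinuousOn (fun v : Fin (k + 2) → EuclideanSpace ℝ (Fin d) =>
          g ω (i.removeNth v)) {v | ∀ i, v i ∈ K} :=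
        (hgcont ω).comp (Continuous.continuousOn (continuous_pi fun j => continuous_apply _))
          fun v hv j => hv _
      exact hi.const_smul ((-1 : ℤ) ^ (i : ℕ))
  · simp only [hnorm]
    refine (lintegral_mono hgle).trans ?_
    rw [lintegral_const_mul _ (measurable_totalGridSum hflat.measurable), mul_assoc]
    gcongr
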